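/- **Setting.** Let $\mathcal H_1,\mathcal H_2$ be complex Hilbert spaces and $I,J$ countable index sets; $\langle\cdot,\cdot\rangle$ is linear in the first argument. A *spectral matrix algebra* over $I$ is a unital $*$-subalgebra $\mathcal A$ of $B(\ell^2(I))$ (bounded operators being identified with their $I\times I$ matrices) that is a Banach algebra for a norm $\|\cdot\|_{\mathcal A}$, inverse-closed in $B(\ell^2(I))$ (if $A\in\mathcal A$ is invertible in $B(\ell^2(I))$, then $A^{-1}\in\mathcal A$) and solid (if $A\in\mathcal A$ and $|b_{ij}|\le|a_{ij}|$ for all $i,j$, then $B\in\mathcal A$ and $\|B\|_{\mathcal A}\le\|A\|_{\mathcal A}$). A weight $w=(w_i)_{i\in I}$, $w_i>0$, is *$\mathcal A$-admissible* if every $A\in\mathcal A$ defines a bounded operator on $\ell^p_w(I)$ for all $1\le p\le\infty$, where $\|c\|_{\ell^p_w}=\|c\cdot w\|_{\ell^p}$. A frame $\Psi=\{\psi_i\}_{i\in I}$ of $\mathcal H$ is *$\mathcal A$-localised* if its Gram matrix $(\langle\psi_{i'},\psi_i\rangle)_{i,i'}$ lies in $\mathcal A$; $\widetilde\Psi=\{\widetilde\psi_i\}$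 is its canonical dual frame, $C_{\widetilde\Psi}f=(\langle f,\widetilde\psi_i\rangle)_i$, and $\mathcal H_{00}(\Psi)$ is the linear span of $\Psi$. For $1\le p<\infty$, the *co-orbit space* $\mathcal H^p_w(\Psi)$ is the completion of $\mathcal H_{00}(\Psi)$ in the norm $\|f\|_{\mathcal H^p_w(\Psi)}=\|C_{\widetilde\Psi}f\|_{\ell^p_w}$. The space $\mathcal H^\infty_w(\Psi)$ consists of the classes $f=[(f_n)]$ of sequences in $\mathcal H$ for which $(C_{\widetilde\Psi}f)_i:=\lim_n\langle f_n,\widetilde\psi_i\rangle$ exists for all $i$ and $\sup_n\|C_{\widetilde\Psi}f_n\|_{\ell^\infty_w}<\infty$, where sequences with the same limits are identified, with norm $\|C_{\widetilde\Psi}f\|_{\ell^\infty_w}$. All these spaces are regarded as spaces of such classes of sequences, so that $\mathcal H^1_w(\Psi)\subset\mathcal H^p_w(\Psi)\subset\mathcal H^\infty_w(\Psi)$. With $(C_\Psi f)_i=\langle f,\psi_i\rangle$ (extended to the co-orbit spaces), put $\langle f,g\rangle=\sum_i(C_{\widetilde\Psi}f)_i\overline{(C_\Psi g)_i}$ for $f\in\mathcal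 H^p_w(\Psi)$, $g\in\mathcal H^q_{1/w}(\Psi)$, $\frac1p+\frac1q=1$. The tensor product $\mathcal H_1\otimes\mathcal H_2$ is the space of Hilbert–Schmidt operators $\mathcal H_1\to\mathcal H_2$, with $(f_1\otimes f_2)(f)=\langle f,f_1\rangle f_2$. For frames $\Psi_1=\{\psi_{1,i}\}_{i\in I}$ and $\Psi_2=\{\psi_{2,j}\}_{j\in J}$ and $1\le r\le\infty$, the space $\mathcal H^{r,\infty}_w(\Psi_1\otimes\Psi_2)$ (respectively $\mathfrak H^{r,\infty}_w(\Psi_1\otimes\Psi_2)$) consists of the classes $K=[(F_n)]$ of sequences in $\mathcal H_1\otimes\mathcal H_2$ for which $(C_{\widetilde{\Psi_1\otimes\Psi_2}}K)_{i,j}:=\lim_n\langle F_n,\widetilde\psi_{1,i}\otimes\widetilde\psi_{2,j}\rangle$ exists for all $i,j$ and the arrays $(\langle F_n,\widetilde\psi_{1,i}\otimes\widetilde\psi_{2,j}\rangle)_{i,j}$ are bounded in $\ell^{r,\infty}_w(I\times J)$ (respectively $\mathfrak l^{r,\infty}_w(I\times J)$); sequences with the same limits are identified, and the norm of $K$ is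 that of $C_{\widetilde{\Psi_1\otimes\Psi_2}}K$. Here $$\|c\|_{\ell^{r,\infty}_w}=\sup_{j}\big\|(c_{i,j}w_{i,j})_i\big\|_{\ell^r(I)},\qquad \|c\|_{\mathfrak l^{r,\infty}_w}=\sup_{i}\big\|(c_{i,j}w_{i,j})_j\big\|_{\ell^r(J)} .$$ Write $\langle K,f_1\otimes f_2\rangle=\sum_{i,j}(C_{\widetilde{\Psi_1\otimes\Psi_2}}K)_{i,j}\,(C_{\Psi_1}f_1)_i\,\overline{(C_{\Psi_2}f_2)_j}$, let $(w_1\otimes w_2)_{i,j}=w_{1,i}w_{2,j}$, and set $W=1/(w_1\otimes w_2)$. For a linear operator $O$ from $\mathcal H^r_{w_1}(\Psi_1)$ to $\mathcal H^s_{1/w_2}(\Psi_2)$, $K$ is called a *kernel* of $O$ if $\langle Of_1,f_2\rangle=\langle K,f_1\otimes f_2\rangle$ for all $f_1$ in the domain of $O$ and all $f_2\in\mathcal H^1_{w_2}(\Psi_2)$; the *Galerkin matrix* of $O$ is $k_{i,j}=\langle O\widetilde\psi_{1,i},\widetilde\psi_{2,j}\rangle$. **Theorem.** Let $1\le p,q\le\infty$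 with $\frac1p+\frac1q=1$, and, for $n=1,2$, let $\mathcal A_n$ be a spectral matrix algebra, $\Psi_n\subset\mathcal H_n$ an $\mathcal A_n$-localised frame and $w_n$ an $\mathcal A_n$-admissible weight. (i) A linear operator $O:\mathcal H^1_{w_1}(\Psi_1)\to\mathcal H^p_{1/w_2}(\Psi_2)$ is bounded if and only if it has a kernel $K\in\mathfrak H^{p,\infty}_{W}(\Psi_1\otimes\Psi_2)$; this $K$ is then unique, every $K\in\mathfrak H^{p,\infty}_W(\Psi_1\otimes\Psi_2)$ is the kernel of exactly one such bounded operator, and $$\|O\|_{\mathcal H^1_{w_1}(\Psi_1)\to\mathcal H^p_{1/w_2}(\Psi_2)}\asymp\|K\|_{\mathfrak H^{p,\infty}_W(\Psi_1\otimes\Psi_2)}=\|k\|_{\mathfrak l^{p,\infty}_W(I\times J)},$$ where $k$ is the Galerkin matrix of $O$. Moreover, every bounded linear operator $O:\mathcal H^1_{w_1}(\Psi_1)\to\mathcal H^\infty_{1/w_2}(\Psi_2)$ has a unique kernel $K$ in $\mathcal H^{\infty,\infty}_W(\Psi_1\otimes\Psi_2)$ and a Galerkin matrix $k$, and the following are equivalent: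 $O$ is a bounded operator from $\mathcal H^1_{w_1}(\Psi_1)$ into $\mathcal H^p_{1/w_2}(\Psi_2)$; $K\in\mathfrak H^{p,\infty}_W(\Psi_1\otimes\Psi_2)$; $k\in\mathfrak l^{p,\infty}_W(I\times J)$. (ii) A linear operator $O:\mathcal H^p_{w_1}(\Psi_1)\to\mathcal H^\infty_{1/w_2}(\Psi_2)$ is bounded and, in the case $p=\infty$, weak-$*$ continuous (for every $f_2\in\mathcal H^1_{w_2}(\Psi_2)$ there is $g\in\mathcal H^1_{1/w_1}(\Psi_1)$ with $\langle Of,f_2\rangle=\langle f,g\rangle$ for all $f$) if and only if it has a kernel $K\in\mathcal H^{q,\infty}_W(\Psi_1\otimes\Psi_2)$; this $K$ is then unique, every $K\in\mathcal H^{q,\infty}_W(\Psi_1\otimes\Psi_2)$ is the kernel of exactly one such operator, and $$\|O\|_{\mathcal H^p_{w_1}(\Psi_1)\to\mathcal H^\infty_{1/w_2}(\Psi_2)}\asymp\|K\|_{\mathcal H^{q,\infty}_W(\Psi_1\otimes\Psi_2)}=\|k\|_{\ell^{q,\infty}_W(I\times J)}.$$ Moreover, for every bounded linear operator $O:\mathcal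 H^1_{w_1}(\Psi_1)\to\mathcal H^\infty_{1/w_2}(\Psi_2)$, with kernel $K\in\mathcal H^{\infty,\infty}_W(\Psi_1\otimes\Psi_2)$ and Galerkin matrix $k$, the following are equivalent: $O$ extends to a bounded operator from $\mathcal H^p_{w_1}(\Psi_1)$ to $\mathcal H^\infty_{1/w_2}(\Psi_2)$; $K\in\mathcal H^{q,\infty}_W(\Psi_1\otimes\Psi_2)$; $k\in\ell^{q,\infty}_W(I\times J)$. Here $A\asymp B$ means $C^{-1}B\le A\le CB$ with a constant $C\ge1$ that does not depend on $O$, $K$ and $k$. -/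

import Mathlib

open scoped ENNReal NNReal ComplexConjugate
open Filter Topology

noncomputable section

namespace CoOrbit

/-! ### Weighted and mixed-norm sequence norms (with values in `[0, ∞]`) -/

/-- The `ℓ^p`-norm of a family of extended nonnegative reals. -/
def ellNorm {ι : Type*} (p : ℝ≥0∞) (a : ι → ℝ≥0∞) : ℝ≥0∞ :=
  open Classical in
  if p = ∞ then ⨆ i, a i else (∑' i, a i ^ p.toReal) ^ (1 / p.toReal)

/-- The norm of `ℓ^p_w(I)`: the `ℓ^p`-norm of `c · w`. -/
def wNorm {I : Type*} (p : ℝ≥0∞) (w : I → ℝ) (c : I → ℂ) : ℝ≥0∞ :=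
  ellNorm p fun i => ‖c i‖ₑ * ENNReal.ofReal (w i)

/-- The norm of `ℓ^{p,q}_w(I × J)`: inner `p`-norm over `i ∈ I`, outer `q`-norm over `j ∈ J`. -/
def colNorm {I J : Type*} (p q : ℝ≥0∞) (w : I → J → ℝ) (c : I → J → ℂ) : ℝ≥0∞ :=
  ellNorm q fun j => ellNorm p fun i => ‖c i j‖ₑ * ENNReal.ofReal (w i j)

/-- The norm of `𝔩^{p,q}_w(I × J)`: inner `p`-norm over `j ∈ J`, outer `q`-norm over `i ∈ I`. -/
def rowNorm {I J : Type*} (p q : ℝ≥0∞) (w : I → J → ℝ) (c : I → J → ℂ) : ℝ≥0∞ :=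
  ellNorm q fun i => ellNorm p fun j => ‖c i j‖ₑ * ENNReal.ofReal (w i j)

/-- The weight `1 / (w₁ ⊗ w₂)` on `I × J`. -/
def invTensorWeight {I J : Type*} (w₁ : I → ℝ) (w₂ : J → ℝ) : I → J → ℝ :=
  fun i j => (w₁ i * w₂ j)⁻¹

theorem ellNorm_mono {ι : Type*} (p : ℝ≥0∞) {a b : ι → ℝ≥0∞} (h : ∀ i, a i ≤ b i) :
    ellNorm p a ≤ ellNorm p b := by
  unfold ellNorm
  split_ifs with hp
  · exact iSup_mono h
  · refine ENNReal.rpow_le_rpow (ENNReal.tsum_le_tsum fun i => ?_) (by positivity)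
    exact ENNReal.rpow_le_rpow (h i) ENNReal.toReal_nonneg

theorem ellNorm_add_le {ι : Type*} (p : ℝ≥0∞) [hp1 : Fact (1 ≤ p)] (a b : ι → ℝ≥0∞) :
    ellNorm p (fun i => a i + b i) ≤ ellNorm p a + ellNorm p b := by
  unfold ellNorm
  split_ifs with hp
  · exact iSup_le fun i => add_le_add (le_iSup a i) (le_iSup b i)
  · let _ : MeasurableSpace ι := ⊤
    have h1 : 1 ≤ p.toReal := by
      have := ENNReal.toReal_mono hp hp1.out
      simpa using this
    have := ENNReal.lintegral_Lp_add_le (μ := MeasureTheory.Measure.count) (f := a) (g := b)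
      measurable_from_top.aemeasurable measurable_from_top.aemeasurable h1
    simpa [MeasureTheory.lintegral_count] using this

theorem ellNorm_zero {ι : Type*} (p : ℝ≥0∞) [hp1 : Fact (1 ≤ p)] :
    ellNorm p (fun _ : ι => 0) = 0 := by
  unfold ellNorm
  split_ifs with hp
  · simp
  · have h1 : 0 < p.toReal := ENNReal.toReal_pos (by
      have := hp1.out
      intro h
      simp [h] at this) hp
    simp [ENNReal.zero_rpow_of_pos, h1]

theorem ellNorm_const_mul {ι : Type*} (p : ℝ≥0∞) [hp1 : Fact (1 ≤ p)] (r : ℝ≥0∞)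
    (a : ι → ℝ≥0∞) : ellNorm p (fun i => r * a i) = r * ellNorm p a := by
  unfold ellNorm
  split_ifs with hp
  · rw [ENNReal.mul_iSup]
  · have h1 : 0 < p.toReal := ENNReal.toReal_pos (by
      have := hp1.out
      intro h
      simp [h] at this) hp
    simp_rw [ENNReal.mul_rpow_of_nonneg _ _ h1.le, ENNReal.tsum_mul_left]
    rw [ENNReal.mul_rpow_of_nonneg _ _ (by positivity), ← ENNReal.rpow_mul]
    rw [mul_one_div_cancel h1.ne', ENNReal.rpow_one]

theorem wNorm_add_le {I : Type*} (p : ℝ≥0∞) [Fact (1 ≤ p)] (w : I → ℝ) (c d : I → ℂ) :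
    wNorm p w (fun i => c i + d i) ≤ wNorm p w c + wNorm p w d := by
  unfold wNorm
  refine (ellNorm_mono p fun i => ?_).trans (ellNorm_add_le p _ _)
  rw [← add_mul]
  gcongr
  exact enorm_add_le _ _

theorem wNorm_smul {I : Type*} (p : ℝ≥0∞) [Fact (1 ≤ p)] (w : I → ℝ) (a : ℂ) (c : I → ℂ) :
    wNorm p w (fun i => a * c i) = ‖a‖ₑ * wNorm p w c := by
  unfold wNorm
  rw [← ellNorm_const_mul]
  simp only [enorm_mul, mul_assoc]

theorem wNorm_zero {I : Type*} (p : ℝ≥0∞) [Fact (1 ≤ p)] (w : I → ℝ) :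
    wNorm p w (fun _ => (0 : ℂ)) = 0 := by
  simp [wNorm, ellNorm_zero]

/-! ### Spectral matrix algebras and admissible weights -/

/-- The matrix entry `a_{i,j}` of a bounded operator on `ℓ²(I)`. -/
def entry {I : Type*}
    (T : lp (fun _ : I => ℂ) 2 →L[ℂ] lp (fun _ : I => ℂ) 2) (i j : I) : ℂ :=
  open Classical in
  T (lp.single 2 j (1 : ℂ)) i

/-- A (solid) spectral matrix algebra over `I`. A matrix that defines a bounded operator on
`ℓ²(I)` is identified with that operator, so that the algebra is a unital `*`-subalgebra of
`B(ℓ²(I))`; it is a Banach algebra for a norm `nrm` of its own, inverse-closed in `B(ℓ²(I))`,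
and solid. The involution is not required to be isometric. -/
structure SpectralMatrixAlgebra (I : Type*) where
  carrier : StarSubalgebra ℂ (lp (fun _ : I => ℂ) 2 →L[ℂ] lp (fun _ : I => ℂ) 2)
  nrm : AlgebraNorm ℂ carrier
  complete : ∀ u : ℕ → carrier,
    (∀ ε > 0, ∃ N, ∀ m ≥ N, ∀ n ≥ N, nrm (u m - u n) < ε) →
      ∃ a : carrier, Tendsto (fun n => nrm (u n - a)) atTop (𝓝 0)
  inverse_closed : ∀ T ∈ carrier, ∀ S, T * S = 1 → S * T = 1 → S ∈ carrier
  solid : ∀ (T : carrier) (b : I → I → ℂ), (∀ i j, ‖b i j‖ ≤ ‖entry T.1 i j‖) →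
    ∃ S : carrier, (∀ i j, entry S.1 i j = b i j) ∧ nrm S ≤ nrm T

/-- The matrix `M` belongs to the algebra `A`. -/
def SpectralMatrixAlgebra.HasMatrix {I : Type*} (A : SpectralMatrixAlgebra I)
    (M : I → I → ℂ) : Prop :=
  ∃ T ∈ A.carrier, ∀ i j, entry T i j = M i j

/-- `w` is an `A`-admissible weight: `w > 0`, and each matrix of `A` acts boundedly on
`ℓ^p_w(I)` for every `1 ≤ p ≤ ∞`. -/
def IsAdmissible {I : Type*} (A : SpectralMatrixAlgebra I) (w : I → ℝ) : Prop :=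
  (∀ i, 0 < w i) ∧
    ∀ T ∈ A.carrier, ∀ p : ℝ≥0∞, 1 ≤ p → ∃ C : ℝ≥0, ∀ c : I → ℂ, wNorm p w c < ∞ →
      (∀ i, Summable fun j => entry T i j * c j) ∧
        wNorm p w (fun i => ∑' j, entry T i j * c j) ≤ C * wNorm p w c

/-! ### Frames -/

section Frames

variable {I H : Type*} [NormedAddCommGroup H] [InnerProductSpace ℂ H]

/-- Frames. Mathlib's `inner ℂ g f` is `⟨f, g⟩`, linear in `f` and antilinear in `g`. -/
def IsFrame (ψ : I → H) : Prop :=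
  ∃ A B : ℝ, 0 < A ∧ 0 < B ∧ ∀ f : H,
    (Summable fun i => ‖inner ℂ (ψ i) f‖ ^ 2) ∧
      A * ‖f‖ ^ 2 ≤ ∑' i, ‖inner ℂ (ψ i) f‖ ^ 2 ∧
        ∑' i, ‖inner ℂ (ψ i) f‖ ^ 2 ≤ B * ‖f‖ ^ 2

/-- The frame operator `S f = ∑ᵢ ⟨f, ψᵢ⟩ ψᵢ`. -/
def frameOp (ψ : I → H) (f : H) : H := ∑' i, inner ℂ (ψ i) f • ψ i

/-- The canonical dual frame `ψ̃ᵢ = S⁻¹ ψᵢ` (the frame operator of a frame is bijective). -/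
def dual (ψ : I → H) (i : I) : H := Function.invFun (frameOp ψ) (ψ i)

/-- `ψ` is an `A`-localised frame: a frame whose Gram matrix `(⟨ψ_{i'}, ψ_i⟩)_{i,i'}` lies in
`A`. -/
def IsLocalised (A : SpectralMatrixAlgebra I) (ψ : I → H) : Prop :=
  IsFrame ψ ∧ A.HasMatrix fun i i' => inner ℂ (ψ i) (ψ i')

end Frames

/-! ### Equivalence classes of sequences

Given linear functionals `L i` on `X` (the frame coefficients), two sequences in `X` along which
all coefficients converge are equivalent if the coefficients of their difference tend to `0`. -/

section Generalised

variable {X ι : Type*} [AddCommGroup X] [Module ℂ X]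

/-- The sequences `F` in `X` for which `lim_n L i (F n)` exists for every `i`. -/
def ConvSeq (L : ι → X →ₗ[ℂ] ℂ) : Submodule ℂ (ℕ → X) where
  carrier := {F | ∀ i, ∃ l : ℂ, Tendsto (fun n => L i (F n)) atTop (𝓝 l)}
  zero_mem' := fun i => ⟨0, by simp⟩
  add_mem' := by
    intro F G hF hG i
    obtain ⟨l, hl⟩ := hF i
    obtain ⟨m, hm⟩ := hG i
    exact ⟨l + m, by simpa using hl.add hm⟩
  smul_mem' := by
    intro a F hF i
    obtain ⟨l, hl⟩ := hF i
    exact ⟨a * l, by simpa using hl.const_mul a⟩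

/-- `(lim_n L i (F n))_i`. -/
def limCoeff (L : ι → X →ₗ[ℂ] ℂ) : ConvSeq L →ₗ[ℂ] (ι → ℂ) where
  toFun F i := limUnder atTop fun n => L i (F.1 n)
  map_add' F G := by
    funext i
    obtain ⟨l, hl⟩ := F.2 i
    obtain ⟨m, hm⟩ := G.2 i
    have h : Tendsto (fun n => L i ((F + G).1 n)) atTop (𝓝 (l + m)) := by
      simpa using hl.add hm
    rw [Pi.add_apply, h.limUnder_eq, hl.limUnder_eq, hm.limUnder_eq]
  map_smul' a F := by
    funext i
    obtain ⟨l, hl⟩ := F.2 i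
    have h : Tendsto (fun n => L i ((a • F).1 n)) atTop (𝓝 (a * l)) := by
      simpa using hl.const_mul a
    rw [Pi.smul_apply, h.limUnder_eq, RingHom.id_apply, hl.limUnder_eq, smul_eq_mul]

/-- The sequences equivalent to zero: `lim_n L i (F n) = 0` for every `i`. -/
def NullSeq (L : ι → X →ₗ[ℂ] ℂ) : Submodule ℂ (ConvSeq L) where
  carrier := {F | ∀ i, Tendsto (fun n => L i (F.1 n)) atTop (𝓝 0)}
  zero_mem' := fun i => by simp
  add_mem' := by
    intro F G hF hG i
    simpa using (hF i).add (hG i)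
  smul_mem' := by
    intro a F hF i
    simpa using (hF i).const_mul a

/-- The equivalence classes `[(F_n)]`. -/
abbrev GenElt (L : ι → X →ₗ[ℂ] ℂ) : Type _ := ConvSeq L ⧸ NullSeq L

/-- The coefficients of a class: `coeff L [(F_n)] i = lim_n L i (F n)`. -/
def coeff (L : ι → X →ₗ[ℂ] ℂ) : GenElt L →ₗ[ℂ] (ι → ℂ) :=
  (NullSeq L).liftQ (limCoeff L) (by
    intro F hF
    rw [LinearMap.mem_ker]
    funext i
    exact (hF i).limUnder_eq)

/-- The class of the constant sequence, through which `X` is mapped to the classes. -/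
def constElt (L : ι → X →ₗ[ℂ] ℂ) (x : X) : GenElt L :=
  (NullSeq L).mkQ ⟨fun _ => x, fun i => ⟨L i x, tendsto_const_nhds⟩⟩

/-- Sanity check: a class is determined by its coefficients. -/
theorem coeff_injective (L : ι → X →ₗ[ℂ] ℂ) : Function.Injective (coeff L) := by
  rw [injective_iff_map_eq_zero]
  intro x hx
  obtain ⟨F, rfl⟩ := (NullSeq L).mkQ_surjective x
  rw [Submodule.mkQ_apply, Submodule.Quotient.mk_eq_zero]
  intro i
  obtain ⟨l, hl⟩ := F.2 i
  have h : limUnder atTop (fun n => L i (F.1 n)) = 0 := congrFun hx i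
  rw [hl.limUnder_eq] at h
  rwa [h] at hl

end Generalised

/-! ### The co-orbit spaces `H^p_w(Ψ)` -/

section CoorbitSpaces

variable {I H : Type*} [NormedAddCommGroup H] [InnerProductSpace ℂ H]

/-- The functionals `f ↦ ⟨f, ψ̃ᵢ⟩`, the entries of the analysis operator of the dual frame. -/
def dualCoeff (ψ : I → H) (i : I) : H →ₗ[ℂ] ℂ := (innerSL ℂ (dual ψ i)).toLinearMap

/-- The ambient space of all the co-orbit spaces of `ψ`. For `f` in it, `coeff (dualCoeff ψ) f`
is the family `C_Ψ̃ f` of its coefficients. -/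
abbrev GenVec (ψ : I → H) : Type _ := GenElt (dualCoeff ψ)

/-- `H₀₀(Ψ)`, the finite linear combinations of the frame elements. -/
def H00 (ψ : I → H) : Submodule ℂ H := Submodule.span ℂ (Set.range ψ)

/-- The norm `‖C_Ψ̃ f‖_{ℓ^p_w}`. -/
def coNorm (ψ : I → H) (p : ℝ≥0∞) (w : I → ℝ) (f : GenVec ψ) : ℝ≥0∞ :=
  wNorm p w (coeff (dualCoeff ψ) f)

/-- The co-orbit space `H^p_w(Ψ)`. For `p < ∞` it is the completion of `H₀₀(Ψ)` in the norm
`‖C_Ψ̃ f‖_{ℓ^p_w}`, given by the classes of the Cauchy sequences in `H₀₀(Ψ)` (such a sequence is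
a null sequence in this norm iff all its coefficients tend to zero); for `p = ∞`, it
consists of the classes of the sequences in `H` that are bounded in `‖C_Ψ̃ f‖_{ℓ^∞_w}` and along
which all coefficients converge. -/
def Co (ψ : I → H) (p : ℝ≥0∞) [Fact (1 ≤ p)] (w : I → ℝ) : Submodule ℂ (GenVec ψ) where
  carrier := {f | ∃ F : ConvSeq (dualCoeff ψ), (NullSeq (dualCoeff ψ)).mkQ F = f ∧
    ((p < ∞ ∧ (∀ n, F.1 n ∈ H00 ψ) ∧ ∀ ε : ℝ≥0∞, 0 < ε → ∃ N : ℕ, ∀ m ≥ N, ∀ n ≥ N,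
        wNorm p w (fun i => dualCoeff ψ i (F.1 m - F.1 n)) < ε) ∨
      (p = ∞ ∧ ∃ M : ℝ≥0, ∀ n, wNorm ∞ w (fun i => dualCoeff ψ i (F.1 n)) ≤ M))}
  zero_mem' := by
    refine ⟨0, map_zero _, ?_⟩
    rcases eq_or_ne p ∞ with hp | hp
    · refine Or.inr ⟨hp, 0, fun n => ?_⟩
      simp [wNorm_zero]
    · refine Or.inl ⟨hp.lt_top, fun n => zero_mem _, fun ε hε => ⟨0, fun m _ n _ => ?_⟩⟩
      simpa [wNorm_zero] using hε
  add_mem' := by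
    rintro f g ⟨F, rfl, hF⟩ ⟨G, rfl, hG⟩
    refine ⟨F + G, map_add _ _ _, ?_⟩
    rcases hF with ⟨hp, hF0, hF⟩ | ⟨hp, M, hF⟩
    · rcases hG with ⟨_, hG0, hG⟩ | ⟨hp', _⟩
      · refine Or.inl ⟨hp, fun n => add_mem (hF0 n) (hG0 n), fun ε hε => ?_⟩
        obtain ⟨N₁, h₁⟩ := hF (ε / 2) (ENNReal.half_pos hε.ne')
        obtain ⟨N₂, h₂⟩ := hG (ε / 2) (ENNReal.half_pos hε.ne')
        refine ⟨max N₁ N₂, fun m hm n hn => ?_⟩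
        have e : (fun i => dualCoeff ψ i ((F + G).1 m - (F + G).1 n)) =
            fun i => dualCoeff ψ i (F.1 m - F.1 n) + dualCoeff ψ i (G.1 m - G.1 n) := by
          funext i
          rw [← map_add]
          congr 1
          simp only [Submodule.coe_add, Pi.add_apply]
          abel
        rw [e, ← ENNReal.add_halves ε]
        exact (wNorm_add_le p w _ _).trans_lt (ENNReal.add_lt_add
          (h₁ m (le_of_max_le_left hm) n (le_of_max_le_left hn))
          (h₂ m (le_of_max_le_right hm) n (le_of_max_le_right hn)))
      · exact absurd hp' hp.ne
    · rcases hG with ⟨hp', _⟩ | ⟨_, M', hG⟩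
      · exact absurd hp hp'.ne
      · refine Or.inr ⟨hp, M + M', fun n => ?_⟩
        have e : (fun i => dualCoeff ψ i ((F + G).1 n)) =
            fun i => dualCoeff ψ i (F.1 n) + dualCoeff ψ i (G.1 n) := by
          funext i
          rw [← map_add]
          rfl
        rw [e, ENNReal.coe_add]
        exact (wNorm_add_le ∞ w _ _).trans (add_le_add (hF n) (hG n))
  smul_mem' := by
    rintro a f ⟨F, rfl, hF⟩
    refine ⟨a • F, map_smul _ _ _, ?_⟩
    rcases hF with ⟨hp, hF0, hF⟩ | ⟨hp, M, hF⟩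
    · refine Or.inl ⟨hp, fun n => Submodule.smul_mem _ a (hF0 n), fun ε hε => ?_⟩
      obtain ⟨N, h⟩ := hF (ε / (‖a‖ₑ + 1)) (ENNReal.div_pos hε.ne' (by simp))
      refine ⟨N, fun m hm n hn => ?_⟩
      have e : (fun i => dualCoeff ψ i ((a • F).1 m - (a • F).1 n)) =
          fun i => a * dualCoeff ψ i (F.1 m - F.1 n) := by
        funext i
        rw [← smul_eq_mul, ← map_smul, smul_sub]
        rfl
      rw [e, wNorm_smul]
      have h' := h m hm n hn
      rw [ENNReal.lt_div_iff_mul_lt (Or.inl (by simp)) (Or.inl (by simp))] at h'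
      refine lt_of_le_of_lt ?_ h'
      rw [mul_comm]
      gcongr
      exact le_self_add
    · refine Or.inr ⟨hp, ‖a‖₊ * M, fun n => ?_⟩
      have e : (fun i => dualCoeff ψ i ((a • F).1 n)) =
          fun i => a * dualCoeff ψ i (F.1 n) := by
        funext i
        rw [← smul_eq_mul, ← map_smul]
        rfl
      rw [e, wNorm_smul, ENNReal.coe_mul]
      gcongr
      · exact le_rfl
      · exact hF n

/-- The analysis `(C_Ψ f)_i = ⟨f, ψ_i⟩ = ∑_l (C_Ψ̃ f)_l ⟨ψ_l, ψ_i⟩`, which is the usual inner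
product with `ψ_i` on `H` and its continuous extension on the co-orbit spaces. -/
def analysis (ψ : I → H) (f : GenVec ψ) (i : I) : ℂ :=
  ∑' l, coeff (dualCoeff ψ) f l * inner ℂ (ψ i) (ψ l)

/-- The duality `⟨f, g⟩ = ⟨C_Ψ̃ f, C_Ψ g⟩ = ∑_i (C_Ψ̃ f)_i conj (C_Ψ g)_i` between `H^p_w(Ψ)` and
`H^q_{1/w}(Ψ)`, where `1/p + 1/q = 1`; the series then converges absolutely. -/
def pairing (ψ : I → H) (f g : GenVec ψ) : ℂ :=
  ∑' i, coeff (dualCoeff ψ) f i * conj (analysis ψ g i)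

end CoorbitSpaces

/-! ### The Hilbert space tensor product, as the space of Hilbert–Schmidt operators -/

section Kernels

variable {I J H₁ H₂ : Type*}
  [NormedAddCommGroup H₁] [InnerProductSpace ℂ H₁] [CompleteSpace H₁]
  [NormedAddCommGroup H₂] [InnerProductSpace ℂ H₂] [CompleteSpace H₂]

/-- An orthonormal basis of a Hilbert space. -/
def onb (E : Type*) [NormedAddCommGroup E] [InnerProductSpace ℂ E] [CompleteSpace E] :
    HilbertBasis ((exists_hilbertBasis ℂ E).choose) ℂ E :=
  (exists_hilbertBasis ℂ E).choose_spec.choose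

/-- The Hilbert–Schmidt operators `H₁ → H₂`, the model of `H₁ ⊗ H₂`. -/
def HS (H₁ H₂ : Type*)
    [NormedAddCommGroup H₁] [InnerProductSpace ℂ H₁] [CompleteSpace H₁]
    [NormedAddCommGroup H₂] [InnerProductSpace ℂ H₂] : Submodule ℂ (H₁ →L[ℂ] H₂) where
  carrier := {T | Summable fun e => ‖T (onb H₁ e)‖ ^ 2}
  zero_mem' := by simp
  add_mem' := by
    intro S T hS hT
    refine Summable.of_nonneg_of_le (fun e => by positivity) (fun e => ?_)
      ((hS.add hT).mul_left 2)
    have h : ‖(S + T) (onb H₁ e)‖ ≤ ‖S (onb H₁ e)‖ + ‖T (onb H₁ e)‖ := norm_add_le _ _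
    have h2 := pow_le_pow_left₀ (norm_nonneg _) h 2
    nlinarith [sq_nonneg (‖S (onb H₁ e)‖ - ‖T (onb H₁ e)‖)]
  smul_mem' := by
    intro a T hT
    have h : Summable fun e => ‖a‖ ^ 2 * ‖T (onb H₁ e)‖ ^ 2 := hT.mul_left _
    refine h.congr fun e => ?_
    rw [smul_apply, norm_smul, mul_pow]

/-- The simple tensor `f₁ ⊗ f₂`, i.e. the operator `f ↦ ⟨f, f₁⟩ f₂`. -/
def tensor (f₁ : H₁) (f₂ : H₂) : H₁ →L[ℂ] H₂ := InnerProductSpace.rankOne ℂ f₂ f₁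

/-- The Hilbert–Schmidt inner product `⟨S, T⟩ = ∑_e ⟨S e, T e⟩`. -/
def hsInner (S T : H₁ →L[ℂ] H₂) : ℂ := ∑' e, inner ℂ (T (onb H₁ e)) (S (onb H₁ e))

/-- `⟨S, f₁ ⊗ f₂⟩ = ⟨S f₁, f₂⟩`. -/
theorem hsInner_tensor (S : H₁ →L[ℂ] H₂) (f₁ : H₁) (f₂ : H₂) :
    hsInner S (tensor f₁ f₂) = inner ℂ f₂ (S f₁) := by
  have h := ((onb H₁).hasSum_repr f₁).mapL ((innerSL ℂ f₂).comp S)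
  have h' : ((innerSL ℂ f₂).comp S) f₁ = inner ℂ f₂ (S f₁) := rfl
  rw [h'] at h
  rw [← h.tsum_eq]
  unfold hsInner
  congr 1
  funext e
  simp [tensor, InnerProductSpace.rankOne_apply, HilbertBasis.repr_apply_apply, mul_comm]

/-- The functionals `F ↦ ⟨F, ψ̃_{1,i} ⊗ ψ̃_{2,j}⟩` on `H₁ ⊗ H₂`, the entries of the analysis
operator of the canonical dual `ψ̃₁ ⊗ ψ̃₂` of the frame `ψ₁ ⊗ ψ₂`. -/
def kerCoeff (ψ₁ : I → H₁) (ψ₂ : J → H₂) (ij : I × J) : HS H₁ H₂ →ₗ[ℂ] ℂ where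
  toFun F := hsInner F.1 (tensor (dual ψ₁ ij.1) (dual ψ₂ ij.2))
  map_add' F G := by simp [hsInner_tensor]
  map_smul' a F := by simp [hsInner_tensor]

/-- The ambient space of all the co-orbit spaces of `ψ₁ ⊗ ψ₂`. -/
abbrev GenKer (ψ₁ : I → H₁) (ψ₂ : J → H₂) : Type _ := GenElt (kerCoeff ψ₁ ψ₂)

/-- The coefficients `k_{i,j} = ⟨K, ψ̃_{1,i} ⊗ ψ̃_{2,j}⟩` of `K`. -/
def kerMatrix (ψ₁ : I → H₁) (ψ₂ : J → H₂) (K : GenKer ψ₁ ψ₂) (i : I) (j : J) : ℂ :=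
  coeff (kerCoeff ψ₁ ψ₂) K (i, j)

/-- The co-orbit space `H^{r,∞}_w(Ψ₁ ⊗ Ψ₂)`: classes of sequences in `H₁ ⊗ H₂` along
which all coefficients converge and which are bounded in the `ℓ^{r,∞}_w`-norm of the
coefficients. -/
def KerCol (ψ₁ : I → H₁) (ψ₂ : J → H₂) (r : ℝ≥0∞) (w : I → J → ℝ) : Set (GenKer ψ₁ ψ₂) :=
  {K | ∃ F : ConvSeq (kerCoeff ψ₁ ψ₂), (NullSeq (kerCoeff ψ₁ ψ₂)).mkQ F = K ∧
    ⨆ n, colNorm r ∞ w (fun i j => kerCoeff ψ₁ ψ₂ (i, j) (F.1 n)) < ∞}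

/-- The co-orbit space `𝔥^{r,∞}_w(Ψ₁ ⊗ Ψ₂)`: the same with the `𝔩^{r,∞}_w`-norm. -/
def KerRow (ψ₁ : I → H₁) (ψ₂ : J → H₂) (r : ℝ≥0∞) (w : I → J → ℝ) : Set (GenKer ψ₁ ψ₂) :=
  {K | ∃ F : ConvSeq (kerCoeff ψ₁ ψ₂), (NullSeq (kerCoeff ψ₁ ψ₂)).mkQ F = K ∧
    ⨆ n, rowNorm r ∞ w (fun i j => kerCoeff ψ₁ ψ₂ (i, j) (F.1 n)) < ∞}

/-- The norm of `H^{r,∞}_w(Ψ₁ ⊗ Ψ₂)`. -/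
def kerColNorm (ψ₁ : I → H₁) (ψ₂ : J → H₂) (r : ℝ≥0∞) (w : I → J → ℝ)
    (K : GenKer ψ₁ ψ₂) : ℝ≥0∞ := colNorm r ∞ w (kerMatrix ψ₁ ψ₂ K)

/-- The norm of `𝔥^{r,∞}_w(Ψ₁ ⊗ Ψ₂)`. -/
def kerRowNorm (ψ₁ : I → H₁) (ψ₂ : J → H₂) (r : ℝ≥0∞) (w : I → J → ℝ)
    (K : GenKer ψ₁ ψ₂) : ℝ≥0∞ := rowNorm r ∞ w (kerMatrix ψ₁ ψ₂ K)

/-- The pairing `⟨K, f₁ ⊗ f₂⟩ = ⟨C_{Ψ̃₁⊗Ψ̃₂} K, C_{Ψ₁⊗Ψ₂}(f₁ ⊗ f₂)⟩`, where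
`(C_{Ψ₁⊗Ψ₂}(f₁ ⊗ f₂))_{i,j} = conj ⟨f₁, ψ_{1,i}⟩ · ⟨f₂, ψ_{2,j}⟩`. The series converges
absolutely for `K ∈ H^{q,∞}_{1/(w₁⊗w₂)}`, `f₁ ∈ H^p_{w₁}`, `f₂ ∈ H¹_{w₂}`, `1/p + 1/q = 1`. -/
def kerPairing (ψ₁ : I → H₁) (ψ₂ : J → H₂) (K : GenKer ψ₁ ψ₂)
    (f₁ : GenVec ψ₁) (f₂ : GenVec ψ₂) : ℂ :=
  ∑' ij : I × J, kerMatrix ψ₁ ψ₂ K ij.1 ij.2 *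
    conj (conj (analysis ψ₁ f₁ ij.1) * analysis ψ₂ f₂ ij.2)

end Kernels

/-! ### Operators between co-orbit spaces -/

section Operators

variable {I J H₁ H₂ : Type*}
  [NormedAddCommGroup H₁] [InnerProductSpace ℂ H₁]
  [NormedAddCommGroup H₂] [InnerProductSpace ℂ H₂]
  {ψ₁ : I → H₁} {ψ₂ : J → H₂} {r s : ℝ≥0∞} [Fact (1 ≤ r)] [Fact (1 ≤ s)]
  {u : I → ℝ} {v : J → ℝ}

/-- The linear operator `O : H^r_u(Ψ₁) → H^s_v(Ψ₂)` is bounded. -/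
def IsBdd (O : Co ψ₁ r u →ₗ[ℂ] Co ψ₂ s v) : Prop :=
  ∃ C : ℝ≥0, ∀ f, coNorm ψ₂ s v (O f) ≤ C * coNorm ψ₁ r u f

/-- The operator norm (`∞` for an unbounded operator). -/
def opNorm (O : Co ψ₁ r u →ₗ[ℂ] Co ψ₂ s v) : ℝ≥0∞ :=
  ⨅ C : {C : ℝ≥0 // ∀ f, coNorm ψ₂ s v (O f) ≤ C * coNorm ψ₁ r u f}, ((C : ℝ≥0) : ℝ≥0∞)

/-- `K` is a kernel of `O : H^r_u(Ψ₁) → H^s_v(Ψ₂)`: `⟨O f₁, f₂⟩ = ⟨K, f₁ ⊗ f₂⟩` for all `f₁` in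
the domain of `O` and all `f₂ ∈ H¹_{w₂}(Ψ₂)`. -/
def IsKernel [CompleteSpace H₁] [CompleteSpace H₂] (w₂ : J → ℝ)
    (O : Co ψ₁ r u →ₗ[ℂ] Co ψ₂ s v) (K : GenKer ψ₁ ψ₂) : Prop :=
  ∀ (f₁ : Co ψ₁ r u) (f₂ : Co ψ₂ 1 w₂),
    pairing ψ₂ (O f₁) f₂ = kerPairing ψ₁ ψ₂ K f₁ f₂

/-- `k` is the Galerkin matrix of `O`: `k_{i,j} = ⟨O ψ̃_{1,i}, ψ̃_{2,j}⟩`, where `ψ̃_{1,i}` lies in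
the domain of `O` and `ψ̃_{2,j}` in `H¹_{w₂}(Ψ₂)`. -/
def IsGalerkin (w₂ : J → ℝ) (O : Co ψ₁ r u →ₗ[ℂ] Co ψ₂ s v) (k : I → J → ℂ) : Prop :=
  ∀ i j, ∃ (x : Co ψ₁ r u) (y : Co ψ₂ 1 w₂),
    (x : GenVec ψ₁) = constElt (dualCoeff ψ₁) (dual ψ₁ i) ∧
      (y : GenVec ψ₂) = constElt (dualCoeff ψ₂) (dual ψ₂ j) ∧
        k i j = pairing ψ₂ (O x) y

/-- For `r = ∞`: `O : H^∞_u(Ψ₁) → H^s_v(Ψ₂)` is continuous from the weak-* topology given by the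
predual `H¹_{1/u}(Ψ₁)` to the weak topology given by `H¹_{w₂}(Ψ₂)`, i.e. each functional
`f ↦ ⟨O f, f₂⟩` is of the form `f ↦ ⟨f, g⟩` with `g ∈ H¹_{1/u}(Ψ₁)`. -/
def IsWeakStarCont (w₂ : J → ℝ) (O : Co ψ₁ r u →ₗ[ℂ] Co ψ₂ s v) : Prop :=
  ∀ f₂ : Co ψ₂ 1 w₂, ∃ g : Co ψ₁ 1 u⁻¹, ∀ f : Co ψ₁ r u,
    pairing ψ₂ (O f) f₂ = pairing ψ₁ f g

end Operators

end CoOrbit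

end

open CoOrbit

/-!
Everything is read off the matrix of coefficients.

*Localisation.* Let `C` be the analysis operator and `S = C* C` the frame operator of a localised
frame, so that its Gram operator `G = C C*` belongs to the algebra. The Gram operator of the dual
frame is `C S⁻² C*`, the integral of `(2πi)⁻¹ z⁻¹ (z - G)⁻¹` over a circle around the spectrum of
`S` that leaves out zero. By inverse-closedness the integrand is a continuous function with values in
the algebra, and by solidity the matrix entries are continuous on it, so the integral lies in the
algebra (`IsLocalised.hasMatrix_dual`). Solidity also allows the entries of a matrix to be replaced
by their absolute values. Hence the Gram matrices of the frame and of its dual, and the cross Gram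
matrix `⟨ψ l, ψ̃ i⟩`, act on every `ℓ^p_w` with absolute convergence, and by duality on every
`ℓ^p_{1/w}` (`IsLocalised.localisedFor`, `LocalisedFor.inv`).

*Co-orbit spaces.* A family is the family of coefficients `C_Ψ̃ f` of some `f` in `H^p_w` if and
only if it has finite norm in `ℓ^p_w` and is invariant under the cross Gram matrix (`Co.coeff_spec`,
`exists_mem_Co`). In the same way, a matrix is that of a kernel if and only if it has finite
mixed norm and is invariant under the cross Gram matrices in both of its indices (`kerRow_spec`,
`exists_mem_kerRow` and their analogues for columns).

*Operators.* Testing with the dual frame shows that `K` is a kernel of `O` if and only if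
`(C_Ψ̃₂ O f)_j = ∑_i (C_Ψ₁ f)_i k_{i,j}`, where `k` is the matrix of `K` (`IsKernel.represents`,
`Represents.isKernel`); then `k` is the Galerkin matrix of `O`. Thus the upper bounds for the norm
of `O` are the inequalities of Minkowski and Hölder (`matBdd_rowNorm`, `matBdd_colNorm`). For the
lower bounds, `O` is applied to single elements of the dual frame
(`exists_rowNorm_le_of_isBdd`), or to finite linear combinations of them
(`exists_colNorm_le_of_isBdd`). That a bounded operator is given by its Galerkin matrix follows
from the norm convergence of the expansion `f = ∑ ⟨f, ψ i⟩ ψ̃ i` if `p < ∞` (`IsBdd.represents`),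
and from weak-* continuity if `p = ∞` (`IsWeakStarCont.represents`). `KernelClass` collects what the
two kernel theorems have in common.
-/

namespace CoOrbit

/-! ### Duality of the `ℓ^p`-norms with values in `[0, ∞]` -/

section EllNorm

variable {ι κ : Type*}

theorem ellNorm_top (a : ι → ℝ≥0∞) : ellNorm ∞ a = ⨆ i, a i := by
  simp [ellNorm]

theorem ellNorm_of_ne_top {p : ℝ≥0∞} (hp : p ≠ ∞) (a : ι → ℝ≥0∞) :
    ellNorm p a = (∑' i, a i ^ p.toReal) ^ (1 / p.toReal) := by
  simp [ellNorm, hp]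

theorem ellNorm_one (a : ι → ℝ≥0∞) : ellNorm 1 a = ∑' i, a i := by
  simp [ellNorm]

theorem toReal_pos_of_one_le {p : ℝ≥0∞} (hp1 : 1 ≤ p) (hp : p ≠ ∞) : 0 < p.toReal :=
  ENNReal.toReal_pos (zero_lt_one.trans_le hp1).ne' hp

theorem le_ellNorm {p : ℝ≥0∞} (hp1 : 1 ≤ p) (a : ι → ℝ≥0∞) (i : ι) : a i ≤ ellNorm p a := by
  rcases eq_or_ne p ∞ with rfl | hp
  · rw [ellNorm_top]
    exact le_iSup a i
  · have h := toReal_pos_of_one_le hp1 hp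
    rw [ellNorm_of_ne_top hp, one_div, ENNReal.le_rpow_inv_iff h]
    exact ENNReal.le_tsum i

theorem ellNorm_single {p : ℝ≥0∞} (hp1 : 1 ≤ p) [DecidableEq ι] (i : ι) (x : ℝ≥0∞) :
    ellNorm p (Pi.single i x) = x := by
  rcases eq_or_ne p ∞ with rfl | hp
  · rw [ellNorm_top]
    refine le_antisymm (iSup_le fun j => ?_) ?_
    · rcases eq_or_ne j i with rfl | h
      · simp
      · simp [h]
    · simpa using le_iSup (Pi.single i x : ι → ℝ≥0∞) i
  · have h := toReal_pos_of_one_le hp1 hp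
    rw [ellNorm_of_ne_top hp, tsum_eq_single i]
    · rw [Pi.single_eq_same, ← ENNReal.rpow_mul, mul_one_div_cancel h.ne', ENNReal.rpow_one]
    · intro j hj
      simp [hj, h]

/-- The three cases of a pair of conjugate exponents. -/
theorem holderConjugate_cases {p q : ℝ≥0∞} (hpq : p.HolderConjugate q) :
    (p = 1 ∧ q = ∞) ∨ (p = ∞ ∧ q = 1) ∨
      (p ≠ ∞ ∧ q ≠ ∞ ∧ p.toReal.HolderConjugate q.toReal) := by
  have h : p⁻¹ + q⁻¹ = 1 := by simpa using hpq.inv_add_inv_eq_inv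
  rcases eq_or_ne p ∞ with rfl | hp
  · right; left
    simpa using h
  rcases eq_or_ne q ∞ with rfl | hq
  · left
    simpa using h
  · exact .inr (.inr ⟨hp, hq, ENNReal.HolderConjugate.toReal_of_ne_top hp hq⟩)

/-- Hölder's inequality. -/
theorem tsum_mul_le_ellNorm {p q : ℝ≥0∞} (hpq : p.HolderConjugate q) (a b : ι → ℝ≥0∞) :
    ∑' i, a i * b i ≤ ellNorm p a * ellNorm q b := by
  rcases holderConjugate_cases hpq with ⟨rfl, rfl⟩ | ⟨rfl, rfl⟩ | ⟨hp, hq, h⟩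
  · rw [ellNorm_one, ellNorm_top, ← ENNReal.tsum_mul_right]
    exact ENNReal.tsum_le_tsum fun i => by gcongr; exact le_iSup b i
  · rw [ellNorm_one, ellNorm_top, ← ENNReal.tsum_mul_left]
    exact ENNReal.tsum_le_tsum fun i => by gcongr; exact le_iSup a i
  · rw [ellNorm_of_ne_top hp, ellNorm_of_ne_top hq]
    let _ : MeasurableSpace ι := ⊤
    have := ENNReal.lintegral_mul_le_Lp_mul_Lq (MeasureTheory.Measure.count (α := ι)) h
      (f := a) (g := b) measurable_from_top.aemeasurable measurable_from_top.aemeasurable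
    simpa [MeasureTheory.lintegral_count] using this

/-- The converse of Hölder's inequality: the `ℓ^p`-norm is at most `C` if this is so when it is
tested against finitely supported families with finite values. -/
theorem ellNorm_le_of_forall_sum_mul_le {p q : ℝ≥0∞} (hpq : p.HolderConjugate q)
    (hq1 : 1 ≤ q) (a : ι → ℝ≥0∞) (C : ℝ≥0∞)
    (h : ∀ (s : Finset ι) (d : ι → ℝ≥0), (∀ i ∉ s, d i = 0) →
      ∑ i ∈ s, a i * d i ≤ C * ellNorm q fun i => (d i : ℝ≥0∞)) :
    ellNorm p a ≤ C := by
  classical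
  have hsingle : ∀ i, a i ≤ C := fun i => by
    have h1 := h {i} (Pi.single i 1) (fun j hj => by simp_all)
    have e : (fun j => ((Pi.single i 1 : ι → ℝ≥0) j : ℝ≥0∞)) = Pi.single i 1 := by
      funext j
      rcases eq_or_ne j i with rfl | hj
      · simp
      · simp [hj]
    rw [e, ellNorm_single hq1] at h1
    simpa using h1
  rcases holderConjugate_cases hpq with ⟨rfl, rfl⟩ | ⟨rfl, rfl⟩ | ⟨hp, hq, hr⟩
  · rw [ellNorm_one, ENNReal.tsum_eq_iSup_sum]
    refine iSup_le fun s => ?_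
    have h1 := h s (fun i => if i ∈ s then 1 else 0) (fun i hi => by simp [hi])
    have h2 : ellNorm ∞ (fun i => (((if i ∈ s then 1 else 0 : ℝ≥0)) : ℝ≥0∞)) ≤ 1 := by
      rw [ellNorm_top]
      exact iSup_le fun i => by split_ifs <;> simp
    calc ∑ i ∈ s, a i = ∑ i ∈ s, a i * ((if i ∈ s then 1 else 0 : ℝ≥0) : ℝ≥0∞) :=
          Finset.sum_congr rfl fun i hi => by simp [hi]
      _ ≤ C * 1 := h1.trans (by gcongr)
      _ = C := mul_one C
  · rw [ellNorm_top]
    exact iSup_le hsingle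
  · rcases eq_or_ne C ∞ with rfl | hC
    · exact le_top
    have hfin : ∀ i, a i ≠ ∞ := fun i => ((hsingle i).trans_lt hC.lt_top).ne
    lift a to ι → ℝ≥0 using hfin
    rw [ellNorm_of_ne_top hp, one_div, ENNReal.rpow_inv_le_iff hr.pos, ENNReal.tsum_eq_iSup_sum]
    refine iSup_le fun s => ?_
    rw [← ENNReal.rpow_inv_le_iff hr.pos, ← one_div]
    obtain ⟨g, hg, hgs⟩ := (NNReal.isGreatest_Lp s a hr).1
    have hgs' : ∑ i ∈ s, a i * g i = (∑ i ∈ s, a i ^ p.toReal) ^ (1 / p.toReal) := hgs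
    have hg' : ∑ i ∈ s, g i ^ q.toReal ≤ 1 := hg
    have h1 := h s (fun i => if i ∈ s then g i else 0) (fun i hi => by simp [hi])
    have h2 : ellNorm q (fun i => (((if i ∈ s then g i else 0 : ℝ≥0)) : ℝ≥0∞)) ≤ 1 := by
      rw [ellNorm_of_ne_top hq, tsum_eq_sum (s := s)]
      · refine ENNReal.rpow_le_one ?_ (by positivity)
        have : ∑ i ∈ s, ((if i ∈ s then g i else 0 : ℝ≥0) : ℝ≥0∞) ^ q.toReal
            = ((∑ i ∈ s, g i ^ q.toReal : ℝ≥0) : ℝ≥0∞) := by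
          push_cast
          refine Finset.sum_congr rfl fun i hi => ?_
          rw [if_pos hi, ENNReal.coe_rpow_of_nonneg _ hr.symm.nonneg]
        rw [this]
        exact_mod_cast hg'
      · intro i hi
        simp [hi, hr.symm.pos]
    calc (∑ i ∈ s, (a i : ℝ≥0∞) ^ p.toReal) ^ (1 / p.toReal)
        = (((∑ i ∈ s, a i ^ p.toReal) ^ (1 / p.toReal) : ℝ≥0) : ℝ≥0∞) := by
          rw [ENNReal.coe_rpow_of_nonneg _ (by positivity)]
          congr 1
          push_cast
          exact Finset.sum_congr rfl fun i _ => (ENNReal.coe_rpow_of_nonneg _ hr.nonneg).symm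
      _ = ∑ i ∈ s, (a i : ℝ≥0∞) * ((if i ∈ s then g i else 0 : ℝ≥0) : ℝ≥0∞) := by
          rw [← hgs']
          push_cast
          exact Finset.sum_congr rfl fun i hi => by simp [hi]
      _ ≤ C * 1 := h1.trans (by gcongr)
      _ = C := mul_one C

theorem exists_holderConjugate {p : ℝ≥0∞} (hp : 1 ≤ p) :
    ∃ q : ℝ≥0∞, 1 ≤ q ∧ p.HolderConjugate q := by
  have h := ENNReal.HolderConjugate.conjExponent hp
  refine ⟨_, ?_, h⟩
  have h' : p⁻¹ + (ENNReal.conjExponent p)⁻¹ = 1 := by simpa using h.inv_add_inv_eq_inv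
  rw [← ENNReal.inv_le_one, ← h']
  exact le_add_self

/-- Minkowski's inequality for infinite sums. -/
theorem ellNorm_tsum_mul_le {p : ℝ≥0∞} (hp : 1 ≤ p) (b : κ → ℝ≥0∞) (m : κ → ι → ℝ≥0∞) :
    ellNorm p (fun j => ∑' i, b i * m i j) ≤ ∑' i, b i * ellNorm p (m i) := by
  obtain ⟨q, hq, hpq⟩ := exists_holderConjugate hp
  refine ellNorm_le_of_forall_sum_mul_le hpq hq _ _ fun s d _ => ?_
  calc ∑ j ∈ s, (∑' i, b i * m i j) * d j
      ≤ ∑' j, (∑' i, b i * m i j) * d j := ENNReal.sum_le_tsum s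
    _ = ∑' i, b i * ∑' j, m i j * d j := by
        simp_rw [← ENNReal.tsum_mul_right, ← ENNReal.tsum_mul_left]
        rw [ENNReal.tsum_comm]
        simp_rw [mul_assoc]
    _ ≤ ∑' i, b i * (ellNorm p (m i) * ellNorm q fun j => (d j : ℝ≥0∞)) :=
        ENNReal.tsum_le_tsum fun i => by gcongr; exact tsum_mul_le_ellNorm hpq _ _
    _ = (∑' i, b i * ellNorm p (m i)) * ellNorm q fun j => (d j : ℝ≥0∞) := by
        rw [← ENNReal.tsum_mul_right]
        simp_rw [mul_assoc]

/-- Fatou's lemma for the `ℓ^p`-norm along a pointwise convergent family. -/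
theorem ellNorm_le_of_tendsto {p : ℝ≥0∞} (hp : 1 ≤ p) {α : Type*} {l : Filter α} [l.NeBot]
    {a : α → ι → ℝ≥0∞} {b : ι → ℝ≥0∞} {M : ℝ≥0∞}
    (hab : ∀ i, Tendsto (fun n => a n i) l (𝓝 (b i))) (hM : ∀ᶠ n in l, ellNorm p (a n) ≤ M) :
    ellNorm p b ≤ M := by
  obtain ⟨q, hq, hpq⟩ := exists_holderConjugate hp
  refine ellNorm_le_of_forall_sum_mul_le hpq hq _ _ fun s d _ => ?_
  have hlim : Tendsto (fun n => ∑ i ∈ s, a n i * d i) l (𝓝 (∑ i ∈ s, b i * d i)) :=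
    tendsto_finsetSum _ fun i _ => ENNReal.Tendsto.mul_const (hab i) (.inr ENNReal.coe_ne_top)
  refine le_of_tendsto hlim (hM.mono fun n hn => ?_)
  calc ∑ i ∈ s, a n i * d i ≤ ∑' i, a n i * d i := ENNReal.sum_le_tsum s
    _ ≤ ellNorm p (a n) * ellNorm q fun i => (d i : ℝ≥0∞) := tsum_mul_le_ellNorm hpq _ _
    _ ≤ _ := by gcongr

/-- For `p < ∞`, the tails of a family of finite `ℓ^p`-norm tend to zero. -/
theorem tendsto_ellNorm_tail {p : ℝ≥0∞} (hp1 : 1 ≤ p) (hp : p ≠ ∞) [DecidableEq ι]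
    {a : ι → ℝ≥0∞} (ha : ellNorm p a ≠ ∞) :
    Tendsto (fun s : Finset ι => ellNorm p fun i => if i ∈ s then 0 else a i) atTop (𝓝 0) := by
  have h := toReal_pos_of_one_le hp1 hp
  rw [ellNorm_of_ne_top hp] at ha
  have ha' : ∑' i, a i ^ p.toReal ≠ ∞ := fun h' => ha (by
    rw [h', ENNReal.top_rpow_of_pos (by positivity)])
  have ht := (ENNReal.tendsto_tsum_compl_atTop_zero ha').ennrpow_const (1 / p.toReal)
  rw [ENNReal.zero_rpow_of_pos (by positivity)] at ht
  refine ht.congr fun s => ?_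
  rw [ellNorm_of_ne_top hp]
  congr 1
  refine (tsum_subtype {i | i ∉ s} fun i => a i ^ p.toReal).trans (tsum_congr fun i => ?_)
  by_cases hi : i ∈ s
  · rw [Set.indicator_of_notMem (by simpa using hi)]
    simp [hi, h]
  · rw [Set.indicator_of_mem (by simpa using hi)]
    simp [hi]

theorem ellNorm_le_ellNorm_one {p : ℝ≥0∞} (hp : 1 ≤ p) (a : ι → ℝ≥0∞) :
    ellNorm p a ≤ ellNorm 1 a := by
  classical
  have h := ellNorm_tsum_mul_le hp a fun i => Pi.single (M := fun _ => ℝ≥0∞) i 1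
  simp_rw [ellNorm_single hp, mul_one] at h
  rw [ellNorm_one]
  refine le_trans (ellNorm_mono p fun j => ?_) h
  refine le_trans (by simp) (ENNReal.le_tsum j)

end EllNorm

/-! ### Matrices acting on all weighted `ℓ^p`-spaces -/

section ActsOn

variable {I J : Type*}

/-- The matrix `(|M i l|)` acts boundedly on `ℓ^p_w` for every `1 ≤ p ≤ ∞`. The action is on
families with values in `[0, ∞]`, for which all the sums make sense. -/
def ActsOn (M : I → I → ℂ) (w : I → ℝ) : Prop :=
  ∀ p : ℝ≥0∞, 1 ≤ p → ∃ C : ℝ≥0, ∀ a : I → ℝ≥0∞,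
    ellNorm p (fun i => (∑' l, ‖M i l‖ₑ * a l) * ENNReal.ofReal (w i)) ≤
      C * ellNorm p fun i => a i * ENNReal.ofReal (w i)

theorem ofReal_ne_zero_of_pos {w : I → ℝ} (hw : ∀ i, 0 < w i) (i : I) :
    ENNReal.ofReal (w i) ≠ 0 := by
  simpa using hw i

theorem ofReal_inv_weight {w : I → ℝ} (hw : ∀ i, 0 < w i) (i : I) :
    ENNReal.ofReal (w⁻¹ i) = (ENNReal.ofReal (w i))⁻¹ := by
  rw [Pi.inv_apply, ENNReal.ofReal_inv_of_pos (hw i)]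

theorem ofReal_invTensorWeight {w₁ : I → ℝ} {w₂ : J → ℝ} (hw₁ : ∀ i, 0 < w₁ i)
    (i : I) (j : J) :
    ENNReal.ofReal (invTensorWeight w₁ w₂ i j) =
      ENNReal.ofReal (w₁⁻¹ i) * ENNReal.ofReal (w₂⁻¹ j) := by
  rw [Pi.inv_apply, Pi.inv_apply, ← ENNReal.ofReal_mul (inv_nonneg.2 (hw₁ i).le),
    invTensorWeight, mul_inv]

theorem weight_mul_inv_weight {w : I → ℝ} (hw : ∀ i, 0 < w i) (i : I) :
    ENNReal.ofReal (w i) * ENNReal.ofReal (w⁻¹ i) = 1 := by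
  rw [ofReal_inv_weight hw, ENNReal.mul_inv_cancel (ofReal_ne_zero_of_pos hw i)
    ENNReal.ofReal_ne_top]

theorem inv_weight_pos {w : I → ℝ} (hw : ∀ i, 0 < w i) (i : I) : 0 < w⁻¹ i :=
  inv_pos.2 (hw i)

/-- A family of finite weighted norm has finite entries. -/
theorem ne_top_of_ellNorm_mul_ne_top {p : ℝ≥0∞} (hp : 1 ≤ p) {w : I → ℝ} (hw : ∀ i, 0 < w i)
    {a : I → ℝ≥0∞} (h : ellNorm p (fun i => a i * ENNReal.ofReal (w i)) ≠ ∞) (i : I) :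
    a i ≠ ∞ := by
  intro hi
  have := le_ellNorm hp (fun i => a i * ENNReal.ofReal (w i)) i
  simp only [hi] at this
  rw [ENNReal.top_mul (ofReal_ne_zero_of_pos hw i), top_le_iff] at this
  exact h this

theorem ActsOn.tsum_ne_top {M : I → I → ℂ} {w : I → ℝ} (hM : ActsOn M w) (hw : ∀ i, 0 < w i)
    {p : ℝ≥0∞} (hp : 1 ≤ p) {a : I → ℝ≥0∞}
    (h : ellNorm p (fun i => a i * ENNReal.ofReal (w i)) ≠ ∞) (i : I) :
    ∑' l, ‖M i l‖ₑ * a l ≠ ∞ := by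
  obtain ⟨C, hC⟩ := hM p hp
  exact ne_top_of_ellNorm_mul_ne_top hp hw
    ((hC a).trans_lt (ENNReal.mul_lt_top ENNReal.coe_lt_top h.lt_top)).ne i

/-- Duality: the transpose of a matrix acting on the spaces `ℓ^q_w` acts on the spaces
`ℓ^p_{1/w}`. -/
theorem ActsOn.inv {M : I → I → ℂ} {w : I → ℝ} (hM : ActsOn M w) (hw : ∀ i, 0 < w i)
    (hsymm : ∀ i l, ‖M i l‖ₑ = ‖M l i‖ₑ) : ActsOn M w⁻¹ := by
  intro p hp
  obtain ⟨q, hq, hpq⟩ := exists_holderConjugate hp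
  obtain ⟨C, hC⟩ := hM q hq
  refine ⟨C, fun a => ellNorm_le_of_forall_sum_mul_le hpq hq _ _ fun s d _ => ?_⟩
  have hb := hC fun i => d i * ENNReal.ofReal (w⁻¹ i)
  have e : (fun i => (d i * ENNReal.ofReal (w⁻¹ i)) * ENNReal.ofReal (w i)) =
      fun i => (d i : ℝ≥0∞) := by
    funext i
    rw [mul_assoc, mul_comm (ENNReal.ofReal (w⁻¹ i)), weight_mul_inv_weight hw, mul_one]
  rw [e] at hb
  calc ∑ i ∈ s, ((∑' l, ‖M i l‖ₑ * a l) * ENNReal.ofReal (w⁻¹ i)) * d i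
      ≤ ∑' i, ((∑' l, ‖M i l‖ₑ * a l) * ENNReal.ofReal (w⁻¹ i)) * d i := ENNReal.sum_le_tsum s
    _ = ∑' l, (a l * ENNReal.ofReal (w⁻¹ l)) *
          ((∑' i, ‖M l i‖ₑ * (d i * ENNReal.ofReal (w⁻¹ i))) * ENNReal.ofReal (w l)) := by
        simp_rw [← ENNReal.tsum_mul_right, ← ENNReal.tsum_mul_left]
        rw [ENNReal.tsum_comm]
        refine tsum_congr fun l => tsum_congr fun i => ?_
        rw [hsymm i l]
        calc ‖M l i‖ₑ * a l * ENNReal.ofReal (w⁻¹ i) * d i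
            = (ENNReal.ofReal (w l) * ENNReal.ofReal (w⁻¹ l)) *
                (‖M l i‖ₑ * a l * ENNReal.ofReal (w⁻¹ i) * d i) := by
              rw [weight_mul_inv_weight hw, one_mul]
          _ = _ := by ring
    _ ≤ ellNorm p (fun l => a l * ENNReal.ofReal (w⁻¹ l)) *
          (C * ellNorm q fun i => (d i : ℝ≥0∞)) :=
        (tsum_mul_le_ellNorm hpq _ _).trans (by gcongr)
    _ = _ := by ring

/-- A double series converges absolutely if the iterated sum of the norms is finite. -/
theorem summable_prod_of_tsum_enorm {F : I × J → ℂ} (h : ∑' i, ∑' j, ‖F (i, j)‖ₑ ≠ ∞) :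
    Summable F := by
  rw [← ENNReal.tsum_prod (f := fun i j => ‖F (i, j)‖ₑ)] at h
  exact Summable.of_enorm h

end ActsOn

/-! ### The analysis operator and the frame operator -/

section FrameOperator

variable {I H : Type*} [NormedAddCommGroup H] [InnerProductSpace ℂ H]

theorem IsFrame.memℓp {ψ : I → H} (hψ : IsFrame ψ) (f : H) :
    Memℓp (fun i => (inner ℂ (ψ i) f : ℂ)) 2 := by
  obtain ⟨A, B, -, -, h⟩ := hψ
  refine memℓp_gen ?_
  simpa using (h f).1

theorem norm_sq_lp_two (f : lp (fun _ : I => ℂ) 2) : ‖f‖ ^ 2 = ∑' i, ‖f i‖ ^ 2 := by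
  have := lp.norm_rpow_eq_tsum (p := 2) (by simp) f
  simpa using this

/-- The analysis operator `f ↦ (⟨f, ψ i⟩)_i` of a frame, as a bounded operator into `ℓ²`. -/
noncomputable def IsFrame.analysisOp {ψ : I → H} (hψ : IsFrame ψ) :
    H →L[ℂ] lp (fun _ : I => ℂ) 2 :=
  LinearMap.mkContinuousOfExistsBound
    { toFun := fun f => ⟨fun i => inner ℂ (ψ i) f, hψ.memℓp f⟩
      map_add' := fun f g => by ext i; exact inner_add_right _ _ _
      map_smul' := fun a f => by ext i; exact inner_smul_right _ _ _ }
    (by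
      obtain ⟨A, B, hA, hB, h⟩ := id hψ
      refine ⟨√B, fun f => ?_⟩
      refine le_of_sq_le_sq ?_ (by positivity)
      rw [norm_sq_lp_two, mul_pow, Real.sq_sqrt hB.le]
      exact (h f).2.2)

@[simp]
theorem IsFrame.analysisOp_apply {ψ : I → H} (hψ : IsFrame ψ) (f : H) (i : I) :
    hψ.analysisOp f i = inner ℂ (ψ i) f := rfl

variable [CompleteSpace H]

open Classical in
theorem IsFrame.adjoint_analysisOp_single {ψ : I → H} (hψ : IsFrame ψ) (i : I) :
    hψ.analysisOp.adjoint (lp.single 2 i (1 : ℂ)) = ψ i := by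
  refine ext_inner_right ℂ fun f => ?_
  rw [ContinuousLinearMap.adjoint_inner_left, lp.inner_single_left]
  simp

open Classical in
theorem IsFrame.hasSum_adjoint_analysisOp {ψ : I → H} (hψ : IsFrame ψ)
    (c : lp (fun _ : I => ℂ) 2) : HasSum (fun i => c i • ψ i) (hψ.analysisOp.adjoint c) := by
  have h := (lp.hasSum_single (by simp) c).mapL hψ.analysisOp.adjoint
  refine h.congr_fun fun i => ?_
  rw [← hψ.adjoint_analysisOp_single i, ← map_smul, ← lp.single_smul]
  simp

/-- The frame operator of a frame, as a bounded operator. -/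
noncomputable def IsFrame.op {ψ : I → H} (hψ : IsFrame ψ) : H →L[ℂ] H :=
  hψ.analysisOp.adjoint ∘L hψ.analysisOp

theorem IsFrame.frameOp_eq {ψ : I → H} (hψ : IsFrame ψ) (f : H) : frameOp ψ f = hψ.op f :=
  (hψ.hasSum_adjoint_analysisOp (hψ.analysisOp f)).tsum_eq

theorem IsFrame.isSelfAdjoint_op {ψ : I → H} (hψ : IsFrame ψ) : IsSelfAdjoint hψ.op := by
  rw [ContinuousLinearMap.isSelfAdjoint_iff']
  simp [IsFrame.op, ContinuousLinearMap.adjoint_comp]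

/-- The frame operator is a scalar operator up to an error of relative size less than `1`: its
spectrum lies in a disc whose closure misses zero. -/
theorem IsFrame.exists_norm_sub_op_lt {ψ : I → H} (hψ : IsFrame ψ) :
    ∃ R r : ℝ, 0 < r ∧ r < R ∧ ‖algebraMap ℂ (H →L[ℂ] H) R - hψ.op‖ < r := by
  obtain ⟨A, B, hA, hB, h⟩ := id hψ
  set S := hψ.op with hS
  set M : ℝ := ‖S‖ + A + 1 with hM
  have hMpos : 0 < M := by positivity
  have hlow : ∀ f, A * ‖f‖ ^ 2 ≤ RCLike.re (inner ℂ (S f) f) := fun f => by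
    have : inner ℂ (S f) f = ((‖hψ.analysisOp f‖ ^ 2 : ℝ) : ℂ) := by
      rw [hS, IsFrame.op, ContinuousLinearMap.comp_apply, ContinuousLinearMap.adjoint_inner_left,
        inner_self_eq_norm_sq_to_K]
      simp
    rw [this]
    have h2 := (h f).2.1
    have h3 := norm_sq_lp_two (hψ.analysisOp f)
    simp only [IsFrame.analysisOp_apply] at h3
    rw [← h3] at h2
    exact h2
  -- the disc of centre `M² / A`, for which `‖(R - S) f‖² ≤ (R² - M²) ‖f‖²`
  set R : ℝ := M ^ 2 / A with hR
  have hRA : R * A = M ^ 2 := by rw [hR]; field_simp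
  have hRM : M ^ 2 < R ^ 2 := by
    have : M < R := by
      rw [hR, lt_div_iff₀ hA]
      nlinarith [norm_nonneg S]
    exact pow_lt_pow_left₀ this hMpos.le two_ne_zero
  have hRpos : 0 < R := by positivity
  have hbound : ‖algebraMap ℂ (H →L[ℂ] H) R - S‖ ≤ √(R ^ 2 - M ^ 2) := by
    refine ContinuousLinearMap.opNorm_le_bound _ (Real.sqrt_nonneg _) fun f => ?_
    refine le_of_sq_le_sq ?_ (by positivity)
    rw [mul_pow, Real.sq_sqrt (by linarith)]
    have e : (algebraMap ℂ (H →L[ℂ] H) R - S) f = (R : ℂ) • f - S f := by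
      simp [Algebra.algebraMap_eq_smul_one]
    rw [e, @norm_sub_sq ℂ]
    have h1 : RCLike.re (inner ℂ ((R : ℂ) • f) (S f)) = R * RCLike.re (inner ℂ (S f) f) := by
      rw [inner_smul_left, Complex.conj_ofReal, inner_re_symm (𝕜 := ℂ) (S f)]
      simp
    have h2 : ‖S f‖ ≤ M * ‖f‖ := (S.le_opNorm f).trans (by gcongr; linarith)
    have h3 : ‖S f‖ ^ 2 ≤ M ^ 2 * ‖f‖ ^ 2 := by
      rw [← mul_pow]
      gcongr
    have h4 : R * (A * ‖f‖ ^ 2) ≤ R * RCLike.re (inner ℂ (S f) f) := by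
      gcongr
      exact hlow f
    rw [← mul_assoc, hRA] at h4
    have h5 : ‖(R : ℂ) • f‖ ^ 2 = R ^ 2 * ‖f‖ ^ 2 := by
      rw [norm_smul, mul_pow]
      simp
    rw [h1, h5]
    nlinarith
  have hlt : √(R ^ 2 - M ^ 2) < R := by
    rw [Real.sqrt_lt' hRpos]
    have : 0 < M ^ 2 := by positivity
    linarith
  obtain ⟨r, hr1, hr2⟩ := exists_between hlt
  exact ⟨R, r, (Real.sqrt_nonneg _).trans_lt hr1, hr2, hbound.trans_lt hr1⟩

theorem mem_ball_of_mem_spectrum {S : H →L[ℂ] H} {R r : ℝ}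
    (h : ‖algebraMap ℂ (H →L[ℂ] H) R - S‖ < r) {z : ℂ} (hz : z ∈ spectrum ℂ S) :
    z ∈ Metric.ball (R : ℂ) r := by
  have h1 : (R : ℂ) - z ∈ spectrum ℂ (algebraMap ℂ (H →L[ℂ] H) R - S) := by
    rw [← spectrum.singleton_sub_eq]
    exact Set.sub_mem_sub rfl hz
  have := (spectrum.subset_closedBall_norm_mul _ h1)
  rw [mem_closedBall_zero_iff] at this
  have h2 := ContinuousLinearMap.norm_id_le (𝕜 := ℂ) (E := H)
  rw [mem_ball_iff_norm, norm_sub_rev]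
  refine lt_of_le_of_lt (this.trans ?_) h
  exact mul_le_of_le_one_right (norm_nonneg _) h2

theorem IsFrame.isUnit_op {ψ : I → H} (hψ : IsFrame ψ) : IsUnit hψ.op := by
  obtain ⟨R, r, -, hrR, h⟩ := hψ.exists_norm_sub_op_lt
  rw [← spectrum.zero_notMem_iff ℂ]
  intro h0
  have := mem_ball_of_mem_spectrum h h0
  rw [mem_ball_iff_norm] at this
  simp only [zero_sub, norm_neg, Complex.norm_real, Real.norm_eq_abs] at this
  exact absurd ((le_abs_self R).trans_lt this) (by linarith)

theorem IsFrame.op_dual {ψ : I → H} (hψ : IsFrame ψ) (i : I) : hψ.op (dual ψ i) = ψ i := by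
  rw [← hψ.frameOp_eq]
  refine Function.invFun_eq ?_
  obtain ⟨u, hu⟩ := hψ.isUnit_op
  refine ⟨(↑u⁻¹ : H →L[ℂ] H) (ψ i), ?_⟩
  rw [hψ.frameOp_eq, ← hu, ← mul_apply_eq_comp, Units.mul_inv]
  rfl

theorem IsFrame.inverse_op_apply {ψ : I → H} (hψ : IsFrame ψ) (i : I) :
    Ring.inverse hψ.op (ψ i) = dual ψ i := by
  rw [← hψ.op_dual i, ← mul_apply_eq_comp, Ring.inverse_mul_cancel _ hψ.isUnit_op]
  rfl

theorem IsFrame.inner_op {ψ : I → H} (hψ : IsFrame ψ) (f g : H) :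
    inner ℂ (hψ.op f) g = inner ℂ f (hψ.op g) := by
  rw [← ContinuousLinearMap.adjoint_inner_left, hψ.isSelfAdjoint_op.adjoint_eq]

theorem IsFrame.inner_dual_op {ψ : I → H} (hψ : IsFrame ψ) (i : I) (g : H) :
    inner ℂ (dual ψ i) (hψ.op g) = inner ℂ (ψ i) g := by
  rw [← hψ.inner_op, hψ.op_dual]

theorem IsFrame.op_surjective {ψ : I → H} (hψ : IsFrame ψ) : Function.Surjective hψ.op := by
  intro f
  refine ⟨Ring.inverse hψ.op f, ?_⟩
  rw [← mul_apply_eq_comp, Ring.mul_inverse_cancel _ hψ.isUnit_op]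
  rfl

/-- The frame expansion `f = ∑ ⟨f, ψ̃ i⟩ ψ i`. -/
theorem IsFrame.hasSum_inner_dual {ψ : I → H} (hψ : IsFrame ψ) (f : H) :
    HasSum (fun i => (inner ℂ (dual ψ i) f : ℂ) • ψ i) f := by
  obtain ⟨g, rfl⟩ := hψ.op_surjective f
  refine (hψ.hasSum_adjoint_analysisOp (hψ.analysisOp g)).congr_fun fun i => ?_
  rw [hψ.inner_dual_op, hψ.analysisOp_apply]

/-- The dual frame expansion `f = ∑ ⟨f, ψ i⟩ ψ̃ i`. -/
theorem IsFrame.hasSum_inner {ψ : I → H} (hψ : IsFrame ψ) (f : H) :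
    HasSum (fun i => (inner ℂ (ψ i) f : ℂ) • dual ψ i) f := by
  have h := (hψ.hasSum_adjoint_analysisOp (hψ.analysisOp f)).mapL (Ring.inverse hψ.op)
  have e : Ring.inverse hψ.op (hψ.analysisOp.adjoint (hψ.analysisOp f)) = f := by
    change Ring.inverse hψ.op (hψ.op f) = f
    rw [← mul_apply_eq_comp, Ring.inverse_mul_cancel _ hψ.isUnit_op]
    rfl
  rw [e] at h
  refine h.congr_fun fun i => ?_
  rw [map_smul, hψ.inverse_op_apply, hψ.analysisOp_apply]

theorem IsFrame.hasSum_inner_mul_inner_dual {ψ : I → H} (hψ : IsFrame ψ) (f g : H) :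
    HasSum (fun l => (inner ℂ g (ψ l) : ℂ) * inner ℂ (dual ψ l) f) (inner ℂ g f) := by
  refine ((hψ.hasSum_inner_dual f).mapL (innerSL ℂ g)).congr_fun fun l => ?_
  simp [mul_comm]

theorem IsFrame.hasSum_inner_dual_mul_inner {ψ : I → H} (hψ : IsFrame ψ) (f g : H) :
    HasSum (fun l => (inner ℂ g (dual ψ l) : ℂ) * inner ℂ (ψ l) f) (inner ℂ g f) := by
  refine ((hψ.hasSum_inner f).mapL (innerSL ℂ g)).congr_fun fun l => ?_
  simp [mul_comm]

/-- The cross Gram matrix `(⟨ψ l, ψ̃ i⟩)` is Hermitian. -/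
theorem IsFrame.inner_dual_symm {ψ : I → H} (hψ : IsFrame ψ) (i l : I) :
    (inner ℂ (dual ψ i) (ψ l) : ℂ) = inner ℂ (ψ i) (dual ψ l) := by
  rw [← hψ.op_dual l, hψ.inner_dual_op]

end FrameOperator

/-! ### Inverting the frame operator by a contour integral -/

section Contour

theorem ne_zero_of_mem_closedBall {R r : ℝ} (hrR : r < R) {z : ℂ}
    (hz : z ∈ Metric.closedBall (R : ℂ) r) : z ≠ 0 := by
  rintro rfl
  rw [mem_closedBall_iff_norm] at hz
  simp only [zero_sub, norm_neg, Complex.norm_real, Real.norm_eq_abs] at hz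
  exact absurd ((le_abs_self R).trans hz) (by linarith)

theorem circleIntegral_inv_sq {R r : ℝ} (hr : 0 < r) (hrR : r < R) :
    (∮ z in C((R : ℂ), r), (z ^ 2)⁻¹) = 0 := by
  have hd : DifferentiableOn ℂ (fun z : ℂ => (z ^ 2)⁻¹) (Metric.closedBall (R : ℂ) r) :=
    fun z hz => ((differentiableAt_id.pow 2).inv
      (pow_ne_zero 2 (ne_zero_of_mem_closedBall hrR hz))).differentiableWithinAt
  exact Complex.circleIntegral_eq_zero_of_differentiable_on_off_countable hr.le
    Set.countable_empty hd.continuousOn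
    fun z hz => hd.differentiableAt (Metric.closedBall_mem_nhds_of_mem hz.1)

theorem circleIntegral_inv_sq_mul_inv_sub {R r : ℝ} (hrR : r < R) {w : ℂ}
    (hw : w ∈ Metric.ball (R : ℂ) r) :
    (∮ z in C((R : ℂ), r), (z ^ 2)⁻¹ * (z - w)⁻¹) = 2 * Real.pi * Complex.I * (w ^ 2)⁻¹ := by
  have hd : DifferentiableOn ℂ (fun z : ℂ => (z ^ 2)⁻¹) (Metric.closedBall (R : ℂ) r) :=
    fun z hz => ((differentiableAt_id.pow 2).inv
      (pow_ne_zero 2 (ne_zero_of_mem_closedBall hrR hz))).differentiableWithinAt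
  simpa [mul_comm] using hd.circleIntegral_sub_inv_smul hw

variable {H : Type*} [NormedAddCommGroup H] [InnerProductSpace ℂ H] [CompleteSpace H]

/-- The contour integral is computed by the functional calculus of `S`, under the integral sign: it
reduces to a scalar integral at each point of the spectrum. -/
theorem circleIntegral_inv_sq_smul_resolvent {S : H →L[ℂ] H} (hS : IsStarNormal S) {R r : ℝ}
    (hr : 0 < r) (hrR : r < R) (h : ‖algebraMap ℂ (H →L[ℂ] H) R - S‖ < r) :
    (∮ z in C((R : ℂ), r), (z ^ 2)⁻¹ • resolvent S z) =
      (2 * Real.pi * Complex.I : ℂ) • Ring.inverse (S ^ 2) := by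
  have hspec : ∀ w ∈ spectrum ℂ S, w ∈ Metric.ball (R : ℂ) r := fun w hw =>
    mem_ball_of_mem_spectrum h hw
  have hw0 : ∀ w ∈ spectrum ℂ S, w ≠ 0 := fun w hw =>
    ne_zero_of_mem_closedBall hrR (Metric.ball_subset_closedBall (hspec w hw))
  have hz0 : ∀ θ, circleMap (R : ℂ) r θ ≠ 0 := fun θ =>
    ne_zero_of_mem_closedBall hrR (circleMap_mem_closedBall _ hr.le θ)
  have hzw : ∀ θ, ∀ w ∈ spectrum ℂ S, circleMap (R : ℂ) r θ - w ≠ 0 := fun θ w hw =>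
    sub_ne_zero.2 (circleMap_ne_mem_ball (hspec w hw) θ)
  set f : ℝ → ℂ → ℂ := fun θ w =>
    deriv (circleMap (R : ℂ) r) θ * (((circleMap (R : ℂ) r θ) ^ 2)⁻¹ *
      (circleMap (R : ℂ) r θ - w)⁻¹) with hf
  have hfc : ContinuousOn (Function.uncurry f) (Set.univ ×ˢ spectrum ℂ S) := by
    have h1 : Continuous (fun x : ℝ × ℂ => circleMap (R : ℂ) r x.1) :=
      (continuous_circleMap _ _).comp continuous_fst
    have h2 : Continuous (fun x : ℝ × ℂ => deriv (circleMap (R : ℂ) r) x.1) := by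
      simp only [deriv_circleMap]
      exact ((continuous_circleMap _ _).comp continuous_fst).mul continuous_const
    refine h2.continuousOn.mul (ContinuousOn.mul ?_ ?_)
    · exact (h1.pow 2).continuousOn.inv₀ fun x _ => pow_ne_zero 2 (hz0 x.1)
    · exact (h1.sub continuous_snd).continuousOn.inv₀ fun x hx => hzw x.1 x.2 hx.2
  have hK : IsCompact (Set.Icc 0 (2 * Real.pi) ×ˢ spectrum ℂ S) :=
    isCompact_Icc.prod (spectrum.isCompact S)
  obtain ⟨M, hM⟩ := hK.exists_bound_of_continuousOn
    (hfc.mono (Set.prod_mono (Set.subset_univ _) subset_rfl))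
  have hcfc : ∀ θ, cfc (f θ) S = deriv (circleMap (R : ℂ) r) θ •
      (((circleMap (R : ℂ) r θ) ^ 2)⁻¹ • resolvent S (circleMap (R : ℂ) r θ)) := fun θ => by
    have hc : ContinuousOn (fun w : ℂ => (circleMap (R : ℂ) r θ - w)⁻¹) (spectrum ℂ S) :=
      (continuous_const.sub continuous_id).continuousOn.inv₀ fun w hw => hzw θ w hw
    change cfc (fun w => deriv (circleMap (R : ℂ) r) θ * ((fun w => (circleMap (R : ℂ) r θ ^ 2)⁻¹ *
      (circleMap (R : ℂ) r θ - w)⁻¹) w)) S = _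
    rw [cfc_const_mul _ (fun w => (circleMap (R : ℂ) r θ ^ 2)⁻¹ *
      (circleMap (R : ℂ) r θ - w)⁻¹) S (continuousOn_const.mul hc), cfc_const_mul _ _ S hc,
      cfc_inv (fun w => circleMap (R : ℂ) r θ - w) S (hzw θ), cfc_sub _ _ S, cfc_const _ S,
      cfc_id' ℂ S]
    rfl
  have key := cfc_setIntegral (μ := MeasureTheory.volume) (s := Set.Ioc 0 (2 * Real.pi))
    measurableSet_Ioc f (fun _ => M) S
    (hfc.mono (Set.prod_mono (Set.subset_univ _) subset_rfl))
    ((MeasureTheory.ae_restrict_iff' measurableSet_Ioc).2 (.of_forall fun θ hθ w hw =>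
      hM (θ, w) ⟨Set.Ioc_subset_Icc_self hθ, hw⟩))
    (MeasureTheory.hasFiniteIntegral_const M)
  have hpi : (0 : ℝ) ≤ 2 * Real.pi := by positivity
  rw [circleIntegral, intervalIntegral.integral_of_le hpi]
  simp_rw [← hcfc]
  rw [← key]
  have e : (spectrum ℂ S).EqOn (fun w => ∫ θ in Set.Ioc 0 (2 * Real.pi), f θ w)
      fun w => (2 * Real.pi * Complex.I : ℂ) * (w ^ 2)⁻¹ := fun w hw => by
    have := circleIntegral_inv_sq_mul_inv_sub hrR (hspec w hw)
    rw [circleIntegral, intervalIntegral.integral_of_le hpi] at this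
    exact this
  have hc2 : ContinuousOn (fun w : ℂ => (w ^ 2)⁻¹) (spectrum ℂ S) :=
    (continuous_id.pow 2).continuousOn.inv₀ fun w hw => pow_ne_zero 2 (hw0 w hw)
  rw [cfc_congr e, cfc_const_mul _ _ S hc2,
    cfc_inv (fun w => w ^ 2) S (fun w hw => pow_ne_zero 2 (hw0 w hw)), cfc_pow_id S 2]

end Contour

/-! ### A spectral matrix algebra as a Banach algebra -/

section Algebra

variable {I : Type*}

/-- Bounded operators on `ℓ²` are determined by their matrices. -/
theorem ext_entry {S T : lp (fun _ : I => ℂ) 2 →L[ℂ] lp (fun _ : I => ℂ) 2}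
    (h : ∀ i j, entry S i j = entry T i j) : S = T := by
  classical
  ext c i
  have h1 := (lp.hasSum_single (by simp) c).mapL S
  have h2 := (lp.hasSum_single (by simp) c).mapL T
  have e : ∀ j, S (lp.single 2 j (c j)) = T (lp.single 2 j (c j)) := fun j => by
    have e1 : lp.single (E := fun _ : I => ℂ) 2 j (c j) = c j • lp.single 2 j (1 : ℂ) := by
      rw [← lp.single_smul]
      simp
    rw [e1, map_smul, map_smul]
    congr 1
    ext i
    convert h i j
    · simp only [entry]
    · simp only [entry]
  simp_rw [e] at h1
  rw [h1.unique h2]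

/-- The matrix entry as a linear functional. -/
noncomputable def entryCLM (i j : I) :
    (lp (fun _ : I => ℂ) 2 →L[ℂ] lp (fun _ : I => ℂ) 2) →L[ℂ] ℂ :=
  open Classical in
  (innerSL ℂ (lp.single 2 i (1 : ℂ))).comp
    (ContinuousLinearMap.apply ℂ (lp (fun _ : I => ℂ) 2) (lp.single 2 j (1 : ℂ)))

theorem entryCLM_apply (i j : I) (T : lp (fun _ : I => ℂ) 2 →L[ℂ] lp (fun _ : I => ℂ) 2) :
    entryCLM i j T = entry T i j := by
  classical
  simp [entryCLM, entry, lp.inner_single_left]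

theorem entry_smul (a : ℂ) (T : lp (fun _ : I => ℂ) 2 →L[ℂ] lp (fun _ : I => ℂ) 2) (i j : I) :
    entry (a • T) i j = a * entry T i j := by
  rw [← entryCLM_apply, map_smul, entryCLM_apply, smul_eq_mul]

/-- A spectral matrix algebra `A` with the Banach algebra structure given by its own norm. It is
a synonym of `A.carrier`, which carries the topology of the operator norm. -/
def SpectralMatrixAlgebra.Alg (A : SpectralMatrixAlgebra I) : Type _ := A.carrier

namespace SpectralMatrixAlgebra

variable (A : SpectralMatrixAlgebra I)

noncomputable instance : NormedRing A.Alg :=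
  RingNorm.toNormedRing (R := A.carrier) A.nrm.toRingNorm

noncomputable instance : NormedAlgebra ℂ A.Alg where
  __ := (inferInstanceAs (Algebra ℂ A.carrier) : Algebra ℂ A.carrier)
  norm_smul_le a T := (A.nrm.smul' a T).le

instance : CompleteSpace A.Alg := by
  refine Metric.complete_of_cauchySeq_tendsto fun u hu => ?_
  obtain ⟨a, ha⟩ := A.complete u fun ε hε => by
    obtain ⟨N, hN⟩ := Metric.cauchySeq_iff.1 hu ε hε
    refine ⟨N, fun m hm n hn => ?_⟩
    have := hN m hm n hn
    rwa [dist_eq_norm] at this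
  exact ⟨a, tendsto_iff_norm_sub_tendsto_zero.2 ha⟩

/-- The embedding of the algebra into the bounded operators. -/
noncomputable def val : A.Alg →ₐ[ℂ] (lp (fun _ : I => ℂ) 2 →L[ℂ] lp (fun _ : I => ℂ) 2) :=
  A.carrier.toSubalgebra.val

theorem val_mem (T : A.Alg) : A.val T ∈ A.carrier := T.2

/-- An entry depends continuously on the element of the algebra: by solidity the norm of `T`
dominates that of the matrix whose only nonzero entry is `T i j`, and these matrices span at most
a line, on which all norms are proportional. -/
theorem exists_norm_entry_le (i j : I) :
    ∃ K : ℝ, ∀ T : A.Alg, ‖entry (A.val T) i j‖ ≤ K * ‖T‖ := by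
  classical
  by_cases h : ∃ T₀ : A.Alg, entry (A.val T₀) i j ≠ 0
  · obtain ⟨T₀, hT₀⟩ := h
    have single : ∀ T : A.Alg, ∃ S : A.Alg, (∀ k l, entry (A.val S) k l =
        if k = i ∧ l = j then entry (A.val T) i j else 0) ∧ ‖S‖ ≤ ‖T‖ := fun T =>
      A.solid T _ fun k l => by
        split_ifs with h
        · rw [h.1, h.2]; rfl
        · simp
    obtain ⟨E, hE, -⟩ := single T₀
    have hE0 : 0 < ‖E‖ := by
      rw [norm_pos_iff]
      rintro rfl
      have := hE i j
      rw [map_zero, ← entryCLM_apply, map_zero] at this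
      simp only [and_self, if_true] at this
      exact hT₀ this.symm
    refine ⟨‖entry (A.val T₀) i j‖ / ‖E‖, fun T => ?_⟩
    obtain ⟨S, hS, hST⟩ := single T
    have e : entry (A.val T₀) i j • S = entry (A.val T) i j • E := by
      refine Subtype.val_injective (ext_entry fun k l => ?_)
      change entry (A.val (entry (A.val T₀) i j • S)) k l =
        entry (A.val (entry (A.val T) i j • E)) k l
      rw [map_smul, map_smul, entry_smul, entry_smul, hS, hE]
      split_ifs
      · exact mul_comm _ _
      · simp
    have h1 := congrArg norm e
    rw [norm_smul, norm_smul] at h1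
    rw [div_mul_eq_mul_div, le_div_iff₀ hE0, ← h1]
    gcongr
  · push Not at h
    exact ⟨0, fun T => by simp [h T]⟩

/-- The matrix entry as a continuous linear functional for the norm of the algebra. -/
noncomputable def algEntry (i j : I) : A.Alg →L[ℂ] ℂ :=
  LinearMap.mkContinuousOfExistsBound ((entryCLM i j).toLinearMap ∘ₗ A.val.toLinearMap) (by
    obtain ⟨K, hK⟩ := A.exists_norm_entry_le i j
    refine ⟨K, fun T => ?_⟩
    change ‖entryCLM i j (A.val T)‖ ≤ K * ‖T‖
    rw [entryCLM_apply]
    exact hK T)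

theorem algEntry_apply (i j : I) (T : A.Alg) : A.algEntry i j T = entry (A.val T) i j :=
  entryCLM_apply i j _

end SpectralMatrixAlgebra

variable {H : Type*} [NormedAddCommGroup H] [InnerProductSpace ℂ H] [CompleteSpace H]

theorem IsFrame.entry_comp {ψ : I → H} (hψ : IsFrame ψ) (T : H →L[ℂ] H) (i j : I) :
    entry (hψ.analysisOp ∘L T ∘L hψ.analysisOp.adjoint) i j = inner ℂ (ψ i) (T (ψ j)) := by
  classical
  unfold entry
  rw [← hψ.adjoint_analysisOp_single j, ContinuousLinearMap.comp_apply, hψ.analysisOp_apply]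
  simp only [ContinuousLinearMap.comp_apply]

/-- The resolvent of the Gram operator in terms of the resolvent of the frame operator. -/
theorem IsFrame.resolvent_gram {ψ : I → H} (hψ : IsFrame ψ) {z : ℂ} (hz0 : z ≠ 0)
    (hz : z ∈ resolventSet ℂ hψ.op) :
    (algebraMap ℂ _ z - hψ.analysisOp ∘L hψ.analysisOp.adjoint) *
        (z⁻¹ • (1 + hψ.analysisOp ∘L resolvent hψ.op z ∘L hψ.analysisOp.adjoint)) = 1 ∧
      (z⁻¹ • (1 + hψ.analysisOp ∘L resolvent hψ.op z ∘L hψ.analysisOp.adjoint)) *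
        (algebraMap ℂ _ z - hψ.analysisOp ∘L hψ.analysisOp.adjoint) = 1 := by
  have h1 : ∀ y, z • resolvent hψ.op z y -
      hψ.analysisOp.adjoint (hψ.analysisOp (resolvent hψ.op z y)) = y := fun y => by
    have := congrArg (· y) (Ring.mul_inverse_cancel _ hz)
    simpa [resolvent, Algebra.algebraMap_eq_smul_one, IsFrame.op] using this
  have h2 : ∀ y, resolvent hψ.op z (z • y - hψ.analysisOp.adjoint (hψ.analysisOp y)) = y :=
    fun y => by
      have := congrArg (· y) (Ring.inverse_mul_cancel _ hz)
      simpa [resolvent, Algebra.algebraMap_eq_smul_one, IsFrame.op] using this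
  constructor
  · refine ContinuousLinearMap.ext fun x => ?_
    set y := hψ.analysisOp.adjoint x with hy
    have e : hψ.analysisOp.adjoint (hψ.analysisOp (resolvent hψ.op z y)) =
        z • resolvent hψ.op z y - y := by
      rw [eq_sub_iff_add_eq, ← eq_sub_iff_add_eq']
      exact (h1 y).symm
    simp only [mul_apply_eq_comp, smul_apply, add_apply, sub_apply,
      ContinuousLinearMap.comp_apply, Algebra.algebraMap_eq_smul_one, one_apply_eq_self,
      map_smul, map_add, ← hy, e, map_sub]
    simp only [smul_sub, smul_add, smul_smul, inv_mul_cancel₀ hz0, one_smul]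
    abel
  · refine ContinuousLinearMap.ext fun x => ?_
    set y := hψ.analysisOp.adjoint x with hy
    have e : resolvent hψ.op z (hψ.analysisOp.adjoint (hψ.analysisOp y)) =
        z • resolvent hψ.op z y - y := by
      rw [eq_sub_iff_add_eq, ← eq_sub_iff_add_eq', ← map_smul, ← map_sub]
      exact (h2 y).symm
    simp only [mul_apply_eq_comp, smul_apply, add_apply, sub_apply,
      ContinuousLinearMap.comp_apply, Algebra.algebraMap_eq_smul_one, one_apply_eq_self,
      map_smul, ← hy, map_sub, e]
    simp only [smul_sub, smul_add, smul_smul, mul_inv_cancel₀ hz0, inv_mul_cancel₀ hz0, one_smul]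
    abel

end Algebra

/-! ### The Gram matrices of a localised frame and of its dual -/

section GramMatrices

variable {I H : Type*} [NormedAddCommGroup H] [InnerProductSpace ℂ H] [CompleteSpace H]

theorem clm_circleIntegral {E F : Type*} [NormedAddCommGroup E] [NormedSpace ℂ E]
    [CompleteSpace E] [NormedAddCommGroup F] [NormedSpace ℂ F] [CompleteSpace F] (L : E →L[ℂ] F)
    {f : ℂ → E} {c : ℂ} {r : ℝ} (hf : CircleIntegrable f c r) :
    L (∮ z in C(c, r), f z) = ∮ z in C(c, r), L (f z) := by
  unfold circleIntegral
  rw [← L.intervalIntegral_comp_comm hf.out]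
  simp

/-- The matrix of the operator `C S⁻² C*`, where `C` is the analysis operator and `S` the frame
operator, is the Gram matrix of the dual frame. -/
theorem IsFrame.inner_inverse_op_sq {ψ : I → H} (hψ : IsFrame ψ) (i j : I) :
    (inner ℂ (ψ i) (Ring.inverse (hψ.op ^ 2) (ψ j)) : ℂ) = inner ℂ (dual ψ i) (dual ψ j) := by
  rw [← Ring.inverse_pow, pow_two, mul_apply_eq_comp, hψ.inverse_op_apply, ← hψ.inner_dual_op,
    ← mul_apply_eq_comp, Ring.mul_inverse_cancel _ hψ.isUnit_op, one_apply_eq_self]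

/-- The Gram matrix of the canonical dual of a localised frame lies in the algebra. It is the
pseudo-inverse of the Gram operator `G`, which is the integral of `z⁻¹ (z - G)⁻¹` over a circle
that separates zero from the rest of the spectrum. As the algebra is inverse-closed, this is an
integral in the algebra. -/
theorem IsLocalised.hasMatrix_dual {A : SpectralMatrixAlgebra I} {ψ : I → H}
    (h : IsLocalised A ψ) : A.HasMatrix fun i j => inner ℂ (dual ψ i) (dual ψ j) := by
  obtain ⟨hψ, T, hT, hTe⟩ := h
  obtain ⟨R, r, hr, hrR, hRS⟩ := hψ.exists_norm_sub_op_lt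
  set V := hψ.analysisOp with hV
  have hTV : T = V ∘L V.adjoint := by
    refine ext_entry fun i j => ?_
    rw [hTe]
    exact (hψ.entry_comp (ContinuousLinearMap.id ℂ H) i j).symm
  set g : A.Alg := ⟨T, hT⟩ with hg
  have hz0 : ∀ z ∈ Metric.sphere (R : ℂ) r, z ≠ 0 := fun z hz =>
    ne_zero_of_mem_closedBall hrR (Metric.sphere_subset_closedBall hz)
  have hzS : ∀ z ∈ Metric.sphere (R : ℂ) r, z ∈ resolventSet ℂ hψ.op := fun z hz => by
    by_contra h'
    have := mem_ball_of_mem_spectrum hRS h'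
    rw [Metric.mem_ball] at this
    rw [Metric.mem_sphere] at hz
    exact this.ne hz
  have hres : ∀ z ∈ Metric.sphere (R : ℂ) r, z ∈ resolventSet ℂ g ∧
      A.val (resolvent g z) = z⁻¹ • (1 + V ∘L resolvent hψ.op z ∘L V.adjoint) := fun z hz => by
    obtain ⟨h1, h2⟩ := hψ.resolvent_gram (hz0 z hz) (hzS z hz)
    rw [← hV, ← hTV] at h1 h2
    have hmem : algebraMap ℂ _ z - T ∈ A.carrier := sub_mem (algebraMap_mem _ _) hT
    have hQ := A.inverse_closed _ hmem _ h1 h2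
    set Q := z⁻¹ • (1 + V ∘L resolvent hψ.op z ∘L V.adjoint)
    let u : A.Algˣ := ⟨algebraMap ℂ A.Alg z - g, ⟨Q, hQ⟩, Subtype.ext h1, Subtype.ext h2⟩
    refine ⟨u.isUnit, ?_⟩
    have : resolvent g z = ((u⁻¹ : A.Algˣ) : A.Alg) := Ring.inverse_unit u
    rw [this]
    rfl
  have hcont : ContinuousOn (fun z => z⁻¹ • resolvent g z) (Metric.sphere (R : ℂ) r) :=
    (continuousOn_id.inv₀ hz0).smul fun z hz =>
      (spectrum.hasDerivAt_resolvent_const_left (hres z hz).1).continuousAt.continuousWithinAt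
  have hcontS : ContinuousOn (fun z => (z ^ 2)⁻¹ • resolvent hψ.op z)
      (Metric.sphere (R : ℂ) r) :=
    ((continuousOn_id.pow 2).inv₀ fun z hz => pow_ne_zero 2 (hz0 z hz)).smul fun z hz =>
      (spectrum.hasDerivAt_resolvent_const_left (hzS z hz)).continuousAt.continuousWithinAt
  have hpi : (2 * Real.pi * Complex.I : ℂ) ≠ 0 := Complex.two_pi_I_ne_zero
  set D : A.Alg := ∮ z in C((R : ℂ), r), z⁻¹ • resolvent g z
  refine ⟨A.val ((2 * Real.pi * Complex.I : ℂ)⁻¹ • D), A.val_mem _, fun i j => ?_⟩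
  have hD : entry (A.val D) i j =
      (2 * Real.pi * Complex.I : ℂ) * inner ℂ (dual ψ i) (dual ψ j) := by
    rw [← A.algEntry_apply]
    refine (clm_circleIntegral (A.algEntry i j) (hcont.circleIntegrable hr.le)).trans ?_
    set L : (H →L[ℂ] H) →L[ℂ] ℂ :=
      (innerSL ℂ (ψ i)).comp (ContinuousLinearMap.apply ℂ H (ψ j)) with hL
    have e : Set.EqOn (fun z => A.algEntry i j (z⁻¹ • resolvent g z))
        (fun z => entry 1 i j * (z ^ 2)⁻¹ + L ((z ^ 2)⁻¹ • resolvent hψ.op z))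
        (Metric.sphere (R : ℂ) r) := fun z hz => by
      have h1 : entry (1 + V ∘L resolvent hψ.op z ∘L V.adjoint) i j =
          entry 1 i j + inner ℂ (ψ i) (resolvent hψ.op z (ψ j)) := by
        rw [← entryCLM_apply, map_add, entryCLM_apply, entryCLM_apply, hψ.entry_comp]
      have h2 : L (resolvent hψ.op z) = inner ℂ (ψ i) (resolvent hψ.op z (ψ j)) := rfl
      simp only
      rw [A.algEntry_apply, map_smul, (hres z hz).2, entry_smul, entry_smul, h1, map_smul, h2,
        smul_eq_mul, pow_two, mul_inv]
      ring
    refine (circleIntegral.integral_congr hr.le e).trans ?_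
    rw [circleIntegral.integral_add,
      circleIntegral.integral_const_mul, circleIntegral_inv_sq hr hrR, mul_zero, zero_add,
      ← clm_circleIntegral L (hcontS.circleIntegrable hr.le),
      circleIntegral_inv_sq_smul_resolvent hψ.isSelfAdjoint_op.isStarNormal hr hrR hRS, map_smul,
      smul_eq_mul, ← hψ.inner_inverse_op_sq]
    · rfl
    · exact (continuousOn_const.mul ((continuousOn_id.pow 2).inv₀
        fun z hz => pow_ne_zero 2 (hz0 z hz))).circleIntegrable hr.le
    · exact (L.continuous.comp_continuousOn hcontS).circleIntegrable hr.le
  rw [map_smul, entry_smul, hD, inv_mul_cancel_left₀ hpi]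

/-- The cross Gram matrix of a localised frame and its dual lies in the algebra, as the product
of the Gram matrices of the dual and of the frame. -/
theorem IsLocalised.hasMatrix_cross {A : SpectralMatrixAlgebra I} {ψ : I → H}
    (h : IsLocalised A ψ) : A.HasMatrix fun i j => inner ℂ (dual ψ i) (ψ j) := by
  obtain ⟨T', hT', hTe'⟩ := h.hasMatrix_dual
  obtain ⟨hψ, T, hT, hTe⟩ := h
  have e : T = hψ.analysisOp ∘L hψ.analysisOp.adjoint := by
    refine ext_entry fun i j => ?_
    rw [hTe]
    exact (hψ.entry_comp (ContinuousLinearMap.id ℂ H) i j).symm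
  have e' : T' = hψ.analysisOp ∘L Ring.inverse (hψ.op ^ 2) ∘L hψ.analysisOp.adjoint := by
    refine ext_entry fun i j => ?_
    rw [hTe', hψ.entry_comp, hψ.inner_inverse_op_sq]
  refine ⟨T' * T, mul_mem hT' hT, fun i j => ?_⟩
  have e2 : T' * T = hψ.analysisOp ∘L Ring.inverse hψ.op ∘L hψ.analysisOp.adjoint := by
    rw [e, e']
    refine ContinuousLinearMap.ext fun x => ?_
    have : ∀ y, Ring.inverse (hψ.op ^ 2) (hψ.op y) = Ring.inverse hψ.op y := fun y => by
      rw [← Ring.inverse_pow, pow_two, mul_apply_eq_comp, ← mul_apply_eq_comp _ hψ.op,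
        Ring.inverse_mul_cancel _ hψ.isUnit_op, one_apply_eq_self]
    simp only [mul_apply_eq_comp, ContinuousLinearMap.comp_apply]
    rw [← this]
    rfl
  rw [e2, hψ.entry_comp, hψ.inverse_op_apply]
  exact (hψ.inner_dual_symm i j).symm

end GramMatrices

section Admissible

theorem enorm_inner_symm {H : Type*} [NormedAddCommGroup H] [InnerProductSpace ℂ H] (f g : H) :
    ‖(inner ℂ f g : ℂ)‖ₑ = ‖(inner ℂ g f : ℂ)‖ₑ := by
  rw [← ofReal_norm, norm_inner_symm, ofReal_norm]

variable {I : Type*}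

/-- By solidity, an admissible weight is admissible for the absolute values of the matrices. -/
theorem IsAdmissible.actsOn {A : SpectralMatrixAlgebra I} {w : I → ℝ} (hw : IsAdmissible A w)
    {M : I → I → ℂ} (hM : A.HasMatrix M) : ActsOn M w := by
  obtain ⟨T, hT, hTe⟩ := hM
  obtain ⟨⟨S, hS⟩, hSe, -⟩ := A.solid ⟨T, hT⟩ (fun i j => (‖M i j‖ : ℂ)) fun i j => by
    rw [hTe]
    simp
  intro p hp
  obtain ⟨C, hC⟩ := hw.2 S hS p hp
  -- the constant must not vanish: it is multiplied with an infinite norm below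
  refine ⟨C + 1, fun a => ?_⟩
  rcases eq_or_ne (ellNorm p fun i => a i * ENNReal.ofReal (w i)) ∞ with hinf | hfin
  · rw [hinf, ENNReal.mul_top (by simp)]
    exact le_top
  have ha := ne_top_of_ellNorm_mul_ne_top hp hw.1 hfin
  have hc : ∀ i, ‖(((a i).toReal : ℝ) : ℂ)‖ₑ = a i := fun i => by
    rw [← ofReal_norm, Complex.norm_of_nonneg ENNReal.toReal_nonneg,
      ENNReal.ofReal_toReal (ha i)]
  have hcn : wNorm p w (fun i => (((a i).toReal : ℝ) : ℂ)) =
      ellNorm p fun i => a i * ENNReal.ofReal (w i) := by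
    simp only [wNorm, hc]
  obtain ⟨hsum, hle⟩ := hC (fun i => (((a i).toReal : ℝ) : ℂ)) (by rw [hcn]; exact hfin.lt_top)
  have hval : ∀ i, ‖∑' j, entry S i j * (((a j).toReal : ℝ) : ℂ)‖ₑ = ∑' l, ‖M i l‖ₑ * a l :=
    fun i => by
      have e : ∀ j, entry S i j * (((a j).toReal : ℝ) : ℂ) =
          ((‖M i j‖ * (a j).toReal : ℝ) : ℂ) := fun j => by
        rw [hSe]
        push_cast
        rfl
      have hs := hsum i
      simp_rw [e] at hs ⊢
      rw [Complex.summable_ofReal] at hs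
      rw [← Complex.ofReal_tsum, ← ofReal_norm,
        Complex.norm_of_nonneg (tsum_nonneg fun j => by positivity),
        ENNReal.ofReal_tsum_of_nonneg (fun j => by positivity) hs]
      refine tsum_congr fun j => ?_
      rw [ENNReal.ofReal_mul (norm_nonneg _), ENNReal.ofReal_toReal (ha j), ofReal_norm]
  rw [hcn] at hle
  simp only [wNorm, hval] at hle
  refine hle.trans ?_
  gcongr
  simp

variable {H : Type*} [NormedAddCommGroup H] [InnerProductSpace ℂ H] [CompleteSpace H]

/-- The consequences of localisation used below: `w` is positive, and the Gram matrix of `ψ`, that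
of its dual, and their cross Gram matrix act on the spaces `ℓ^p_w`. -/
structure LocalisedFor (ψ : I → H) (w : I → ℝ) : Prop where
  isFrame : IsFrame ψ
  pos : ∀ i, 0 < w i
  gram : ActsOn (fun i l => inner ℂ (ψ i) (ψ l)) w
  dualGram : ActsOn (fun i l => inner ℂ (dual ψ i) (dual ψ l)) w
  cross : ActsOn (fun i l => inner ℂ (dual ψ i) (ψ l)) w

theorem IsLocalised.localisedFor {A : SpectralMatrixAlgebra I} {ψ : I → H} (h : IsLocalised A ψ)
    {w : I → ℝ} (hw : IsAdmissible A w) : LocalisedFor ψ w where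
  isFrame := h.1
  pos := hw.1
  gram := hw.actsOn h.2
  dualGram := hw.actsOn h.hasMatrix_dual
  cross := hw.actsOn h.hasMatrix_cross

theorem IsFrame.enorm_cross_symm {ψ : I → H} (hψ : IsFrame ψ) (i l : I) :
    ‖(inner ℂ (dual ψ i) (ψ l) : ℂ)‖ₑ = ‖(inner ℂ (dual ψ l) (ψ i) : ℂ)‖ₑ := by
  rw [hψ.inner_dual_symm i l, enorm_inner_symm]

theorem LocalisedFor.inv {ψ : I → H} {w : I → ℝ} (h : LocalisedFor ψ w) :
    LocalisedFor ψ w⁻¹ where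
  isFrame := h.isFrame
  pos := inv_weight_pos h.pos
  gram := h.gram.inv h.pos fun _ _ => enorm_inner_symm _ _
  dualGram := h.dualGram.inv h.pos fun _ _ => enorm_inner_symm _ _
  cross := h.cross.inv h.pos h.isFrame.enorm_cross_symm

end Admissible

/-! ### The coefficients of the elements of a co-orbit space -/

section Matrices

variable {I : Type*}

theorem ActsOn.summable {M : I → I → ℂ} {w : I → ℝ} (hM : ActsOn M w) (hw : ∀ i, 0 < w i)
    {p : ℝ≥0∞} (hp : 1 ≤ p) {c : I → ℂ} (hc : wNorm p w c ≠ ∞) (i : I) :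
    Summable fun l => M i l * c l := by
  refine Summable.of_enorm ?_
  simp_rw [enorm_mul]
  exact hM.tsum_ne_top hw hp hc i

theorem ActsOn.exists_wNorm_le {M : I → I → ℂ} {w : I → ℝ} (hM : ActsOn M w) {p : ℝ≥0∞}
    (hp : 1 ≤ p) : ∃ C : ℝ≥0, ∀ c : I → ℂ,
      wNorm p w (fun i => ∑' l, M i l * c l) ≤ C * wNorm p w c := by
  obtain ⟨C, hC⟩ := hM p hp
  refine ⟨C, fun c => le_trans (ellNorm_mono p fun i => ?_) (hC fun l => ‖c l‖ₑ)⟩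
  gcongr
  refine enorm_tsum_le_tsum_enorm.trans_eq ?_
  simp_rw [enorm_mul]

theorem ActsOn.transpose {M : I → I → ℂ} {w : I → ℝ} (hM : ActsOn M w)
    (hsymm : ∀ i l, ‖M i l‖ₑ = ‖M l i‖ₑ) : ActsOn (fun i l => M l i) w := by
  intro p hp
  obtain ⟨C, hC⟩ := hM p hp
  refine ⟨C, fun a => ?_⟩
  simp_rw [← hsymm]
  exact hC a

/-- Dominated convergence: the action of a matrix passes to pointwise limits of families that are
bounded in `ℓ^∞_w`. -/
theorem ActsOn.hasSum_of_tendsto {M : I → I → ℂ} {w : I → ℝ} (hM : ActsOn M w)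
    (hw : ∀ i, 0 < w i) {B : ℝ≥0∞} (hB : B ≠ ∞) {c : ℕ → I → ℂ} {c' : I → ℂ} {i : I}
    {d : ℕ → ℂ} {d' : ℂ} (hc : ∀ l, Tendsto (fun n => c n l) atTop (𝓝 (c' l)))
    (hd : Tendsto d atTop (𝓝 d')) (h : ∀ n, HasSum (fun l => M i l * c n l) (d n))
    (hbd : ∀ᶠ n in atTop, ∀ l, ‖c n l‖ₑ * ENNReal.ofReal (w l) ≤ B) :
    HasSum (fun l => M i l * c' l) d' := by
  have hbd' : ∀ᶠ n in atTop, ∀ l, ‖c n l‖ₑ ≤ B * ENNReal.ofReal (w⁻¹ l) :=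
    hbd.mono fun n hn l => by
      calc ‖c n l‖ₑ = ‖c n l‖ₑ * ENNReal.ofReal (w l) * ENNReal.ofReal (w⁻¹ l) := by
            rw [mul_assoc, weight_mul_inv_weight hw, mul_one]
        _ ≤ _ := by gcongr; exact hn l
  have hfin : ∑' l, ‖M i l‖ₑ * (B * ENNReal.ofReal (w⁻¹ l)) ≠ ∞ := by
    refine hM.tsum_ne_top hw le_top ?_ i
    rw [ellNorm_top]
    refine ((iSup_le fun l => ?_).trans_lt hB.lt_top).ne
    rw [mul_assoc, mul_comm (ENNReal.ofReal (w⁻¹ l)), weight_mul_inv_weight hw, mul_one]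
  set b : I → ℝ := fun l => (‖M i l‖ₑ * (B * ENNReal.ofReal (w⁻¹ l))).toReal with hb
  have hbs : Summable b := ENNReal.summable_toReal hfin
  have hterm : ∀ l, ‖M i l‖ₑ * (B * ENNReal.ofReal (w⁻¹ l)) ≠ ∞ := fun l =>
    ENNReal.ne_top_of_tsum_ne_top hfin l
  have hle : ∀ᶠ n in atTop, ∀ l, ‖M i l * c n l‖ ≤ b l := hbd'.mono fun n hn l => by
    rw [← toReal_enorm, enorm_mul]
    exact ENNReal.toReal_mono (hterm l) (by gcongr; exact hn l)
  have hlim : ∀ l, Tendsto (fun n => M i l * c n l) atTop (𝓝 (M i l * c' l)) := fun l =>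
    (hc l).const_mul _
  have ht := tendsto_tsum_of_dominated_convergence hbs hlim hle
  simp_rw [(h _).tsum_eq] at ht
  have hs : Summable fun l => M i l * c' l := by
    refine Summable.of_norm_bounded hbs fun l => ?_
    exact le_of_tendsto (hlim l).norm (hle.mono fun n hn => hn l)
  rw [tendsto_nhds_unique hd ht]
  exact hs.hasSum

theorem exists_seq_finset_tendsto (I : Type*) [Countable I] :
    ∃ E : ℕ → Finset I, Tendsto E atTop atTop :=
  exists_seq_tendsto _

theorem tendsto_coeff {X ι : Type*} [AddCommGroup X] [Module ℂ X] {L : ι → X →ₗ[ℂ] ℂ}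
    (F : ConvSeq L) (i : ι) :
    Tendsto (fun n => L i (F.1 n)) atTop (𝓝 (coeff L ((NullSeq L).mkQ F) i)) := by
  obtain ⟨l, hl⟩ := F.2 i
  have h : coeff L ((NullSeq L).mkQ F) i = limUnder atTop fun n => L i (F.1 n) := rfl
  rw [h, hl.limUnder_eq]
  exact hl

theorem coeff_constElt {X ι : Type*} [AddCommGroup X] [Module ℂ X] (L : ι → X →ₗ[ℂ] ℂ) (x : X)
    (i : ι) : coeff L (constElt L x) i = L i x :=
  tendsto_nhds_unique (tendsto_coeff ⟨fun _ => x, fun i => ⟨L i x, tendsto_const_nhds⟩⟩ i)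
    tendsto_const_nhds

end Matrices

section Coefficients

variable {I H : Type*} [NormedAddCommGroup H] [InnerProductSpace ℂ H]

/-- The family `c` is invariant under the cross Gram matrix `(⟨ψ l, ψ̃ i⟩)`. This characterises
the coefficients `C_Ψ̃ f` among the families in a weighted `ℓ^p`-space. -/
def Reproducing (ψ : I → H) (c : I → ℂ) : Prop :=
  ∀ i, HasSum (fun l => inner ℂ (dual ψ i) (ψ l) * c l) (c i)

theorem dualCoeff_apply (ψ : I → H) (i : I) (f : H) :
    dualCoeff ψ i f = inner ℂ (dual ψ i) f := rfl

theorem coeff_sum_smul (ψ : I → H) (s : Finset I) (c : I → ℂ) (i : I) :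
    dualCoeff ψ i (∑ l ∈ s, c l • ψ l) = ∑ l ∈ s, inner ℂ (dual ψ i) (ψ l) * c l := by
  rw [map_sum]
  refine Finset.sum_congr rfl fun l _ => ?_
  rw [map_smul, smul_eq_mul, mul_comm, dualCoeff_apply]

theorem enorm_mul_le_wNorm {p : ℝ≥0∞} (hp : 1 ≤ p) (w : I → ℝ) (c : I → ℂ) (i : I) :
    ‖c i‖ₑ * ENNReal.ofReal (w i) ≤ wNorm p w c :=
  le_ellNorm hp (fun i => ‖c i‖ₑ * ENNReal.ofReal (w i)) i

variable {ψ : I → H} {w : I → ℝ}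

theorem wNorm_ne_top_of_mem_H00 (h : LocalisedFor ψ w) {p : ℝ≥0∞} [hp : Fact (1 ≤ p)] {f : H}
    (hf : f ∈ H00 ψ) : wNorm p w (fun i => dualCoeff ψ i f) ≠ ∞ := by
  classical
  induction hf using Submodule.span_induction with
  | mem x hx =>
    obtain ⟨l, rfl⟩ := hx
    obtain ⟨C, hC⟩ := h.cross p hp.out
    have h1 := hC (Pi.single l 1)
    have e : ∀ i, ∑' k, ‖(inner ℂ (dual ψ i) (ψ k) : ℂ)‖ₑ * (Pi.single l 1 : I → ℝ≥0∞) k =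
        ‖dualCoeff ψ i (ψ l)‖ₑ := fun i => by
      rw [tsum_eq_single l fun k hk => by simp [hk]]
      simp [dualCoeff_apply]
    have e2 : (fun i => (Pi.single l 1 : I → ℝ≥0∞) i * ENNReal.ofReal (w i)) =
        Pi.single l (ENNReal.ofReal (w l)) := by
      funext i
      rcases eq_or_ne i l with rfl | hi
      · simp
      · simp [hi]
    simp_rw [e] at h1
    rw [e2, ellNorm_single hp.out] at h1
    exact (h1.trans_lt (ENNReal.mul_lt_top ENNReal.coe_lt_top ENNReal.ofReal_lt_top)).ne
  | zero => simp [wNorm_zero]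
  | add x y _ _ hx hy =>
    simp_rw [map_add]
    exact ((wNorm_add_le p w _ _).trans_lt (ENNReal.add_lt_top.2 ⟨hx.lt_top, hy.lt_top⟩)).ne
  | smul a x _ hx =>
    simp_rw [map_smul, smul_eq_mul]
    rw [wNorm_smul]
    exact ENNReal.mul_ne_top enorm_ne_top hx

/-- Every reproducing family of finite norm consists of the coefficients of an element of the
co-orbit space, namely the class of the partial sums of `∑ c l • ψ l`. -/
theorem exists_mem_Co [Countable I] (h : LocalisedFor ψ w) {p : ℝ≥0∞} [hp : Fact (1 ≤ p)]
    {c : I → ℂ} (hc : wNorm p w c ≠ ∞) (hrep : Reproducing ψ c) :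
    ∃ f ∈ Co ψ p w, coeff (dualCoeff ψ) f = c := by
  classical
  obtain ⟨E, hE⟩ := exists_seq_finset_tendsto I
  have hlim : ∀ i, Tendsto (fun n => dualCoeff ψ i (∑ l ∈ E n, c l • ψ l)) atTop (𝓝 (c i)) :=
    fun i => by
      simp_rw [coeff_sum_smul]
      exact (hrep i).comp hE
  set F : ConvSeq (dualCoeff ψ) := ⟨fun n => ∑ l ∈ E n, c l • ψ l, fun i => ⟨c i, hlim i⟩⟩ with hF
  refine ⟨(NullSeq (dualCoeff ψ)).mkQ F, ⟨F, rfl, ?_⟩, ?_⟩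
  · obtain ⟨C, hC⟩ := h.cross p hp.out
    have hbound : ∀ (s t : Finset I), wNorm p w (fun i =>
        dualCoeff ψ i (∑ l ∈ s, c l • ψ l - ∑ l ∈ t, c l • ψ l)) ≤
        C * ellNorm p fun l => if (l ∈ s ↔ l ∈ t) then 0 else ‖c l‖ₑ * ENNReal.ofReal (w l) := by
      intro s t
      have e : ∀ l, (if (l ∈ s ↔ l ∈ t) then 0 else ‖c l‖ₑ * ENNReal.ofReal (w l)) =
          (if (l ∈ s ↔ l ∈ t) then 0 else ‖c l‖ₑ) * ENNReal.ofReal (w l) := fun l => by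
        split_ifs <;> simp
      simp_rw [e]
      refine le_trans (ellNorm_mono p fun i => ?_) (hC _)
      gcongr
      have e2 : dualCoeff ψ i (∑ l ∈ s, c l • ψ l - ∑ l ∈ t, c l • ψ l) =
          ∑ l ∈ s ∪ t, inner ℂ (dual ψ i) (ψ l) *
            ((if l ∈ s then c l else 0) - if l ∈ t then c l else 0) := by
        rw [map_sub, coeff_sum_smul, coeff_sum_smul]
        simp_rw [mul_sub, Finset.sum_sub_distrib, mul_ite, mul_zero, Finset.sum_ite_mem]
        rw [Finset.inter_eq_right.2 Finset.subset_union_left,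
          Finset.inter_eq_right.2 Finset.subset_union_right]
      beta_reduce
      rw [e2]
      refine (enorm_sum_le _ _).trans (le_trans ?_ (ENNReal.sum_le_tsum (s ∪ t)))
      refine Finset.sum_le_sum fun l _ => ?_
      rw [enorm_mul]
      gcongr
      by_cases h1 : l ∈ s <;> by_cases h2 : l ∈ t <;> simp [h1, h2]
    rcases eq_or_ne p ∞ with rfl | hp'
    · refine Or.inr ⟨rfl, C * (wNorm ∞ w c).toNNReal, fun n => ?_⟩
      have := hbound (E n) ∅
      simp only [Finset.sum_empty, sub_zero] at this
      refine this.trans ?_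
      rw [ENNReal.coe_mul, ENNReal.coe_toNNReal hc]
      gcongr
      refine ellNorm_mono ∞ fun l => ?_
      split_ifs
      · exact zero_le
      · exact le_rfl
    · refine Or.inl ⟨hp'.lt_top, fun n => Submodule.sum_mem _ fun l _ =>
        Submodule.smul_mem _ _ (Submodule.subset_span ⟨l, rfl⟩), fun ε hε => ?_⟩
      have ht := (tendsto_ellNorm_tail hp.out hp' hc).comp hE
      have ht2 := ENNReal.Tendsto.const_mul (a := (2 * C : ℝ≥0∞)) ht
        (.inr (ENNReal.mul_ne_top (by simp) ENNReal.coe_ne_top))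
      rw [mul_zero] at ht2
      obtain ⟨N, hN⟩ := eventually_atTop.1 (ht2.eventually_lt_const hε)
      -- the symmetric difference of `E m` and `E n` is covered by their complements
      refine ⟨N, fun m hm n hn => (hbound (E m) (E n)).trans_lt ?_⟩
      have h1 := hN m hm
      have h2 := hN n hn
      have h3 : (C : ℝ≥0∞) * ellNorm p (fun l => if (l ∈ E m ↔ l ∈ E n) then 0 else
          ‖c l‖ₑ * ENNReal.ofReal (w l)) ≤
          C * ellNorm p (fun l => if l ∈ E m then 0 else ‖c l‖ₑ * ENNReal.ofReal (w l)) +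
          C * ellNorm p (fun l => if l ∈ E n then 0 else ‖c l‖ₑ * ENNReal.ofReal (w l)) := by
        rw [← mul_add]
        gcongr
        refine (ellNorm_mono p fun l => ?_).trans (ellNorm_add_le p _ _)
        by_cases h1 : l ∈ E m <;> by_cases h2 : l ∈ E n <;> simp [h1, h2]
      refine h3.trans_lt ?_
      simp only [Function.comp_apply, mul_assoc] at h1 h2
      rw [← ENNReal.add_halves ε]
      refine ENNReal.add_lt_add ?_ ?_
      · rw [ENNReal.lt_div_iff_mul_lt (by simp) (by simp), mul_comm]
        exact h1
      · rw [ENNReal.lt_div_iff_mul_lt (by simp) (by simp), mul_comm]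
        exact h2
  · funext i
    exact tendsto_nhds_unique (tendsto_coeff F i) (hlim i)

variable [CompleteSpace H]

theorem IsFrame.reproducing (hψ : IsFrame ψ) (f : H) :
    Reproducing ψ fun i => dualCoeff ψ i f :=
  fun i => hψ.hasSum_inner_mul_inner_dual f (dual ψ i)

/-- The coefficients of an element of the co-orbit space have finite norm and are
reproducing. -/
theorem Co.coeff_spec (h : LocalisedFor ψ w) {p : ℝ≥0∞} [hp : Fact (1 ≤ p)] {f : GenVec ψ}
    (hf : f ∈ Co ψ p w) : coNorm ψ p w f ≠ ∞ ∧ Reproducing ψ (coeff (dualCoeff ψ) f) := by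
  obtain ⟨F, rfl, hF⟩ := hf
  -- in both cases, the coefficients are eventually bounded in `ℓ^p_w`
  obtain ⟨B, hB, hbd⟩ : ∃ B : ℝ≥0∞, B ≠ ∞ ∧
      ∀ᶠ n in atTop, wNorm p w (fun i => dualCoeff ψ i (F.1 n)) ≤ B := by
    rcases hF with ⟨-, hF0, hF⟩ | ⟨rfl, M, hM⟩
    · obtain ⟨N, hN⟩ := hF 1 one_pos
      refine ⟨1 + wNorm p w (fun i => dualCoeff ψ i (F.1 N)),
        ENNReal.add_ne_top.2 ⟨ENNReal.one_ne_top, wNorm_ne_top_of_mem_H00 h (hF0 N)⟩,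
        eventually_atTop.2 ⟨N, fun n hn => ?_⟩⟩
      have e : (fun i => dualCoeff ψ i (F.1 n)) =
          fun i => dualCoeff ψ i (F.1 n - F.1 N) + dualCoeff ψ i (F.1 N) := by
        funext i
        rw [← map_add, sub_add_cancel]
      rw [e]
      refine (wNorm_add_le p w _ _).trans ?_
      gcongr
      exact (hN n hn N le_rfl).le
    · exact ⟨M, ENNReal.coe_ne_top, .of_forall hM⟩
  constructor
  · refine ((ellNorm_le_of_tendsto hp.out (fun i => ?_) hbd).trans_lt hB.lt_top).ne
    exact ENNReal.Tendsto.mul_const (tendsto_coeff F i).enorm (.inr ENNReal.ofReal_ne_top)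
  · intro i
    exact h.cross.hasSum_of_tendsto h.pos hB (fun l => tendsto_coeff F l) (tendsto_coeff F i)
      (fun n => h.isFrame.reproducing (F.1 n) i)
      (hbd.mono fun n hn l => (enorm_mul_le_wNorm hp.out w _ l).trans hn)

end Coefficients

/-! ### The analysis operator and the duality on co-orbit spaces -/

section Fubini

variable {I J : Type*}

/-- Interchange of summation in an absolutely convergent double series. -/
theorem hasSum_interchange {F : I × J → ℂ} (hF : Summable F) {a : I → ℂ} {b : J → ℂ} {s : ℂ}
    (ha : ∀ i, HasSum (fun j => F (i, j)) (a i)) (hb : ∀ j, HasSum (fun i => F (i, j)) (b j))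
    (hs : HasSum b s) : HasSum a s := by
  have h1 := hF.hasSum.prod_fiberwise ha
  have h2 := hF.prod_symm.hasSum.prod_fiberwise hb
  have h3 : ∑' x : J × I, F x.swap = ∑' x, F x := (Equiv.prodComm J I).tsum_eq F
  rw [h3] at h2
  rwa [hs.unique h2]

/-- Hölder's inequality for a pair of mutually inverse weights. -/
theorem tsum_mul_le_weighted {p q : ℝ≥0∞} (hpq : p.HolderConjugate q) {w : I → ℝ}
    (hw : ∀ i, 0 < w i) (a b : I → ℝ≥0∞) :
    ∑' i, a i * b i ≤ ellNorm p (fun i => a i * ENNReal.ofReal (w i)) *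
      ellNorm q fun i => b i * ENNReal.ofReal (w⁻¹ i) := by
  refine le_trans (le_of_eq (tsum_congr fun i => ?_)) (tsum_mul_le_ellNorm hpq _ _)
  calc a i * b i = a i * b i * (ENNReal.ofReal (w i) * ENNReal.ofReal (w⁻¹ i)) := by
        rw [weight_mul_inv_weight hw, mul_one]
    _ = _ := by ring

end Fubini

section Duality

variable {I H : Type*} [NormedAddCommGroup H] [InnerProductSpace ℂ H]

theorem exists_wNorm_analysis_le {ψ : I → H} {w : I → ℝ} (h : LocalisedFor ψ w) (p : ℝ≥0∞)
    [hp : Fact (1 ≤ p)] : ∃ C : ℝ≥0, ∀ f : GenVec ψ,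
      wNorm p w (analysis ψ f) ≤ C * coNorm ψ p w f := by
  obtain ⟨C, hC⟩ := h.gram.exists_wNorm_le hp.out
  refine ⟨C, fun f => ?_⟩
  have := hC (coeff (dualCoeff ψ) f)
  simp_rw [mul_comm (inner ℂ _ _)] at this
  exact this

theorem exists_wNorm_dualGram_le {ψ : I → H} {w : I → ℝ} (h : LocalisedFor ψ w) (p : ℝ≥0∞)
    [hp : Fact (1 ≤ p)] :
    ∃ C : ℝ≥0, ∀ j, wNorm p w (fun i => dualCoeff ψ i (dual ψ j)) ≤
      C * ENNReal.ofReal (w j) := by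
  classical
  obtain ⟨C, hC⟩ := h.dualGram.exists_wNorm_le hp.out
  refine ⟨C, fun j => ?_⟩
  have h1 := hC (Pi.single j 1)
  have e : ∀ i, ∑' l, (inner ℂ (dual ψ i) (dual ψ l) : ℂ) * (Pi.single j 1 : I → ℂ) l =
      dualCoeff ψ i (dual ψ j) := fun i => by
    rw [tsum_eq_single j fun k hk => by simp [hk]]
    simp [dualCoeff_apply]
  have e2 : wNorm p w (Pi.single j 1 : I → ℂ) = ENNReal.ofReal (w j) := by
    rw [wNorm, ← ellNorm_single hp.out j (ENNReal.ofReal (w j))]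
    congr 1
    funext i
    rcases eq_or_ne i j with rfl | hi
    · simp
    · simp [hi]
  simp_rw [e] at h1
  rwa [e2] at h1

variable [CompleteSpace H] {ψ : I → H} {w : I → ℝ}

theorem hasSum_analysis (h : LocalisedFor ψ w) {p : ℝ≥0∞} [hp : Fact (1 ≤ p)] {f : GenVec ψ}
    (hf : f ∈ Co ψ p w) (i : I) :
    HasSum (fun l => inner ℂ (ψ i) (ψ l) * coeff (dualCoeff ψ) f l) (analysis ψ f i) := by
  have := (h.gram.summable h.pos hp.out (Co.coeff_spec h hf).1 i).hasSum
  have e : analysis ψ f i = ∑' l, inner ℂ (ψ i) (ψ l) * coeff (dualCoeff ψ) f l :=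
    tsum_congr fun l => mul_comm _ _
  rwa [e]

/-- The coefficients `C_Ψ̃ f` are recovered from the coefficients `C_Ψ f`. -/
theorem hasSum_dualGram_analysis (h : LocalisedFor ψ w) {p : ℝ≥0∞} [hp : Fact (1 ≤ p)]
    {f : GenVec ψ} (hf : f ∈ Co ψ p w) (j : I) :
    HasSum (fun i => inner ℂ (dual ψ j) (dual ψ i) * analysis ψ f i)
      (coeff (dualCoeff ψ) f j) := by
  obtain ⟨hc, hrep⟩ := Co.coeff_spec h hf
  set c := coeff (dualCoeff ψ) f
  have hF : Summable fun x : I × I =>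
      (inner ℂ (dual ψ j) (dual ψ x.1) : ℂ) * (inner ℂ (ψ x.1) (ψ x.2) * c x.2) := by
    refine summable_prod_of_tsum_enorm ?_
    simp_rw [enorm_mul, ENNReal.tsum_mul_left]
    obtain ⟨C, hC⟩ := h.gram p hp.out
    have := (hC fun l => ‖c l‖ₑ).trans_lt (ENNReal.mul_lt_top ENNReal.coe_lt_top hc.lt_top)
    exact h.dualGram.tsum_ne_top h.pos hp.out this.ne j
  have h1 : ∀ i, HasSum (fun l => (inner ℂ (dual ψ j) (dual ψ i) : ℂ) *
      ((inner ℂ (ψ i) (ψ l) : ℂ) * c l)) (inner ℂ (dual ψ j) (dual ψ i) * analysis ψ f i) :=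
    fun i => (hasSum_analysis h hf i).mul_left _
  have h2 : ∀ l, HasSum (fun i => (inner ℂ (dual ψ j) (dual ψ i) : ℂ) *
      ((inner ℂ (ψ i) (ψ l) : ℂ) * c l)) (inner ℂ (dual ψ j) (ψ l) * c l) := fun l => by
    have := (h.isFrame.hasSum_inner_dual_mul_inner (ψ l) (dual ψ j)).mul_right (c l)
    simp_rw [mul_assoc] at this
    exact this
  exact hasSum_interchange hF h1 h2 (hrep j)

/-- The dual frame elements belong to all co-orbit spaces. -/
theorem constElt_dual_mem_Co [Countable I] (h : LocalisedFor ψ w) (p : ℝ≥0∞)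
    [hp : Fact (1 ≤ p)] (j : I) : constElt (dualCoeff ψ) (dual ψ j) ∈ Co ψ p w := by
  obtain ⟨C, hC⟩ := exists_wNorm_dualGram_le h p
  obtain ⟨f, hf, hfc⟩ := exists_mem_Co (p := p) h
    ((hC j).trans_lt (ENNReal.mul_lt_top ENNReal.coe_lt_top ENNReal.ofReal_lt_top)).ne
    (h.isFrame.reproducing (dual ψ j))
  have : constElt (dualCoeff ψ) (dual ψ j) = f := by
    refine coeff_injective _ ?_
    rw [hfc]
    funext i
    exact coeff_constElt _ _ _
  rwa [this]

theorem analysis_constElt_dual (hψ : IsFrame ψ) (i j : I) :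
    analysis ψ (constElt (dualCoeff ψ) (dual ψ j)) i = inner ℂ (ψ i) (dual ψ j) := by
  rw [analysis, ← (hψ.hasSum_inner_mul_inner_dual (dual ψ j) (ψ i)).tsum_eq]
  refine tsum_congr fun l => ?_
  rw [coeff_constElt, mul_comm, dualCoeff_apply]

theorem conj_analysis_constElt_dual (hψ : IsFrame ψ) (i j : I) :
    conj (analysis ψ (constElt (dualCoeff ψ) (dual ψ j)) i) = inner ℂ (dual ψ j) (ψ i) := by
  rw [analysis_constElt_dual hψ, inner_conj_symm]

/-- The pairing with a dual frame element is the evaluation of a coefficient. -/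
theorem pairing_constElt_dual (hψ : IsFrame ψ) {f : GenVec ψ}
    (hf : Reproducing ψ (coeff (dualCoeff ψ) f)) (j : I) :
    pairing ψ f (constElt (dualCoeff ψ) (dual ψ j)) = coeff (dualCoeff ψ) f j := by
  rw [pairing, ← (hf j).tsum_eq]
  refine tsum_congr fun i => ?_
  rw [conj_analysis_constElt_dual hψ, mul_comm]

/-- As the Gram matrix is Hermitian, the two analysis operators may be exchanged in the
pairing. -/
theorem hasSum_pairing (h : LocalisedFor ψ w) {p q : ℝ≥0∞} [hp : Fact (1 ≤ p)]
    [hq : Fact (1 ≤ q)] (hpq : p.HolderConjugate q) {f g : GenVec ψ} (hf : f ∈ Co ψ p w)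
    (hg : g ∈ Co ψ q w⁻¹) :
    HasSum (fun i => analysis ψ f i * conj (coeff (dualCoeff ψ) g i)) (pairing ψ f g) := by
  have hcf := (Co.coeff_spec h hf).1
  have hcg := (Co.coeff_spec h.inv hg).1
  set c := coeff (dualCoeff ψ) f with hc
  set d := coeff (dualCoeff ψ) g with hd
  have hF : Summable fun x : I × I =>
      c x.1 * conj ((inner ℂ (ψ x.1) (ψ x.2) : ℂ) * d x.2) := by
    refine summable_prod_of_tsum_enorm ?_
    simp_rw [enorm_mul, RCLike.enorm_conj, enorm_mul, ENNReal.tsum_mul_left]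
    refine ((tsum_mul_le_weighted hpq h.pos _ _).trans_lt (ENNReal.mul_lt_top hcf.lt_top ?_)).ne
    obtain ⟨C, hC⟩ := h.inv.gram q hq.out
    exact (hC fun l => ‖d l‖ₑ).trans_lt (ENNReal.mul_lt_top ENNReal.coe_lt_top hcg.lt_top)
  have h1 : ∀ i, HasSum (fun l => c i * conj ((inner ℂ (ψ i) (ψ l) : ℂ) * d l))
      (c i * conj (analysis ψ g i)) := fun i =>
    ((Complex.hasSum_conj'.2 (hasSum_analysis h.inv hg i))).mul_left _
  have h2 : HasSum (fun i => c i * conj (analysis ψ g i)) (pairing ψ f g) :=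
    (hF.hasSum.prod_fiberwise h1).summable.hasSum
  refine hasSum_interchange hF.prod_symm (fun l => ?_) h1 h2
  refine ((hasSum_analysis h hf l).mul_right (conj (d l))).congr_fun fun i => ?_
  simp only [Prod.swap, map_mul, inner_conj_symm]
  ring

end Duality

/-! ### The co-orbit spaces of kernels -/

section MixedNorms

variable {I J : Type*}

theorem rowNorm_top_le_iff {p : ℝ≥0∞} {w : I → J → ℝ} {k : I → J → ℂ} {M : ℝ≥0∞} :
    rowNorm p ∞ w k ≤ M ↔ ∀ i, ellNorm p (fun j => ‖k i j‖ₑ * ENNReal.ofReal (w i j)) ≤ M := by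
  rw [rowNorm, ellNorm_top, iSup_le_iff]

theorem colNorm_top_le_iff {p : ℝ≥0∞} {w : I → J → ℝ} {k : I → J → ℂ} {M : ℝ≥0∞} :
    colNorm p ∞ w k ≤ M ↔ ∀ j, ellNorm p (fun i => ‖k i j‖ₑ * ENNReal.ofReal (w i j)) ≤ M := by
  rw [colNorm, ellNorm_top, iSup_le_iff]

theorem enorm_mul_le_rowNorm {p : ℝ≥0∞} (hp : 1 ≤ p) (w : I → J → ℝ) (k : I → J → ℂ) (i : I)
    (j : J) : ‖k i j‖ₑ * ENNReal.ofReal (w i j) ≤ rowNorm p ∞ w k :=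
  (le_ellNorm hp (fun j => ‖k i j‖ₑ * ENNReal.ofReal (w i j)) j).trans
    (rowNorm_top_le_iff.1 le_rfl i)

theorem enorm_mul_le_colNorm {p : ℝ≥0∞} (hp : 1 ≤ p) (w : I → J → ℝ) (k : I → J → ℂ) (i : I)
    (j : J) : ‖k i j‖ₑ * ENNReal.ofReal (w i j) ≤ colNorm p ∞ w k :=
  (le_ellNorm hp (fun i => ‖k i j‖ₑ * ENNReal.ofReal (w i j)) i).trans
    (colNorm_top_le_iff.1 le_rfl j)

/-- The rows of `A κ Bᵀ` are bounded in `ℓ^p` if those of `κ` are: `B` acts on each row, and the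
rows are combined by means of the action of `A` on a weighted `ℓ^∞`-space. -/
theorem exists_row_le {A : I → I → ℂ} {B : J → J → ℂ} {v₁ : I → ℝ} {v₂ : J → ℝ}
    (hA : ActsOn A v₁) (hB : ActsOn B v₂)
    (p : ℝ≥0∞) [hp : Fact (1 ≤ p)] :
    ∃ C : ℝ≥0, ∀ (κ : I → J → ℝ≥0∞) (M : ℝ≥0∞),
      (∀ i, ellNorm p (fun j => κ i j * (ENNReal.ofReal (v₁ i) * ENNReal.ofReal (v₂ j))) ≤ M) →
      ∀ i, ellNorm p (fun j => (∑' l, ‖A i l‖ₑ * ∑' m, ‖B j m‖ₑ * κ l m) *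
        (ENNReal.ofReal (v₁ i) * ENNReal.ofReal (v₂ j))) ≤ C * M := by
  obtain ⟨CA, hCA⟩ := hA ∞ le_top
  obtain ⟨CB, hCB⟩ := hB p hp.out
  refine ⟨CB * CA, fun κ M hM i => ?_⟩
  set N : I → ℝ≥0∞ := fun l => ellNorm p fun j => κ l j * ENNReal.ofReal (v₂ j) with hN
  have hNM : ∀ l, N l * ENNReal.ofReal (v₁ l) ≤ M := fun l => by
    rw [mul_comm, hN, ← ellNorm_const_mul]
    refine le_trans (le_of_eq ?_) (hM l)
    congr 1
    funext j
    ring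
  have hAN : (∑' l, ‖A i l‖ₑ * N l) * ENNReal.ofReal (v₁ i) ≤ CA * M := by
    refine (le_ellNorm le_top
      (fun i => (∑' l, ‖A i l‖ₑ * N l) * ENNReal.ofReal (v₁ i)) i).trans ((hCA N).trans ?_)
    gcongr
    rw [ellNorm_top]
    exact iSup_le hNM
  calc ellNorm p (fun j => (∑' l, ‖A i l‖ₑ * ∑' m, ‖B j m‖ₑ * κ l m) *
        (ENNReal.ofReal (v₁ i) * ENNReal.ofReal (v₂ j)))
      = ellNorm p (fun j => ∑' l, (‖A i l‖ₑ * ENNReal.ofReal (v₁ i)) *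
          ((∑' m, ‖B j m‖ₑ * κ l m) * ENNReal.ofReal (v₂ j))) := by
        congr 1
        funext j
        rw [← ENNReal.tsum_mul_right]
        refine tsum_congr fun l => ?_
        ring
    _ ≤ ∑' l, (‖A i l‖ₑ * ENNReal.ofReal (v₁ i)) *
          ellNorm p (fun j => (∑' m, ‖B j m‖ₑ * κ l m) * ENNReal.ofReal (v₂ j)) :=
        ellNorm_tsum_mul_le hp.out _ _
    _ ≤ ∑' l, (‖A i l‖ₑ * ENNReal.ofReal (v₁ i)) * (CB * N l) :=
        ENNReal.tsum_le_tsum fun l => by gcongr; exact hCB (κ l)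
    _ = CB * ((∑' l, ‖A i l‖ₑ * N l) * ENNReal.ofReal (v₁ i)) := by
        rw [← ENNReal.tsum_mul_right, ← ENNReal.tsum_mul_left]
        refine tsum_congr fun l => ?_
        ring
    _ ≤ CB * (CA * M) := by gcongr
    _ = ((CB * CA : ℝ≥0) : ℝ≥0∞) * M := by
        rw [ENNReal.coe_mul, mul_assoc]

end MixedNorms

section Kernels

theorem tensor_mem_HS {H₁ H₂ : Type*} [NormedAddCommGroup H₁]
    [InnerProductSpace ℂ H₁] [CompleteSpace H₁] [NormedAddCommGroup H₂] [InnerProductSpace ℂ H₂]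
    (f₁ : H₁) (f₂ : H₂) : tensor f₁ f₂ ∈ HS H₁ H₂ := by
  have h := ((onb H₁).orthonormal.inner_products_summable f₁).mul_right (‖f₂‖ ^ 2)
  refine h.congr fun e => ?_
  rw [tensor, InnerProductSpace.rankOne_apply, norm_smul, mul_pow, norm_inner_symm]

variable {I J H₁ H₂ : Type*}
  [NormedAddCommGroup H₁] [InnerProductSpace ℂ H₁] [CompleteSpace H₁]
  [NormedAddCommGroup H₂] [InnerProductSpace ℂ H₂] [CompleteSpace H₂]
  {ψ₁ : I → H₁} {ψ₂ : J → H₂} {w₁ : I → ℝ} {w₂ : J → ℝ}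

theorem kerCoeff_apply (ij : I × J) (F : HS H₁ H₂) :
    kerCoeff ψ₁ ψ₂ ij F = inner ℂ (dual ψ₂ ij.2) (F.1 (dual ψ₁ ij.1)) :=
  hsInner_tensor _ _ _

/-- The matrix `k` is invariant under the cross Gram matrices of `ψ₁` and `ψ₂` in its two indices.
This characterises the coefficients of the elements of the co-orbit spaces of `ψ₁ ⊗ ψ₂`. -/
structure KerReproducing (ψ₁ : I → H₁) (ψ₂ : J → H₂) (k : I → J → ℂ) : Prop where
  right : ∀ i, Reproducing ψ₂ (k i)
  left : ∀ i j, HasSum (fun l => inner ℂ (dual ψ₁ l) (ψ₁ i) * k l j) (k i j)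

theorem kerReproducing_kerCoeff (h₁ : IsFrame ψ₁) (h₂ : IsFrame ψ₂) (F : HS H₁ H₂) :
    KerReproducing ψ₁ ψ₂ fun i j => kerCoeff ψ₁ ψ₂ (i, j) F where
  right i := by
    simp only [kerCoeff_apply]
    exact h₂.reproducing (F.1 (dual ψ₁ i))
  left i j := by
    simp only [kerCoeff_apply]
    refine ((h₁.hasSum_inner (dual ψ₁ i)).mapL
      ((innerSL ℂ (dual ψ₂ j)).comp F.1)).congr_fun fun l => ?_
    rw [h₁.inner_dual_symm]
    simp

theorem tendsto_kerMatrix {F : ConvSeq (kerCoeff ψ₁ ψ₂)} {K : GenKer ψ₁ ψ₂}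
    (hK : (NullSeq (kerCoeff ψ₁ ψ₂)).mkQ F = K) (i : I) (j : J) :
    Tendsto (fun n => kerCoeff ψ₁ ψ₂ (i, j) (F.1 n)) atTop (𝓝 (kerMatrix ψ₁ ψ₂ K i j)) := by
  rw [← hK]
  exact tendsto_coeff F (i, j)

/-- The coefficients of a class of sequences of Hilbert–Schmidt operators are reproducing, if the
weighted entries of the sequence are uniformly bounded. -/
theorem kerReproducing_kerMatrix (h₁ : LocalisedFor ψ₁ w₁) (h₂ : LocalisedFor ψ₂ w₂)
    {F : ConvSeq (kerCoeff ψ₁ ψ₂)} {K : GenKer ψ₁ ψ₂}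
    (hK : (NullSeq (kerCoeff ψ₁ ψ₂)).mkQ F = K) {B : ℝ≥0∞} (hB : B ≠ ∞)
    (hF : ∀ n i j, ‖kerCoeff ψ₁ ψ₂ (i, j) (F.1 n)‖ₑ *
      ENNReal.ofReal (invTensorWeight w₁ w₂ i j) ≤ B) :
    KerReproducing ψ₁ ψ₂ (kerMatrix ψ₁ ψ₂ K) := by
  have ht : ∀ i j, Tendsto (fun n => kerCoeff ψ₁ ψ₂ (i, j) (F.1 n)) atTop
      (𝓝 (kerMatrix ψ₁ ψ₂ K i j)) := fun i j => tendsto_kerMatrix hK i j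
  simp_rw [ofReal_invTensorWeight h₁.pos] at hF
  have hB₁ : ∀ i, B * ENNReal.ofReal (w₁ i) ≠ ∞ := fun i =>
    ENNReal.mul_ne_top hB ENNReal.ofReal_ne_top
  have hB₂ : ∀ j, B * ENNReal.ofReal (w₂ j) ≠ ∞ := fun j =>
    ENNReal.mul_ne_top hB ENNReal.ofReal_ne_top
  constructor
  · intro i j
    refine h₂.inv.cross.hasSum_of_tendsto h₂.inv.pos (hB₁ i) (fun m => ht i m) (ht i j)
      (fun n => (kerReproducing_kerCoeff h₁.isFrame h₂.isFrame (F.1 n)).right i j)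
      (.of_forall fun n m => ?_)
    calc ‖kerCoeff ψ₁ ψ₂ (i, m) (F.1 n)‖ₑ * ENNReal.ofReal (w₂⁻¹ m)
        = ‖kerCoeff ψ₁ ψ₂ (i, m) (F.1 n)‖ₑ *
            (ENNReal.ofReal (w₁⁻¹ i) * ENNReal.ofReal (w₂⁻¹ m)) * ENNReal.ofReal (w₁ i) := by
          rw [mul_assoc, mul_right_comm, mul_comm (ENNReal.ofReal (w₁⁻¹ i)),
            weight_mul_inv_weight h₁.pos, one_mul]
      _ ≤ _ := by gcongr; exact hF n i m
  · intro i j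
    refine (h₁.inv.cross.transpose h₁.isFrame.enorm_cross_symm).hasSum_of_tendsto h₁.inv.pos
      (hB₂ j) (fun l => ht l j) (ht i j)
      (fun n => (kerReproducing_kerCoeff h₁.isFrame h₂.isFrame (F.1 n)).left i j)
      (.of_forall fun n l => ?_)
    calc ‖kerCoeff ψ₁ ψ₂ (l, j) (F.1 n)‖ₑ * ENNReal.ofReal (w₁⁻¹ l)
        = ‖kerCoeff ψ₁ ψ₂ (l, j) (F.1 n)‖ₑ *
            (ENNReal.ofReal (w₁⁻¹ l) * ENNReal.ofReal (w₂⁻¹ j)) * ENNReal.ofReal (w₂ j) := by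
          rw [mul_assoc, mul_assoc, mul_comm (ENNReal.ofReal (w₂⁻¹ j)),
            weight_mul_inv_weight h₂.pos, mul_one]
      _ ≤ _ := by gcongr; exact hF n l j

theorem kerCoeff_sum_tensor (s : Finset (I × J)) (k : I → J → ℂ) (ij : I × J) :
    kerCoeff ψ₁ ψ₂ ij (∑ x ∈ s, k x.1 x.2 •
      (⟨tensor (ψ₁ x.1) (ψ₂ x.2), tensor_mem_HS _ _⟩ : HS H₁ H₂)) =
      ∑ x ∈ s, (inner ℂ (ψ₁ x.1) (dual ψ₁ ij.1) : ℂ) *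
        (inner ℂ (dual ψ₂ ij.2) (ψ₂ x.2) * k x.1 x.2) := by
  rw [map_sum]
  refine Finset.sum_congr rfl fun x _ => ?_
  have e : tensor (ψ₁ x.1) (ψ₂ x.2) (dual ψ₁ ij.1) =
      (inner ℂ (ψ₁ x.1) (dual ψ₁ ij.1) : ℂ) • ψ₂ x.2 := InnerProductSpace.rankOne_apply _ _ _
  rw [map_smul, kerCoeff_apply, e, inner_smul_right, smul_eq_mul]
  ring

/-- A reproducing matrix is the coefficient matrix of the class of the partial sums of
`∑ k l m • (ψ₁ l ⊗ ψ₂ m)`, provided that the relevant double series converge absolutely. -/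
theorem exists_convSeq_kerMatrix [Countable I] [Countable J] (h₁ : IsFrame ψ₁)
    {k : I → J → ℂ} (hk : KerReproducing ψ₁ ψ₂ k)
    (hfin : ∀ i j, ∑' l, ‖(inner ℂ (dual ψ₁ l) (ψ₁ i) : ℂ)‖ₑ *
      ∑' m, ‖(inner ℂ (dual ψ₂ j) (ψ₂ m) : ℂ)‖ₑ * ‖k l m‖ₑ ≠ ∞) :
    ∃ (F : ConvSeq (kerCoeff ψ₁ ψ₂)) (K : GenKer ψ₁ ψ₂),
      (NullSeq (kerCoeff ψ₁ ψ₂)).mkQ F = K ∧ kerMatrix ψ₁ ψ₂ K = k ∧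
      ∀ n i j, ‖kerCoeff ψ₁ ψ₂ (i, j) (F.1 n)‖ₑ ≤
        ∑' l, ‖(inner ℂ (dual ψ₁ l) (ψ₁ i) : ℂ)‖ₑ *
          ∑' m, ‖(inner ℂ (dual ψ₂ j) (ψ₂ m) : ℂ)‖ₑ * ‖k l m‖ₑ := by
  obtain ⟨E, hE⟩ := exists_seq_finset_tendsto (I × J)
  set T : ℕ → HS H₁ H₂ := fun n => ∑ x ∈ E n, k x.1 x.2 •
    (⟨tensor (ψ₁ x.1) (ψ₂ x.2), tensor_mem_HS _ _⟩ : HS H₁ H₂) with hT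
  have hsumm : ∀ i j, Summable fun x : I × J => (inner ℂ (dual ψ₁ x.1) (ψ₁ i) : ℂ) *
      ((inner ℂ (dual ψ₂ j) (ψ₂ x.2) : ℂ) * k x.1 x.2) := fun i j => by
    refine summable_prod_of_tsum_enorm ?_
    simp_rw [enorm_mul, ENNReal.tsum_mul_left]
    exact hfin i j
  have hsum : ∀ i j, HasSum (fun x : I × J => (inner ℂ (dual ψ₁ x.1) (ψ₁ i) : ℂ) *
      ((inner ℂ (dual ψ₂ j) (ψ₂ x.2) : ℂ) * k x.1 x.2)) (k i j) := fun i j => by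
    have h1 := (hsumm i j).hasSum.prod_fiberwise
      fun l => (hk.right l j).mul_left (inner ℂ (dual ψ₁ l) (ψ₁ i) : ℂ)
    rw [(hk.left i j).unique h1]
    exact (hsumm i j).hasSum
  have hTe : ∀ n i j, kerCoeff ψ₁ ψ₂ (i, j) (T n) =
      ∑ x ∈ E n, (inner ℂ (dual ψ₁ x.1) (ψ₁ i) : ℂ) *
        ((inner ℂ (dual ψ₂ j) (ψ₂ x.2) : ℂ) * k x.1 x.2) := fun n i j => by
    rw [hT, kerCoeff_sum_tensor]
    refine Finset.sum_congr rfl fun x _ => ?_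
    rw [h₁.inner_dual_symm]
  have hlim : ∀ ij, Tendsto (fun n => kerCoeff ψ₁ ψ₂ ij (T n)) atTop (𝓝 (k ij.1 ij.2)) :=
    fun ij => by
      simp_rw [hTe _ ij.1 ij.2]
      exact (hsum ij.1 ij.2).comp hE
  refine ⟨⟨T, fun ij => ⟨_, hlim ij⟩⟩, _, rfl, ?_, fun n i j => ?_⟩
  · funext i j
    exact tendsto_nhds_unique (tendsto_kerMatrix rfl i j) (hlim (i, j))
  · change ‖kerCoeff ψ₁ ψ₂ (i, j) (T n)‖ₑ ≤ _
    rw [hTe]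
    refine (enorm_sum_le _ _).trans ((ENNReal.sum_le_tsum (E n)).trans_eq ?_)
    rw [ENNReal.tsum_prod (f := fun l m => ‖(inner ℂ (dual ψ₁ l) (ψ₁ i) : ℂ) *
      ((inner ℂ (dual ψ₂ j) (ψ₂ m) : ℂ) * k l m)‖ₑ)]
    simp_rw [enorm_mul, ENNReal.tsum_mul_left]

theorem kerMatrix_injective : Function.Injective (kerMatrix ψ₁ ψ₂) := by
  intro K K' h
  refine coeff_injective _ ?_
  funext ij
  exact congrFun (congrFun h ij.1) ij.2

/-- The space `𝔥^{p,∞}` consists of the classes with a reproducing matrix of finite norm. -/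
theorem kerRow_spec (h₁ : LocalisedFor ψ₁ w₁) (h₂ : LocalisedFor ψ₂ w₂) {p : ℝ≥0∞}
    [hp : Fact (1 ≤ p)] {K : GenKer ψ₁ ψ₂}
    (hK : K ∈ KerRow ψ₁ ψ₂ p (invTensorWeight w₁ w₂)) :
    kerRowNorm ψ₁ ψ₂ p (invTensorWeight w₁ w₂) K ≠ ∞ ∧
      KerReproducing ψ₁ ψ₂ (kerMatrix ψ₁ ψ₂ K) := by
  obtain ⟨F, hFK, hF⟩ := hK
  have hle := fun n => le_iSup (fun n => rowNorm p ∞ (invTensorWeight w₁ w₂)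
    fun i j => kerCoeff ψ₁ ψ₂ (i, j) (F.1 n)) n
  refine ⟨ne_top_of_le_ne_top hF.ne (rowNorm_top_le_iff.2 fun i => ?_),
    kerReproducing_kerMatrix h₁ h₂ hFK hF.ne fun n i j =>
      (enorm_mul_le_rowNorm hp.out _ _ i j).trans (hle n)⟩
  refine ellNorm_le_of_tendsto (l := (atTop : Filter ℕ)) hp.out (fun j => ?_)
    (.of_forall fun n => rowNorm_top_le_iff.1 (hle n) i)
  exact ENNReal.Tendsto.mul_const (tendsto_kerMatrix hFK i j).enorm (.inr ENNReal.ofReal_ne_top)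

theorem kerCol_spec (h₁ : LocalisedFor ψ₁ w₁) (h₂ : LocalisedFor ψ₂ w₂) {p : ℝ≥0∞}
    [hp : Fact (1 ≤ p)] {K : GenKer ψ₁ ψ₂}
    (hK : K ∈ KerCol ψ₁ ψ₂ p (invTensorWeight w₁ w₂)) :
    kerColNorm ψ₁ ψ₂ p (invTensorWeight w₁ w₂) K ≠ ∞ ∧
      KerReproducing ψ₁ ψ₂ (kerMatrix ψ₁ ψ₂ K) := by
  obtain ⟨F, hFK, hF⟩ := hK
  have hle := fun n => le_iSup (fun n => colNorm p ∞ (invTensorWeight w₁ w₂)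
    fun i j => kerCoeff ψ₁ ψ₂ (i, j) (F.1 n)) n
  refine ⟨ne_top_of_le_ne_top hF.ne (colNorm_top_le_iff.2 fun j => ?_),
    kerReproducing_kerMatrix h₁ h₂ hFK hF.ne fun n i j =>
      (enorm_mul_le_colNorm hp.out _ _ i j).trans (hle n)⟩
  refine ellNorm_le_of_tendsto (l := (atTop : Filter ℕ)) hp.out (fun i => ?_)
    (.of_forall fun n => colNorm_top_le_iff.1 (hle n) j)
  exact ENNReal.Tendsto.mul_const (tendsto_kerMatrix hFK i j).enorm (.inr ENNReal.ofReal_ne_top)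

theorem exists_mem_kerRow [Countable I] [Countable J] (h₁ : LocalisedFor ψ₁ w₁)
    (h₂ : LocalisedFor ψ₂ w₂) {p : ℝ≥0∞} [hp : Fact (1 ≤ p)] {k : I → J → ℂ}
    (hk : KerReproducing ψ₁ ψ₂ k) (hfin : rowNorm p ∞ (invTensorWeight w₁ w₂) k ≠ ∞) :
    ∃ K ∈ KerRow ψ₁ ψ₂ p (invTensorWeight w₁ w₂), kerMatrix ψ₁ ψ₂ K = k := by
  obtain ⟨C, hC⟩ := exists_row_le (h₁.inv.cross.transpose h₁.isFrame.enorm_cross_symm)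
    h₂.inv.cross p
  have hrow := hC (fun i j => ‖k i j‖ₑ) (rowNorm p ∞ (invTensorWeight w₁ w₂) k) fun i => by
    simp_rw [← ofReal_invTensorWeight h₁.pos]
    exact rowNorm_top_le_iff.1 le_rfl i
  have hlt : (C : ℝ≥0∞) * rowNorm p ∞ (invTensorWeight w₁ w₂) k < ∞ :=
    ENNReal.mul_lt_top ENNReal.coe_lt_top hfin.lt_top
  obtain ⟨F, K, hFK, hKk, hF⟩ := exists_convSeq_kerMatrix h₁.isFrame hk fun i j htop => by
    have h1 := (le_ellNorm hp.out _ j).trans (hrow i)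
    simp only [htop] at h1
    rw [ENNReal.top_mul (mul_ne_zero (ofReal_ne_zero_of_pos h₁.inv.pos i)
      (ofReal_ne_zero_of_pos h₂.inv.pos j)), top_le_iff] at h1
    exact hlt.ne h1
  refine ⟨K, ⟨F, hFK, lt_of_le_of_lt (iSup_le fun n => rowNorm_top_le_iff.2 fun i => ?_) hlt⟩,
    hKk⟩
  refine (ellNorm_mono p fun j => ?_).trans (hrow i)
  rw [ofReal_invTensorWeight h₁.pos]
  gcongr
  exact hF n i j

theorem exists_mem_kerCol [Countable I] [Countable J] (h₁ : LocalisedFor ψ₁ w₁)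
    (h₂ : LocalisedFor ψ₂ w₂) {p : ℝ≥0∞} [hp : Fact (1 ≤ p)] {k : I → J → ℂ}
    (hk : KerReproducing ψ₁ ψ₂ k) (hfin : colNorm p ∞ (invTensorWeight w₁ w₂) k ≠ ∞) :
    ∃ K ∈ KerCol ψ₁ ψ₂ p (invTensorWeight w₁ w₂), kerMatrix ψ₁ ψ₂ K = k := by
  obtain ⟨C, hC⟩ := exists_row_le h₂.inv.cross
    (h₁.inv.cross.transpose h₁.isFrame.enorm_cross_symm) p
  have hcol := hC (fun j i => ‖k i j‖ₑ) (colNorm p ∞ (invTensorWeight w₁ w₂) k) fun j => by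
    simp_rw [mul_comm (ENNReal.ofReal (w₂⁻¹ j)), ← ofReal_invTensorWeight h₁.pos]
    exact colNorm_top_le_iff.1 le_rfl j
  have hswap : ∀ i j, ∑' m, ‖(inner ℂ (dual ψ₂ j) (ψ₂ m) : ℂ)‖ₑ *
      ∑' l, ‖(inner ℂ (dual ψ₁ l) (ψ₁ i) : ℂ)‖ₑ * ‖k l m‖ₑ =
      ∑' l, ‖(inner ℂ (dual ψ₁ l) (ψ₁ i) : ℂ)‖ₑ *
        ∑' m, ‖(inner ℂ (dual ψ₂ j) (ψ₂ m) : ℂ)‖ₑ * ‖k l m‖ₑ := fun i j => by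
    simp_rw [← ENNReal.tsum_mul_left]
    rw [ENNReal.tsum_comm]
    refine tsum_congr fun l => tsum_congr fun m => ?_
    ring
  simp_rw [hswap] at hcol
  have hlt : (C : ℝ≥0∞) * colNorm p ∞ (invTensorWeight w₁ w₂) k < ∞ :=
    ENNReal.mul_lt_top ENNReal.coe_lt_top hfin.lt_top
  obtain ⟨F, K, hFK, hKk, hF⟩ := exists_convSeq_kerMatrix h₁.isFrame hk fun i j htop => by
    have h1 := (le_ellNorm hp.out _ i).trans (hcol j)
    simp only [htop] at h1
    rw [ENNReal.top_mul (mul_ne_zero (ofReal_ne_zero_of_pos h₂.inv.pos j)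
      (ofReal_ne_zero_of_pos h₁.inv.pos i)), top_le_iff] at h1
    exact hlt.ne h1
  refine ⟨K, ⟨F, hFK, lt_of_le_of_lt (iSup_le fun n => colNorm_top_le_iff.2 fun j => ?_) hlt⟩,
    hKk⟩
  refine (ellNorm_mono p fun i => ?_).trans (hcol j)
  rw [ofReal_invTensorWeight h₁.pos, mul_comm (ENNReal.ofReal (w₁⁻¹ i))]
  gcongr
  exact hF n i j

end Kernels

/-! ### Operators given by a matrix -/

section MatrixOperators

variable {I J : Type*}

/-- The matrix `(|k i j|)` maps `ℓ^r_{w₁}` to `ℓ^s_{1/w₂}` with norm at most `N`. -/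
def MatBdd (r s : ℝ≥0∞) (w₁ : I → ℝ) (w₂ : J → ℝ) (k : I → J → ℂ) (N : ℝ≥0∞) : Prop :=
  ∀ a : I → ℝ≥0∞, ellNorm s (fun j => (∑' i, a i * ‖k i j‖ₑ) * ENNReal.ofReal (w₂⁻¹ j)) ≤
    N * ellNorm r fun i => a i * ENNReal.ofReal (w₁ i)

theorem matBdd_rowNorm {w₁ : I → ℝ} {w₂ : J → ℝ} (hw₁ : ∀ i, 0 < w₁ i) {p : ℝ≥0∞}
    [hp : Fact (1 ≤ p)] (k : I → J → ℂ) :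
    MatBdd 1 p w₁ w₂ k (rowNorm p ∞ (invTensorWeight w₁ w₂) k) := by
  intro a
  have hrow : ∀ i, ENNReal.ofReal (w₁⁻¹ i) *
      ellNorm p (fun j => ‖k i j‖ₑ * ENNReal.ofReal (w₂⁻¹ j)) ≤
      rowNorm p ∞ (invTensorWeight w₁ w₂) k := fun i => by
    rw [← ellNorm_const_mul]
    refine le_trans (le_of_eq ?_) (rowNorm_top_le_iff.1 le_rfl i)
    congr 1
    funext j
    rw [ofReal_invTensorWeight hw₁]
    ring
  calc ellNorm p (fun j => (∑' i, a i * ‖k i j‖ₑ) * ENNReal.ofReal (w₂⁻¹ j))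
      = ellNorm p (fun j => ∑' i, a i * (‖k i j‖ₑ * ENNReal.ofReal (w₂⁻¹ j))) := by
        simp_rw [← ENNReal.tsum_mul_right, mul_assoc]
    _ ≤ ∑' i, a i * ellNorm p (fun j => ‖k i j‖ₑ * ENNReal.ofReal (w₂⁻¹ j)) :=
        ellNorm_tsum_mul_le hp.out _ _
    _ = ∑' i, (a i * ENNReal.ofReal (w₁ i)) * (ENNReal.ofReal (w₁⁻¹ i) *
          ellNorm p (fun j => ‖k i j‖ₑ * ENNReal.ofReal (w₂⁻¹ j))) := by
        refine tsum_congr fun i => ?_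
        rw [← mul_assoc, mul_assoc (a i), weight_mul_inv_weight hw₁, mul_one]
    _ ≤ ∑' i, (a i * ENNReal.ofReal (w₁ i)) * rowNorm p ∞ (invTensorWeight w₁ w₂) k :=
        ENNReal.tsum_le_tsum fun i => by gcongr; exact hrow i
    _ = _ := by rw [ENNReal.tsum_mul_right, ellNorm_one, mul_comm]

theorem matBdd_colNorm {w₁ : I → ℝ} {w₂ : J → ℝ} (hw₁ : ∀ i, 0 < w₁ i) {p q : ℝ≥0∞}
    (hpq : p.HolderConjugate q) (k : I → J → ℂ) :
    MatBdd p ∞ w₁ w₂ k (colNorm q ∞ (invTensorWeight w₁ w₂) k) := by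
  intro a
  rw [ellNorm_top]
  refine iSup_le fun j => ?_
  calc (∑' i, a i * ‖k i j‖ₑ) * ENNReal.ofReal (w₂⁻¹ j)
      = ∑' i, a i * (‖k i j‖ₑ * ENNReal.ofReal (w₂⁻¹ j)) := by
        simp_rw [← ENNReal.tsum_mul_right, mul_assoc]
    _ ≤ _ := tsum_mul_le_weighted hpq hw₁ _ _
    _ ≤ _ := by
        rw [mul_comm]
        gcongr
        refine le_trans (le_of_eq ?_) (colNorm_top_le_iff.1 le_rfl j)
        congr 1
        funext i
        rw [ofReal_invTensorWeight hw₁]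
        ring

end MatrixOperators

section Represents

variable {I J H₁ H₂ : Type*} [NormedAddCommGroup H₁] [InnerProductSpace ℂ H₁]
  [NormedAddCommGroup H₂] [InnerProductSpace ℂ H₂] {ψ₁ : I → H₁} {ψ₂ : J → H₂}
  {w₁ : I → ℝ} {w₂ : J → ℝ} {r s : ℝ≥0∞} [hr : Fact (1 ≤ r)]
  {k : I → J → ℂ} {N : ℝ≥0∞}

theorem wNorm_analysis_ne_top [CompleteSpace H₁] (h₁ : LocalisedFor ψ₁ w₁) {f : GenVec ψ₁}
    (hf : f ∈ Co ψ₁ r w₁) : wNorm r w₁ (analysis ψ₁ f) ≠ ∞ := by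
  obtain ⟨C, hC⟩ := exists_wNorm_analysis_le h₁ r
  exact ((hC f).trans_lt
    (ENNReal.mul_lt_top ENNReal.coe_lt_top (Co.coeff_spec h₁ hf).1.lt_top)).ne

theorem MatBdd.ne_top [CompleteSpace H₁] (h₁ : LocalisedFor ψ₁ w₁)
    (hk : MatBdd r s w₁ w₂ k N) (hN : N ≠ ∞) {f : GenVec ψ₁} (hf : f ∈ Co ψ₁ r w₁) :
    ellNorm s (fun j => (∑' i, ‖analysis ψ₁ f i‖ₑ * ‖k i j‖ₑ) * ENNReal.ofReal (w₂⁻¹ j)) ≠ ∞ :=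
  ((hk fun i => ‖analysis ψ₁ f i‖ₑ).trans_lt
    (ENNReal.mul_lt_top hN.lt_top (wNorm_analysis_ne_top h₁ hf).lt_top)).ne

variable [hs : Fact (1 ≤ s)]

/-- The operator `O` is given by the matrix `k`: `(C_Ψ̃₂ O f)_j = ∑_i (C_Ψ₁ f)_i k_{i,j}`. -/
def Represents (k : I → J → ℂ) (O : Co ψ₁ r w₁ →ₗ[ℂ] Co ψ₂ s w₂⁻¹) : Prop :=
  ∀ (f : Co ψ₁ r w₁) (j : J), HasSum (fun i => analysis ψ₁ f i * k i j)
    (coeff (dualCoeff ψ₂) (O f) j)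

theorem Represents.coNorm_le {O : Co ψ₁ r w₁ →ₗ[ℂ] Co ψ₂ s w₂⁻¹} (hO : Represents k O)
    (hk : MatBdd r s w₁ w₂ k N) (f : Co ψ₁ r w₁) :
    coNorm ψ₂ s w₂⁻¹ (O f) ≤ N * wNorm r w₁ (analysis ψ₁ f) := by
  refine le_trans (ellNorm_mono s fun j => ?_) (hk fun i => ‖analysis ψ₁ f i‖ₑ)
  gcongr
  rw [← (hO f j).tsum_eq]
  refine enorm_tsum_le_tsum_enorm.trans_eq ?_
  simp_rw [enorm_mul]

theorem Represents.exists_coNorm_le (h₁ : LocalisedFor ψ₁ w₁) :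
    ∃ D : ℝ≥0, ∀ (O : Co ψ₁ r w₁ →ₗ[ℂ] Co ψ₂ s w₂⁻¹) (k : I → J → ℂ) (N : ℝ≥0∞),
      Represents k O → MatBdd r s w₁ w₂ k N →
      ∀ f, coNorm ψ₂ s w₂⁻¹ (O f) ≤ D * N * coNorm ψ₁ r w₁ f := by
  obtain ⟨D, hD⟩ := exists_wNorm_analysis_le h₁ r
  refine ⟨D, fun O k N hO hk f => (hO.coNorm_le hk f).trans ?_⟩
  rw [mul_comm (D : ℝ≥0∞), mul_assoc]
  gcongr
  exact hD f

theorem Represents.isBdd {O : Co ψ₁ r w₁ →ₗ[ℂ] Co ψ₂ s w₂⁻¹} {k : I → J → ℂ} {N : ℝ≥0∞}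
    (hO : Represents k O) (h₁ : LocalisedFor ψ₁ w₁) (hk : MatBdd r s w₁ w₂ k N) (hN : N ≠ ∞) :
    IsBdd O := by
  obtain ⟨D, hD⟩ := Represents.exists_coNorm_le (ψ₂ := ψ₂) (w₂ := w₂) (r := r) (s := s) h₁
  refine ⟨D * N.toNNReal, fun f => ?_⟩
  rw [ENNReal.coe_mul, ENNReal.coe_toNNReal hN]
  exact hD O k N hO hk f

theorem Represents.unique {O O' : Co ψ₁ r w₁ →ₗ[ℂ] Co ψ₂ s w₂⁻¹} (hO : Represents k O)
    (hO' : Represents k O') : O = O' := by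
  refine LinearMap.ext fun f => Subtype.ext (coeff_injective _ ?_)
  funext j
  exact (hO f j).unique (hO' f j)

variable [CompleteSpace H₁]

theorem analysis_add (h₁ : LocalisedFor ψ₁ w₁) (f g : Co ψ₁ r w₁) (i : I) :
    analysis ψ₁ (f + g : Co ψ₁ r w₁) i = analysis ψ₁ f i + analysis ψ₁ g i := by
  refine (hasSum_analysis h₁ (f + g).2 i).unique
    (((hasSum_analysis h₁ f.2 i).add (hasSum_analysis h₁ g.2 i)).congr_fun fun l => ?_)
  rw [Submodule.coe_add, map_add, Pi.add_apply, mul_add]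

theorem analysis_smul (h₁ : LocalisedFor ψ₁ w₁) (a : ℂ) (f : Co ψ₁ r w₁) (i : I) :
    analysis ψ₁ (a • f : Co ψ₁ r w₁) i = a * analysis ψ₁ f i := by
  refine (hasSum_analysis h₁ (a • f).2 i).unique
    (((hasSum_analysis h₁ f.2 i).mul_left a).congr_fun fun l => ?_)
  rw [Submodule.coe_smul, map_smul, Pi.smul_apply, smul_eq_mul, mul_left_comm]

/-- The dual frame elements as elements of a co-orbit space. -/
noncomputable def dualElt [Countable I] (h₁ : LocalisedFor ψ₁ w₁) (r : ℝ≥0∞) [Fact (1 ≤ r)]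
    (i : I) : Co ψ₁ r w₁ :=
  ⟨constElt (dualCoeff ψ₁) (dual ψ₁ i), constElt_dual_mem_Co h₁ r i⟩

theorem analysis_dualElt [Countable I] (h₁ : LocalisedFor ψ₁ w₁) (i l : I) :
    analysis ψ₁ (dualElt h₁ r i) l = inner ℂ (dual ψ₁ l) (ψ₁ i) := by
  rw [dualElt, analysis_constElt_dual h₁.isFrame, h₁.isFrame.inner_dual_symm]

/-- A reproducing matrix that represents an operator is recovered from it. -/
theorem Represents.coeff_dualElt [Countable I] {O : Co ψ₁ r w₁ →ₗ[ℂ] Co ψ₂ s w₂⁻¹}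
    (hO : Represents k O) (h₁ : LocalisedFor ψ₁ w₁) (hrep : KerReproducing ψ₁ ψ₂ k)
    (i : I) (j : J) : coeff (dualCoeff ψ₂) (O (dualElt h₁ r i)) j = k i j := by
  have h := hO (dualElt h₁ r i) j
  simp_rw [analysis_dualElt] at h
  exact h.unique (hrep.left i j)

variable [CompleteSpace H₂]

/-- Absolute convergence of the double series that arises when the invariance of the rows of `k`
is inserted into the series for `O f`. -/
theorem MatBdd.summable_cross (h₁ : LocalisedFor ψ₁ w₁) (h₂ : LocalisedFor ψ₂ w₂)
    (hk : MatBdd r s w₁ w₂ k N) (hN : N ≠ ∞) {f : GenVec ψ₁} (hf : f ∈ Co ψ₁ r w₁) (j : J) :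
    Summable fun x : J × I => (inner ℂ (dual ψ₂ j) (ψ₂ x.1) : ℂ) *
      (analysis ψ₁ f x.2 * k x.2 x.1) := by
  refine summable_prod_of_tsum_enorm ?_
  simp_rw [enorm_mul, ENNReal.tsum_mul_left]
  exact h₂.inv.cross.tsum_ne_top h₂.inv.pos hs.out (hk.ne_top h₁ hN hf) j

/-- Absolute convergence of the double series `⟨K, f₁ ⊗ f₂⟩`. -/
theorem MatBdd.summable_pairing (h₁ : LocalisedFor ψ₁ w₁) (h₂ : LocalisedFor ψ₂ w₂)
    (hk : MatBdd r s w₁ w₂ k N) (hN : N ≠ ∞) {f : GenVec ψ₁} (hf : f ∈ Co ψ₁ r w₁)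
    {g : GenVec ψ₂} (hg : g ∈ Co ψ₂ 1 w₂) :
    Summable fun x : J × I => (analysis ψ₁ f x.2 * k x.2 x.1) * conj (analysis ψ₂ g x.1) := by
  refine summable_prod_of_tsum_enorm ?_
  simp_rw [enorm_mul, RCLike.enorm_conj, ENNReal.tsum_mul_right,
    mul_comm _ (‖analysis ψ₂ g _‖ₑ)]
  refine ((tsum_mul_le_weighted ENNReal.HolderConjugate.one_top h₂.pos _ _).trans_lt
    (ENNReal.mul_lt_top (wNorm_analysis_ne_top h₂ hg).lt_top ?_)).ne
  rw [ellNorm_top]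
  exact (iSup_le fun j => le_ellNorm hs.out _ j).trans_lt (hk.ne_top h₁ hN hf).lt_top

theorem Represents.hasSum_pairing {O : Co ψ₁ r w₁ →ₗ[ℂ] Co ψ₂ s w₂⁻¹} (hO : Represents k O)
    (h₁ : LocalisedFor ψ₁ w₁) (h₂ : LocalisedFor ψ₂ w₂) (hk : MatBdd r s w₁ w₂ k N)
    (hN : N ≠ ∞) (f : Co ψ₁ r w₁) (g : Co ψ₂ 1 w₂) :
    HasSum (fun x : J × I => (analysis ψ₁ f x.2 * k x.2 x.1) * conj (analysis ψ₂ g x.1))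
      (pairing ψ₂ (O f) g) := by
  have hF := hk.summable_pairing h₁ h₂ hN f.2 g.2
  have h := hF.hasSum.prod_fiberwise fun j => (hO f j).mul_right (conj (analysis ψ₂ g j))
  rw [pairing, h.tsum_eq]
  exact hF.hasSum

/-- An operator given by the matrix of `K` has the kernel `K`. -/
theorem Represents.isKernel {O : Co ψ₁ r w₁ →ₗ[ℂ] Co ψ₂ s w₂⁻¹} {K : GenKer ψ₁ ψ₂}
    (hO : Represents (kerMatrix ψ₁ ψ₂ K) O) (h₁ : LocalisedFor ψ₁ w₁)
    (h₂ : LocalisedFor ψ₂ w₂) (hk : MatBdd r s w₁ w₂ (kerMatrix ψ₁ ψ₂ K) N) (hN : N ≠ ∞) :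
    IsKernel w₂ O K := by
  intro f g
  have h := (hO.hasSum_pairing h₁ h₂ hk hN f g).tsum_eq
  rw [← h, kerPairing, ← (Equiv.prodComm J I).tsum_eq]
  refine tsum_congr fun x => ?_
  simp only [Equiv.prodComm_apply, Prod.fst_swap, Prod.snd_swap, map_mul, Complex.conj_conj]
  ring

/-- An operator with the kernel `K` is given by the matrix of `K`: test the defining identity of
a kernel with the elements of the dual frame. -/
theorem IsKernel.represents [Countable J] {O : Co ψ₁ r w₁ →ₗ[ℂ] Co ψ₂ s w₂⁻¹}
    {K : GenKer ψ₁ ψ₂} (hK : IsKernel w₂ O K) (h₁ : LocalisedFor ψ₁ w₁)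
    (h₂ : LocalisedFor ψ₂ w₂) (hrep : KerReproducing ψ₁ ψ₂ (kerMatrix ψ₁ ψ₂ K))
    (hk : MatBdd r s w₁ w₂ (kerMatrix ψ₁ ψ₂ K) N) (hN : N ≠ ∞) :
    Represents (kerMatrix ψ₁ ψ₂ K) O := by
  intro f j
  have h := hK f ⟨_, constElt_dual_mem_Co h₂ 1 j⟩
  rw [pairing_constElt_dual h₂.isFrame (Co.coeff_spec h₂.inv (O f).2).2] at h
  have hF := hk.summable_cross h₁ h₂ hN f.2 j
  have hfib : ∀ i, HasSum (fun m => (inner ℂ (dual ψ₂ j) (ψ₂ m) : ℂ) *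
      (analysis ψ₁ f i * kerMatrix ψ₁ ψ₂ K i m)) (analysis ψ₁ f i * kerMatrix ψ₁ ψ₂ K i j) :=
    fun i => ((hrep.right i j).mul_left (analysis ψ₁ f i)).congr_fun fun m => mul_left_comm _ _ _
  have hsum := hF.prod_symm.hasSum.prod_fiberwise hfib
  have e : ∑' x : I × J, (inner ℂ (dual ψ₂ j) (ψ₂ x.swap.1) : ℂ) *
      (analysis ψ₁ f x.swap.2 * kerMatrix ψ₁ ψ₂ K x.swap.2 x.swap.1) =
      coeff (dualCoeff ψ₂) (O f) j := by
    rw [h, kerPairing]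
    refine tsum_congr fun x => ?_
    simp only [Prod.fst_swap, Prod.snd_swap, map_mul, Complex.conj_conj,
      conj_analysis_constElt_dual h₂.isFrame]
    ring
  rwa [e] at hsum

/-- Every bounded matrix with reproducing rows represents an operator. -/
theorem exists_represents [Countable J] (h₁ : LocalisedFor ψ₁ w₁) (h₂ : LocalisedFor ψ₂ w₂)
    (hrep : ∀ i, Reproducing ψ₂ (k i)) (hk : MatBdd r s w₁ w₂ k N) (hN : N ≠ ∞) :
    ∃ O : Co ψ₁ r w₁ →ₗ[ℂ] Co ψ₂ s w₂⁻¹, Represents k O := by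
  have hsumm : ∀ (f : Co ψ₁ r w₁) (j : J), Summable fun i => analysis ψ₁ f i * k i j :=
    fun f j => by
      refine Summable.of_enorm ?_
      simp_rw [enorm_mul]
      exact ne_top_of_ellNorm_mul_ne_top hs.out h₂.inv.pos (hk.ne_top h₁ hN f.2) j
  have hex : ∀ f : Co ψ₁ r w₁, ∃ g : Co ψ₂ s w₂⁻¹,
      coeff (dualCoeff ψ₂) g = fun j => ∑' i, analysis ψ₁ f i * k i j := fun f => by
    have h1 : wNorm s w₂⁻¹ (fun j => ∑' i, analysis ψ₁ f i * k i j) ≠ ∞ := by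
      refine ne_top_of_le_ne_top (hk.ne_top h₁ hN f.2) (ellNorm_mono s fun j => ?_)
      gcongr
      refine enorm_tsum_le_tsum_enorm.trans_eq ?_
      simp_rw [enorm_mul]
    have h2 : Reproducing ψ₂ fun j => ∑' i, analysis ψ₁ f i * k i j := fun j => by
      have hfib : ∀ i, HasSum (fun m => (inner ℂ (dual ψ₂ j) (ψ₂ m) : ℂ) *
          (analysis ψ₁ f i * k i m)) (analysis ψ₁ f i * k i j) := fun i =>
        ((hrep i j).mul_left (analysis ψ₁ f i)).congr_fun fun m => mul_left_comm _ _ _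
      have hcol : ∀ m, HasSum (fun i => (inner ℂ (dual ψ₂ j) (ψ₂ m) : ℂ) *
          (analysis ψ₁ f i * k i m)) (inner ℂ (dual ψ₂ j) (ψ₂ m) *
            ∑' i, analysis ψ₁ f i * k i m) := fun m => (hsumm f m).hasSum.mul_left _
      have hF := hk.summable_cross h₁ h₂ hN f.2 j
      exact hasSum_interchange hF hcol hfib (hsumm f j).hasSum
    obtain ⟨g, hg, hgc⟩ := exists_mem_Co h₂.inv h1 h2
    exact ⟨⟨g, hg⟩, hgc⟩
  choose O hO using hex
  refine ⟨⟨⟨O, fun f g => ?_⟩, fun a f => ?_⟩, fun f j => ?_⟩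
  · refine Subtype.ext (coeff_injective _ ?_)
    rw [Submodule.coe_add, map_add, hO, hO, hO]
    funext j
    simp_rw [analysis_add h₁, add_mul]
    exact (hsumm f j).tsum_add (hsumm g j)
  · refine Subtype.ext (coeff_injective _ ?_)
    rw [RingHom.id_apply, Submodule.coe_smul, map_smul, hO, hO]
    funext j
    simp_rw [analysis_smul h₁, mul_assoc, Pi.smul_apply, smul_eq_mul]
    exact tsum_mul_left
  · change HasSum _ (coeff (dualCoeff ψ₂) (O f) j)
    rw [hO]
    exact (hsumm f j).hasSum

theorem isGalerkin_coeff_dualElt [Countable I] [Countable J]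
    (O : Co ψ₁ r w₁ →ₗ[ℂ] Co ψ₂ s w₂⁻¹) (h₁ : LocalisedFor ψ₁ w₁) (h₂ : LocalisedFor ψ₂ w₂) :
    IsGalerkin w₂ O fun i j => coeff (dualCoeff ψ₂) (O (dualElt h₁ r i)) j := fun i j =>
  ⟨dualElt h₁ r i, dualElt h₂ 1 j, rfl, rfl,
    (pairing_constElt_dual h₂.isFrame (Co.coeff_spec h₂.inv (O _).2).2 j).symm⟩

end Represents

/-! ### The matrix of a bounded operator -/

section BoundedOperators

variable {I J H₁ H₂ : Type*} [Countable I] [NormedAddCommGroup H₁] [InnerProductSpace ℂ H₁]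
  [CompleteSpace H₁] [NormedAddCommGroup H₂] [InnerProductSpace ℂ H₂]
  {ψ₁ : I → H₁} {ψ₂ : J → H₂}
  {w₁ : I → ℝ} {w₂ : J → ℝ} {r s : ℝ≥0∞} [hr : Fact (1 ≤ r)] [hs : Fact (1 ≤ s)]

theorem coeff_sum_dualElt (h₁ : LocalisedFor ψ₁ w₁) (t : Finset I) (e : I → ℂ) (l : I) :
    coeff (dualCoeff ψ₁) (∑ i ∈ t, e i • dualElt h₁ r i : Co ψ₁ r w₁) l =
      ∑ i ∈ t, inner ℂ (dual ψ₁ l) (dual ψ₁ i) * e i := by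
  rw [Submodule.coe_sum, map_sum, Finset.sum_apply]
  refine Finset.sum_congr rfl fun i _ => ?_
  rw [Submodule.coe_smul, map_smul, Pi.smul_apply, smul_eq_mul, mul_comm, dualElt, coeff_constElt,
    dualCoeff_apply]

theorem coeff_map_sum_dualElt (h₁ : LocalisedFor ψ₁ w₁) (O : Co ψ₁ r w₁ →ₗ[ℂ] Co ψ₂ s w₂⁻¹)
    (t : Finset I) (e : I → ℂ) (j : J) :
    coeff (dualCoeff ψ₂) (O (∑ i ∈ t, e i • dualElt h₁ r i)) j =
      ∑ i ∈ t, e i * coeff (dualCoeff ψ₂) (O (dualElt h₁ r i)) j := by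
  rw [map_sum, Submodule.coe_sum, map_sum, Finset.sum_apply]
  refine Finset.sum_congr rfl fun i _ => ?_
  rw [map_smul, Submodule.coe_smul, map_smul, Pi.smul_apply, smul_eq_mul]

/-- For `r < ∞`, a bounded operator on `H^r_w` is represented by its Galerkin matrix, since the
expansion `f = ∑ ⟨f, ψ i⟩ ψ̃ i` converges in norm. -/
theorem IsBdd.represents (h₁ : LocalisedFor ψ₁ w₁) (hw₂ : ∀ j, 0 < w₂ j) (hr' : r ≠ ∞)
    {O : Co ψ₁ r w₁ →ₗ[ℂ] Co ψ₂ s w₂⁻¹} (hO : IsBdd O) :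
    Represents (fun i j => coeff (dualCoeff ψ₂) (O (dualElt h₁ r i)) j) O := by
  classical
  intro f j
  obtain ⟨C, hC⟩ := hO
  obtain ⟨D, hD⟩ := h₁.dualGram.exists_wNorm_le hr.out
  set a := analysis ψ₁ f with ha
  set y : Finset I → Co ψ₁ r w₁ := fun t => ∑ i ∈ t, a i • dualElt h₁ r i with hy
  have hdiff : ∀ t, coNorm ψ₁ r w₁ (f - y t : Co ψ₁ r w₁) ≤
      D * ellNorm r fun i => if i ∈ t then 0 else ‖a i‖ₑ * ENNReal.ofReal (w₁ i) := fun t => by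
    have e1 : coeff (dualCoeff ψ₁) (f - y t : Co ψ₁ r w₁) = fun l =>
        ∑' i, inner ℂ (dual ψ₁ l) (dual ψ₁ i) * (if i ∈ t then 0 else a i) := by
      funext l
      have h1 := hasSum_dualGram_analysis h₁ f.2 l
      have h2 : HasSum (fun i => (inner ℂ (dual ψ₁ l) (dual ψ₁ i) : ℂ) *
          (if i ∈ t then a i else 0)) (coeff (dualCoeff ψ₁) (y t) l) := by
        have e0 : coeff (dualCoeff ψ₁) (y t) l = ∑ i ∈ t,
            (inner ℂ (dual ψ₁ l) (dual ψ₁ i) : ℂ) * (if i ∈ t then a i else 0) := by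
          rw [hy, coeff_sum_dualElt]
          exact Finset.sum_congr rfl fun i hi => by rw [if_pos hi]
        rw [e0]
        exact (hasSum_sum_of_ne_finset_zero (s := t) fun i hi => by simp [hi] :
          HasSum (fun i => (inner ℂ (dual ψ₁ l) (dual ψ₁ i) : ℂ) * (if i ∈ t then a i else 0)) _)
      rw [Submodule.coe_sub, map_sub, Pi.sub_apply, ← (h1.sub h2).tsum_eq]
      refine tsum_congr fun i => ?_
      split_ifs <;> simp [ha]
    have e2 : wNorm r w₁ (fun i => if i ∈ t then 0 else a i) =
        ellNorm r fun i => if i ∈ t then 0 else ‖a i‖ₑ * ENNReal.ofReal (w₁ i) := by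
      unfold wNorm
      congr 1
      funext i
      by_cases hi : i ∈ t <;> simp [hi]
    rw [coNorm, e1, ← e2]
    exact hD _
  have htail : Tendsto (fun t => (C * (D * ellNorm r fun i => if i ∈ t then 0 else
      ‖a i‖ₑ * ENNReal.ofReal (w₁ i))) * ENNReal.ofReal (w₂ j)) (atTop : Filter (Finset I))
      (𝓝 0) := by
    have h0 := tendsto_ellNorm_tail hr.out hr' (wNorm_analysis_ne_top h₁ f.2)
    have h1 := ENNReal.Tendsto.mul_const (b := ENNReal.ofReal (w₂ j))
      (ENNReal.Tendsto.const_mul (a := (C : ℝ≥0∞)) (ENNReal.Tendsto.const_mul (a := (D : ℝ≥0∞)) h0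
        (.inr ENNReal.coe_ne_top)) (.inr ENNReal.coe_ne_top)) (.inr ENNReal.ofReal_ne_top)
    simpa using h1
  rw [HasSum, SummationFilter.unconditional_filter, tendsto_iff_edist_tendsto_0]
  refine tendsto_of_tendsto_of_tendsto_of_le_of_le tendsto_const_nhds htail
    (fun _ => zero_le) fun t => ?_
  beta_reduce
  rw [← coeff_map_sum_dualElt, edist_comm, edist_eq_enorm_sub]
  have e3 : coeff (dualCoeff ψ₂) (O f) j - coeff (dualCoeff ψ₂) (O (y t)) j =
      coeff (dualCoeff ψ₂) (O (f - y t)) j := by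
    rw [map_sub O, Submodule.coe_sub, map_sub, Pi.sub_apply]
  change ‖coeff (dualCoeff ψ₂) (O f) j - coeff (dualCoeff ψ₂) (O (y t)) j‖ₑ ≤ _
  rw [e3]
  calc ‖coeff (dualCoeff ψ₂) (O (f - y t)) j‖ₑ
      = ‖coeff (dualCoeff ψ₂) (O (f - y t)) j‖ₑ * ENNReal.ofReal (w₂⁻¹ j) *
          ENNReal.ofReal (w₂ j) := by
        rw [mul_assoc, mul_comm (ENNReal.ofReal (w₂⁻¹ j)), weight_mul_inv_weight hw₂, mul_one]
    _ ≤ coNorm ψ₂ s w₂⁻¹ (O (f - y t)) * ENNReal.ofReal (w₂ j) := by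
        gcongr
        exact enorm_mul_le_wNorm hs.out _ _ j
    _ ≤ _ := by
        gcongr
        exact (hC _).trans (by gcongr; exact hdiff t)

/-- For a bounded operator on `H¹_w`, the norms of the images of the dual frame elements bound the
rows of the Galerkin matrix. -/
theorem exists_rowNorm_le_of_isBdd (h₁ : LocalisedFor ψ₁ w₁) :
    ∃ D : ℝ≥0, ∀ (O : Co ψ₁ 1 w₁ →ₗ[ℂ] Co ψ₂ s w₂⁻¹) (C : ℝ≥0),
      (∀ f, coNorm ψ₂ s w₂⁻¹ (O f) ≤ C * coNorm ψ₁ 1 w₁ f) →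
      rowNorm s ∞ (invTensorWeight w₁ w₂)
        (fun i j => coeff (dualCoeff ψ₂) (O (dualElt h₁ 1 i)) j) ≤ D * C := by
  obtain ⟨D, hD⟩ := exists_wNorm_dualGram_le h₁ 1
  refine ⟨D, fun O C hC => rowNorm_top_le_iff.2 fun i => ?_⟩
  have hco : coNorm ψ₁ 1 w₁ (dualElt h₁ 1 i) ≤ D * ENNReal.ofReal (w₁ i) := by
    refine le_trans (le_of_eq ?_) (hD i)
    unfold coNorm
    congr 1
    funext l
    exact coeff_constElt _ _ _
  calc ellNorm s (fun j => ‖coeff (dualCoeff ψ₂) (O (dualElt h₁ 1 i)) j‖ₑ *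
        ENNReal.ofReal (invTensorWeight w₁ w₂ i j))
      = ENNReal.ofReal (w₁⁻¹ i) * coNorm ψ₂ s w₂⁻¹ (O (dualElt h₁ 1 i)) := by
        rw [coNorm, wNorm, ← ellNorm_const_mul]
        congr 1
        funext j
        rw [ofReal_invTensorWeight h₁.pos]
        ring
    _ ≤ ENNReal.ofReal (w₁⁻¹ i) * (C * (D * ENNReal.ofReal (w₁ i))) := by
        gcongr
        exact (hC _).trans (by gcongr)
    _ = (ENNReal.ofReal (w₁ i) * ENNReal.ofReal (w₁⁻¹ i)) * (D * C) := by ring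
    _ = D * C := by rw [weight_mul_inv_weight h₁.pos, one_mul]

/-- For a bounded operator from `H^p_w` to `H^∞`, the columns of the Galerkin matrix are bounded
in the dual `ℓ^q`-space: test them against finite linear combinations of the dual frame. -/
theorem exists_colNorm_le_of_isBdd (h₁ : LocalisedFor ψ₁ w₁) {p q : ℝ≥0∞} [hp : Fact (1 ≤ p)]
    (hpq : p.HolderConjugate q) :
    ∃ D : ℝ≥0, ∀ (O : Co ψ₁ p w₁ →ₗ[ℂ] Co ψ₂ ∞ w₂⁻¹) (C : ℝ≥0),
      (∀ f, coNorm ψ₂ ∞ w₂⁻¹ (O f) ≤ C * coNorm ψ₁ p w₁ f) →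
      colNorm q ∞ (invTensorWeight w₁ w₂)
        (fun i j => coeff (dualCoeff ψ₂) (O (dualElt h₁ p i)) j) ≤ D * C := by
  obtain ⟨D, hD⟩ := h₁.dualGram.exists_wNorm_le hp.out
  refine ⟨D, fun O C hC => colNorm_top_le_iff.2 fun j =>
    ellNorm_le_of_forall_sum_mul_le hpq.symm hp.out _ _ fun t d hd => ?_⟩
  set k : I → ℂ := fun i => coeff (dualCoeff ψ₂) (O (dualElt h₁ p i)) j with hk
  choose u hu1 hu using fun i => RCLike.exists_norm_eq_mul_self (k i)
  set e : I → ℂ := fun i => u i * ((d i * w₁⁻¹ i : ℝ) : ℂ) with he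
  have hwd : ∀ i, (0 : ℝ) ≤ d i * w₁⁻¹ i := fun i =>
    mul_nonneg (d i).2 (inv_weight_pos h₁.pos i).le
  have hen : ∀ i, ‖e i‖ₑ = d i * ENNReal.ofReal (w₁⁻¹ i) := fun i => by
    rw [he]
    simp only
    rw [enorm_mul, ← ofReal_norm (u i), hu1, ENNReal.ofReal_one, one_mul, ← ofReal_norm,
      Complex.norm_of_nonneg (hwd i), ENNReal.ofReal_mul (NNReal.coe_nonneg (d i)),
      ENNReal.ofReal_coe_nnreal]
  set y : Co ψ₁ p w₁ := ∑ i ∈ t, e i • dualElt h₁ p i with hy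
  have hyn : coNorm ψ₁ p w₁ y ≤ D * ellNorm p fun i => (d i : ℝ≥0∞) := by
    have e1 : coeff (dualCoeff ψ₁) y = fun l =>
        ∑' i, inner ℂ (dual ψ₁ l) (dual ψ₁ i) * e i := by
      funext l
      rw [hy, coeff_sum_dualElt, tsum_eq_sum]
      intro i hi
      simp [he, hd i hi]
    rw [coNorm, e1]
    refine (hD e).trans (le_of_eq ?_)
    congr 1
    unfold wNorm
    congr 1
    funext i
    rw [hen, mul_assoc, mul_comm (ENNReal.ofReal (w₁⁻¹ i)), weight_mul_inv_weight h₁.pos, mul_one]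
  have hval : ‖coeff (dualCoeff ψ₂) (O y) j‖ₑ =
      ∑ i ∈ t, ‖k i‖ₑ * ENNReal.ofReal (w₁⁻¹ i) * d i := by
    have e1 : coeff (dualCoeff ψ₂) (O y) j = ((∑ i ∈ t, ‖k i‖ * (d i * w₁⁻¹ i) : ℝ) : ℂ) := by
      rw [hy, coeff_map_sum_dualElt, Complex.ofReal_sum]
      refine Finset.sum_congr rfl fun i _ => ?_
      have := hu i
      rw [Complex.ofReal_mul]
      calc e i * k i = (u i * k i) * ((d i * w₁⁻¹ i : ℝ) : ℂ) := by rw [he]; ring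
        _ = _ := by rw [← this]; rfl
    have hnn : ∀ i ∈ t, 0 ≤ ‖k i‖ * (d i * w₁⁻¹ i) := fun i _ =>
      mul_nonneg (norm_nonneg _) (hwd i)
    rw [e1, ← ofReal_norm, Complex.norm_of_nonneg (Finset.sum_nonneg hnn),
      ENNReal.ofReal_sum_of_nonneg hnn]
    refine Finset.sum_congr rfl fun i _ => ?_
    rw [ENNReal.ofReal_mul (norm_nonneg _), ENNReal.ofReal_mul (NNReal.coe_nonneg (d i)),
      ofReal_norm, ENNReal.ofReal_coe_nnreal, mul_assoc, mul_comm (d i : ℝ≥0∞)]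
  calc ∑ i ∈ t, ‖k i‖ₑ * ENNReal.ofReal (invTensorWeight w₁ w₂ i j) * d i
      = ‖coeff (dualCoeff ψ₂) (O y) j‖ₑ * ENNReal.ofReal (w₂⁻¹ j) := by
        rw [hval, Finset.sum_mul]
        refine Finset.sum_congr rfl fun i _ => ?_
        rw [ofReal_invTensorWeight h₁.pos]
        ring
    _ ≤ coNorm ψ₂ ∞ w₂⁻¹ (O y) := enorm_mul_le_wNorm le_top _ _ j
    _ ≤ C * (D * ellNorm p fun i => (d i : ℝ≥0∞)) := (hC y).trans (by gcongr)
    _ = D * C * ellNorm p fun i => (d i : ℝ≥0∞) := by ring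

variable [CompleteSpace H₂]

/-- For `r = ∞`, weak-* continuity replaces the norm convergence of the frame expansion. -/
theorem IsWeakStarCont.represents [Countable J] (h₁ : LocalisedFor ψ₁ w₁)
    (h₂ : LocalisedFor ψ₂ w₂) {O : Co ψ₁ ∞ w₁ →ₗ[ℂ] Co ψ₂ s w₂⁻¹} (hO : IsWeakStarCont w₂ O) :
    Represents (fun i j => coeff (dualCoeff ψ₂) (O (dualElt h₁ ∞ i)) j) O := by
  intro f j
  obtain ⟨g, hg⟩ := hO (dualElt h₂ 1 j)
  have hg' : ∀ f : Co ψ₁ ∞ w₁, HasSum (fun i => analysis ψ₁ f i * conj (coeff (dualCoeff ψ₁) g i))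
      (coeff (dualCoeff ψ₂) (O f) j) := fun f => by
    have h := hasSum_pairing h₁ ENNReal.HolderConjugate.top_one f.2 g.2
    rwa [← hg f, dualElt, pairing_constElt_dual h₂.isFrame (Co.coeff_spec h₂.inv (O f).2).2] at h
  have hk : ∀ i, coeff (dualCoeff ψ₂) (O (dualElt h₁ ∞ i)) j =
      conj (coeff (dualCoeff ψ₁) g i) := fun i => by
    have h := Complex.hasSum_conj'.2 ((Co.coeff_spec h₁.inv g.2).2 i)
    refine (hg' (dualElt h₁ ∞ i)).unique (h.congr_fun fun l => ?_)
    rw [analysis_dualElt, map_mul, inner_conj_symm, h₁.isFrame.inner_dual_symm]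
  simp_rw [hk]
  exact hg' f

/-- An operator on `H^∞_w` that is given by a matrix with columns in `ℓ¹` is weak-* continuous. -/
theorem Represents.isWeakStarCont {O : Co ψ₁ ∞ w₁ →ₗ[ℂ] Co ψ₂ ∞ w₂⁻¹} {k : I → J → ℂ}
    (hO : Represents k O) (h₁ : LocalisedFor ψ₁ w₁) (h₂ : LocalisedFor ψ₂ w₂)
    (hrep : KerReproducing ψ₁ ψ₂ k) (hk : colNorm 1 ∞ (invTensorWeight w₁ w₂) k ≠ ∞) :
    IsWeakStarCont w₂ O := by
  intro f₂
  set b := analysis ψ₂ f₂ with hb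
  have hbn := wNorm_analysis_ne_top h₂ f₂.2
  rw [← hb] at hbn
  -- the absolute values `∑ j, |k i j| |b j|` form a family in `ℓ¹` with the weight `1 / w₁`
  have hfin : ellNorm 1 (fun i => (∑' j, ‖k i j‖ₑ * ‖b j‖ₑ) * ENNReal.ofReal (w₁⁻¹ i)) ≠ ∞ := by
    have e : ellNorm 1 (fun i => (∑' j, ‖k i j‖ₑ * ‖b j‖ₑ) * ENNReal.ofReal (w₁⁻¹ i)) =
        ∑' j, ‖b j‖ₑ * ∑' i, ‖k i j‖ₑ * ENNReal.ofReal (w₁⁻¹ i) := by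
      rw [ellNorm_one]
      simp_rw [← ENNReal.tsum_mul_right, ← ENNReal.tsum_mul_left]
      rw [ENNReal.tsum_comm]
      refine tsum_congr fun j => tsum_congr fun i => ?_
      ring
    rw [e]
    refine ((tsum_mul_le_weighted ENNReal.HolderConjugate.one_top h₂.pos _ _).trans_lt
      (ENNReal.mul_lt_top hbn.lt_top (lt_of_le_of_lt ?_ hk.lt_top))).ne
    rw [ellNorm_top]
    refine iSup_le fun j => le_trans (le_of_eq ?_) (colNorm_top_le_iff.1 le_rfl j)
    rw [ellNorm_one, ← ENNReal.tsum_mul_right]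
    refine tsum_congr fun i => ?_
    rw [ofReal_invTensorWeight h₁.pos, mul_assoc]
  have hsum : ∀ i, Summable fun j => conj (k i j) * b j := fun i => by
    refine Summable.of_enorm ?_
    simp_rw [enorm_mul, RCLike.enorm_conj]
    exact ne_top_of_ellNorm_mul_ne_top le_rfl h₁.inv.pos hfin i
  have hc : wNorm 1 w₁⁻¹ (fun i => ∑' j, conj (k i j) * b j) ≠ ∞ := by
    refine ne_top_of_le_ne_top hfin (ellNorm_mono 1 fun i => ?_)
    gcongr
    refine enorm_tsum_le_tsum_enorm.trans_eq ?_
    simp_rw [enorm_mul, RCLike.enorm_conj]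
  have hcrep : Reproducing ψ₁ fun i => ∑' j, conj (k i j) * b j := fun i => by
    have hF : Summable fun x : I × J => (inner ℂ (dual ψ₁ i) (ψ₁ x.1) : ℂ) *
        (conj (k x.1 x.2) * b x.2) := by
      refine summable_prod_of_tsum_enorm ?_
      simp_rw [enorm_mul, RCLike.enorm_conj, ENNReal.tsum_mul_left]
      exact h₁.inv.cross.tsum_ne_top h₁.inv.pos le_rfl hfin i
    have hrow : ∀ l, HasSum (fun j => (inner ℂ (dual ψ₁ i) (ψ₁ l) : ℂ) * (conj (k l j) * b j))
        (inner ℂ (dual ψ₁ i) (ψ₁ l) * ∑' j, conj (k l j) * b j) := fun l =>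
      (hsum l).hasSum.mul_left _
    have hcol : ∀ j, HasSum (fun l => (inner ℂ (dual ψ₁ i) (ψ₁ l) : ℂ) * (conj (k l j) * b j))
        (conj (k i j) * b j) := fun j => by
      refine ((Complex.hasSum_conj'.2 (hrep.left i j)).mul_right (b j)).congr_fun fun l => ?_
      rw [map_mul, inner_conj_symm, h₁.isFrame.inner_dual_symm i l, mul_assoc]
    exact hasSum_interchange hF hrow hcol (hsum i).hasSum
  obtain ⟨g, hg, hgc⟩ := exists_mem_Co h₁.inv hc hcrep
  refine ⟨⟨g, hg⟩, fun f => ?_⟩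
  have hpair := CoOrbit.hasSum_pairing h₁ ENNReal.HolderConjugate.top_one f.2 hg
  have hO2 := hO.hasSum_pairing h₁ h₂
    (matBdd_colNorm h₁.pos ENNReal.HolderConjugate.top_one k) hk f f₂
  have hfib : ∀ i, HasSum (fun j => (analysis ψ₁ f i * k i j) * conj (b j))
      (analysis ψ₁ f i * conj (coeff (dualCoeff ψ₁) g i)) := fun i => by
    rw [hgc]
    refine ((Complex.hasSum_conj'.2 (hsum i).hasSum).mul_left (analysis ψ₁ f i)).congr_fun
      fun j => ?_
    rw [map_mul, Complex.conj_conj, mul_assoc]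
  have hF := hO2.summable.prod_symm.hasSum.prod_fiberwise hfib
  have e : ∑' x : I × J, (analysis ψ₁ f x.swap.2 * k x.swap.2 x.swap.1) *
      conj (analysis ψ₂ f₂ x.swap.1) = pairing ψ₂ (O f) f₂ := by
    rw [← hO2.tsum_eq]
    exact (Equiv.prodComm I J).tsum_eq fun x : J × I =>
      (analysis ψ₁ f x.2 * k x.2 x.1) * conj (analysis ψ₂ f₂ x.1)
  rw [← e]
  exact hF.unique hpair

end BoundedOperators

/-! ### Kernel theorems for a class of kernels -/

section KernelClasses

variable {I J H₁ H₂ : Type*} [Countable I]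
  [NormedAddCommGroup H₁] [InnerProductSpace ℂ H₁] [CompleteSpace H₁]
  [NormedAddCommGroup H₂] [InnerProductSpace ℂ H₂] [CompleteSpace H₂]
  {ψ₁ : I → H₁} {ψ₂ : J → H₂} {w₁ : I → ℝ} {w₂ : J → ℝ}
  {r s : ℝ≥0∞} [Fact (1 ≤ r)] [hs : Fact (1 ≤ s)]

/-- The Galerkin matrix `(⟨O ψ̃_{1,i}, ψ̃_{2,j}⟩)_{i,j}`, written by means of the coefficients of
the classes `O ψ̃_{1,i}`. -/
noncomputable def galerkin (h₁ : LocalisedFor ψ₁ w₁) (O : Co ψ₁ r w₁ →ₗ[ℂ] Co ψ₂ s w₂⁻¹) (i : I)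
    (j : J) : ℂ :=
  coeff (dualCoeff ψ₂) (O (dualElt h₁ r i)) j

/-- The rows are reproducing as they are the coefficients of elements of co-orbit spaces; the
columns are reproducing as `O` is given by its matrix on the dual frame elements. -/
theorem Represents.kerReproducing_galerkin {O : Co ψ₁ r w₁ →ₗ[ℂ] Co ψ₂ s w₂⁻¹}
    (h₁ : LocalisedFor ψ₁ w₁) (h₂ : LocalisedFor ψ₂ w₂) (hO : Represents (galerkin h₁ O) O) :
    KerReproducing ψ₁ ψ₂ (galerkin h₁ O) where
  right i := (Co.coeff_spec h₂.inv (O (dualElt h₁ r i)).2).2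
  left i j := by
    have h := hO (dualElt h₁ r i) j
    simp_rw [analysis_dualElt] at h
    exact h

/-- The data of a kernel theorem for operators from `H^r_{w₁}` to `H^s_{1/w₂}`: the kernels in `𝒦`
are those with a reproducing matrix of finite norm `ν`, and for an operator with the continuity
property `P`, to be bounded means that its matrix is of finite norm. -/
structure KernelClass (h₁ : LocalisedFor ψ₁ w₁) (ψ₂ : J → H₂) (w₂ : J → ℝ) (r s : ℝ≥0∞)
    [Fact (1 ≤ r)] [Fact (1 ≤ s)] (𝒦 : Set (GenKer ψ₁ ψ₂)) (ν : (I → J → ℂ) → ℝ≥0∞)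
    (P : (Co ψ₁ r w₁ →ₗ[ℂ] Co ψ₂ s w₂⁻¹) → Prop) : Prop where
  spec : ∀ K ∈ 𝒦, ν (kerMatrix ψ₁ ψ₂ K) ≠ ∞ ∧ KerReproducing ψ₁ ψ₂ (kerMatrix ψ₁ ψ₂ K)
  exists_mem : ∀ k, KerReproducing ψ₁ ψ₂ k → ν k ≠ ∞ → ∃ K ∈ 𝒦, kerMatrix ψ₁ ψ₂ K = k
  matBdd : ∀ k, MatBdd r s w₁ w₂ k (ν k)
  exists_le : ∃ D : ℝ≥0, ∀ (O : Co ψ₁ r w₁ →ₗ[ℂ] Co ψ₂ s w₂⁻¹) (C : ℝ≥0),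
    (∀ f, coNorm ψ₂ s w₂⁻¹ (O f) ≤ C * coNorm ψ₁ r w₁ f) → ν (galerkin h₁ O) ≤ D * C
  represents : ∀ O, IsBdd O → P O → Represents (galerkin h₁ O) O
  continuity : ∀ O k, Represents k O → KerReproducing ψ₁ ψ₂ k → ν k ≠ ∞ → P O

namespace KernelClass

variable {h₁ : LocalisedFor ψ₁ w₁} {𝒦 : Set (GenKer ψ₁ ψ₂)} {ν : (I → J → ℂ) → ℝ≥0∞}
  {P : (Co ψ₁ r w₁ →ₗ[ℂ] Co ψ₂ s w₂⁻¹) → Prop}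

theorem mem_iff (c : KernelClass h₁ ψ₂ w₂ r s 𝒦 ν P) {K : GenKer ψ₁ ψ₂}
    (hK : KerReproducing ψ₁ ψ₂ (kerMatrix ψ₁ ψ₂ K)) :
    K ∈ 𝒦 ↔ ν (kerMatrix ψ₁ ψ₂ K) < ∞ := by
  refine ⟨fun h => (c.spec K h).1.lt_top, fun h => ?_⟩
  obtain ⟨K', hK', e⟩ := c.exists_mem _ hK h.ne
  exact kerMatrix_injective e ▸ hK'

theorem galerkin_ne_top (c : KernelClass h₁ ψ₂ w₂ r s 𝒦 ν P)
    {O : Co ψ₁ r w₁ →ₗ[ℂ] Co ψ₂ s w₂⁻¹} (hO : IsBdd O) : ν (galerkin h₁ O) ≠ ∞ := by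
  obtain ⟨D, hD⟩ := c.exists_le
  obtain ⟨C, hC⟩ := hO
  exact ne_top_of_le_ne_top (ENNReal.mul_ne_top ENNReal.coe_ne_top ENNReal.coe_ne_top) (hD O C hC)

theorem exists_isKernel (c : KernelClass h₁ ψ₂ w₂ r s 𝒦 ν P) (h₂ : LocalisedFor ψ₂ w₂)
    {O : Co ψ₁ r w₁ →ₗ[ℂ] Co ψ₂ s w₂⁻¹} (hO : IsBdd O) (hP : P O) :
    ∃ K ∈ 𝒦, IsKernel w₂ O K := by
  have hrep := c.represents O hO hP
  obtain ⟨K, hK, e⟩ := c.exists_mem _ (hrep.kerReproducing_galerkin h₁ h₂) (c.galerkin_ne_top hO)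
  exact ⟨K, hK, Represents.isKernel (e ▸ hrep) h₁ h₂ (c.matBdd _) (c.spec K hK).1⟩

variable [Countable J]

theorem represents_kerMatrix (c : KernelClass h₁ ψ₂ w₂ r s 𝒦 ν P) (h₂ : LocalisedFor ψ₂ w₂)
    {O : Co ψ₁ r w₁ →ₗ[ℂ] Co ψ₂ s w₂⁻¹} {K : GenKer ψ₁ ψ₂} (hK : K ∈ 𝒦)
    (hOK : IsKernel w₂ O K) : Represents (kerMatrix ψ₁ ψ₂ K) O :=
  hOK.represents h₁ h₂ (c.spec K hK).2 (c.matBdd _) (c.spec K hK).1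

theorem kerMatrix_eq_galerkin (c : KernelClass h₁ ψ₂ w₂ r s 𝒦 ν P) (h₂ : LocalisedFor ψ₂ w₂)
    {O : Co ψ₁ r w₁ →ₗ[ℂ] Co ψ₂ s w₂⁻¹} {K : GenKer ψ₁ ψ₂} (hK : K ∈ 𝒦)
    (hOK : IsKernel w₂ O K) : kerMatrix ψ₁ ψ₂ K = galerkin h₁ O := by
  funext i j
  exact ((c.represents_kerMatrix h₂ hK hOK).coeff_dualElt h₁ (c.spec K hK).2 i j).symm

theorem isKernel_unique (c : KernelClass h₁ ψ₂ w₂ r s 𝒦 ν P) (h₂ : LocalisedFor ψ₂ w₂)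
    {O : Co ψ₁ r w₁ →ₗ[ℂ] Co ψ₂ s w₂⁻¹} {K K' : GenKer ψ₁ ψ₂} (hK : K ∈ 𝒦)
    (hOK : IsKernel w₂ O K) (hK' : K' ∈ 𝒦) (hOK' : IsKernel w₂ O K') : K = K' :=
  kerMatrix_injective
    ((c.kerMatrix_eq_galerkin h₂ hK hOK).trans (c.kerMatrix_eq_galerkin h₂ hK' hOK').symm)

theorem isBdd_iff (c : KernelClass h₁ ψ₂ w₂ r s 𝒦 ν P) (h₂ : LocalisedFor ψ₂ w₂)
    (O : Co ψ₁ r w₁ →ₗ[ℂ] Co ψ₂ s w₂⁻¹) :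
    (IsBdd O ∧ P O) ↔ ∃! K, K ∈ 𝒦 ∧ IsKernel w₂ O K := by
  constructor
  · rintro ⟨hO, hP⟩
    obtain ⟨K, hK, hOK⟩ := c.exists_isKernel h₂ hO hP
    exact ⟨K, ⟨hK, hOK⟩, fun K' h => c.isKernel_unique h₂ h.1 h.2 hK hOK⟩
  · rintro ⟨K, ⟨hK, hOK⟩, -⟩
    have hrep := c.represents_kerMatrix h₂ hK hOK
    exact ⟨hrep.isBdd h₁ (c.matBdd _) (c.spec K hK).1,
      c.continuity O _ hrep (c.spec K hK).2 (c.spec K hK).1⟩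

theorem existsUnique_operator (c : KernelClass h₁ ψ₂ w₂ r s 𝒦 ν P) (h₂ : LocalisedFor ψ₂ w₂)
    {K : GenKer ψ₁ ψ₂} (hK : K ∈ 𝒦) :
    ∃! O : Co ψ₁ r w₁ →ₗ[ℂ] Co ψ₂ s w₂⁻¹, IsBdd O ∧ IsKernel w₂ O K := by
  obtain ⟨hfin, hrep⟩ := c.spec K hK
  obtain ⟨O, hO⟩ := exists_represents (s := s) h₁ h₂ hrep.right (c.matBdd _) hfin
  exact ⟨O, ⟨hO.isBdd h₁ (c.matBdd _) hfin, hO.isKernel h₁ h₂ (c.matBdd _) hfin⟩,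
    fun O' h => (c.represents_kerMatrix h₂ hK h.2).unique hO⟩

/-- The upper bound is that for operators given by a matrix, the lower bound the one obtained by
testing the operator with the dual frame. -/
theorem exists_norm_equiv (c : KernelClass h₁ ψ₂ w₂ r s 𝒦 ν P) (h₂ : LocalisedFor ψ₂ w₂) :
    ∃ C : ℝ≥0, 1 ≤ C ∧ ∀ (O : Co ψ₁ r w₁ →ₗ[ℂ] Co ψ₂ s w₂⁻¹), ∀ K ∈ 𝒦, IsKernel w₂ O K →
      ∃ k : I → J → ℂ, IsGalerkin w₂ O k ∧ opNorm O ≤ C * ν (kerMatrix ψ₁ ψ₂ K) ∧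
        ν (kerMatrix ψ₁ ψ₂ K) ≤ C * opNorm O ∧ ν (kerMatrix ψ₁ ψ₂ K) = ν k := by
  obtain ⟨D, hD⟩ := c.exists_le
  obtain ⟨D', hD'⟩ := Represents.exists_coNorm_le (ψ₂ := ψ₂) (w₂ := w₂) (r := r) (s := s) h₁
  refine ⟨max 1 (max D D'), le_max_left _ _, fun O K hK hOK =>
    ⟨galerkin h₁ O, isGalerkin_coeff_dualElt O h₁ h₂, ?_, ?_, ?_⟩⟩
  · have hfin := (c.spec K hK).1
    have hb := hD' O _ _ (c.represents_kerMatrix h₂ hK hOK) (c.matBdd _)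
    rw [← ENNReal.coe_toNNReal hfin, ← ENNReal.coe_mul] at hb
    refine (iInf_le (fun C : {C : ℝ≥0 // ∀ f, coNorm ψ₂ s w₂⁻¹ (O f) ≤ C * coNorm ψ₁ r w₁ f} =>
      ((C : ℝ≥0) : ℝ≥0∞)) ⟨_, hb⟩).trans ?_
    rw [ENNReal.coe_mul, ENNReal.coe_toNNReal hfin]
    gcongr
    exact (le_max_right _ _).trans (le_max_right _ _)
  · rw [c.kerMatrix_eq_galerkin h₂ hK hOK, opNorm, ENNReal.mul_iInf_of_ne
      (by simp) ENNReal.coe_ne_top]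
    refine le_iInf fun C => (hD O C.1 C.2).trans ?_
    gcongr
    exact (le_max_left _ _).trans (le_max_right _ _)
  · rw [c.kerMatrix_eq_galerkin h₂ hK hOK]

end KernelClass

variable [Countable J]

/-- The kernel theorem for operators from `H¹` to `H^p`. There is no further continuity property, as
the frame expansion converges in the norm of `H¹`. -/
theorem kernelClass_kerRow (h₁ : LocalisedFor ψ₁ w₁) (h₂ : LocalisedFor ψ₂ w₂) (p : ℝ≥0∞)
    [Fact (1 ≤ p)] :
    KernelClass h₁ ψ₂ w₂ 1 p (KerRow ψ₁ ψ₂ p (invTensorWeight w₁ w₂))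
      (rowNorm p ∞ (invTensorWeight w₁ w₂)) fun _ => True where
  spec _ hK := kerRow_spec h₁ h₂ hK
  exists_mem _ hk hfin := exists_mem_kerRow h₁ h₂ hk hfin
  matBdd k := matBdd_rowNorm h₁.pos k
  exists_le := exists_rowNorm_le_of_isBdd h₁
  represents _ hO _ := hO.represents h₁ h₂.pos ENNReal.one_ne_top
  continuity _ _ _ _ _ := trivial

/-- The kernel theorem for operators from `H^p` to `H^∞`. For `p = ∞` the frame expansion need not
converge in norm, and weak-* continuity is required instead. -/
theorem kernelClass_kerCol (h₁ : LocalisedFor ψ₁ w₁) (h₂ : LocalisedFor ψ₂ w₂) {p q : ℝ≥0∞}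
    [Fact (1 ≤ p)] [Fact (1 ≤ q)] (hpq : p.HolderConjugate q) :
    KernelClass h₁ ψ₂ w₂ p ∞ (KerCol ψ₁ ψ₂ q (invTensorWeight w₁ w₂))
      (colNorm q ∞ (invTensorWeight w₁ w₂)) fun O => p = ∞ → IsWeakStarCont w₂ O where
  spec _ hK := kerCol_spec h₁ h₂ hK
  exists_mem _ hk hfin := exists_mem_kerCol h₁ h₂ hk hfin
  matBdd k := matBdd_colNorm h₁.pos hpq k
  exists_le := exists_colNorm_le_of_isBdd h₁ hpq
  represents O hO hP := by
    rcases eq_or_ne p ∞ with rfl | hp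
    · exact (hP rfl).represents h₁ h₂
    · exact hO.represents h₁ h₂.pos hp
  continuity O k hO hk hfin := by
    rintro rfl
    obtain rfl : q = 1 := ENNReal.HolderConjugate.unique ∞ q 1
    exact hO.isWeakStarCont h₁ h₂ hk hfin

/-- A bounded operator from `H¹` to `H^∞` takes its values in `H^p`, boundedly, if and only if the
rows of its matrix are bounded in `ℓ^p`. -/
theorem exists_isBdd_codRestrict_iff (h₁ : LocalisedFor ψ₁ w₁) (h₂ : LocalisedFor ψ₂ w₂) (p : ℝ≥0∞)
    [Fact (1 ≤ p)] {O : Co ψ₁ 1 w₁ →ₗ[ℂ] Co ψ₂ ∞ w₂⁻¹} (hO : Represents (galerkin h₁ O) O) :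
    (∃ O' : Co ψ₁ 1 w₁ →ₗ[ℂ] Co ψ₂ p w₂⁻¹, IsBdd O' ∧ ∀ f, (O' f : GenVec ψ₂) = O f) ↔
      rowNorm p ∞ (invTensorWeight w₁ w₂) (galerkin h₁ O) < ∞ := by
  have c := kernelClass_kerRow h₁ h₂ p
  constructor
  · rintro ⟨O', hO', he⟩
    have e : galerkin h₁ O = galerkin h₁ O' := by
      funext i j
      rw [galerkin, galerkin, he]
    rw [e]
    exact (c.galerkin_ne_top hO').lt_top
  · intro hfin
    obtain ⟨O', hO'⟩ := exists_represents (s := p) h₁ h₂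
      (hO.kerReproducing_galerkin h₁ h₂).right (c.matBdd _) hfin.ne
    refine ⟨O', hO'.isBdd h₁ (c.matBdd _) hfin.ne, fun f => coeff_injective _ ?_⟩
    funext j
    exact (hO' f j).unique (hO f j)

/-- `H¹_w ⊆ H^p_w`, which is read off the coefficients. -/
theorem Co_one_le (h₁ : LocalisedFor ψ₁ w₁) (p : ℝ≥0∞) [hp : Fact (1 ≤ p)] :
    Co ψ₁ 1 w₁ ≤ Co ψ₁ p w₁ := by
  intro f hf
  obtain ⟨hn, hrep⟩ := Co.coeff_spec h₁ hf
  obtain ⟨g, hg, e⟩ := exists_mem_Co h₁ (p := p)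
    (ne_top_of_le_ne_top hn (ellNorm_le_ellNorm_one hp.out _)) hrep
  exact coeff_injective _ e ▸ hg

/-- A bounded operator from `H¹` to `H^∞` extends boundedly to `H^p` if and only if the columns of
its matrix are bounded in the dual `ℓ^q`-space. -/
theorem exists_isBdd_extension_iff (h₁ : LocalisedFor ψ₁ w₁) (h₂ : LocalisedFor ψ₂ w₂)
    {p q : ℝ≥0∞} [Fact (1 ≤ p)] [Fact (1 ≤ q)] (hpq : p.HolderConjugate q)
    {O : Co ψ₁ 1 w₁ →ₗ[ℂ] Co ψ₂ ∞ w₂⁻¹} (hO : Represents (galerkin h₁ O) O) :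
    (∃ O' : Co ψ₁ p w₁ →ₗ[ℂ] Co ψ₂ ∞ w₂⁻¹, IsBdd O' ∧
        ∀ f : Co ψ₁ 1 w₁, ∃ f' : Co ψ₁ p w₁, (f' : GenVec ψ₁) = f ∧ O' f' = O f) ↔
      colNorm q ∞ (invTensorWeight w₁ w₂) (galerkin h₁ O) < ∞ := by
  have c := kernelClass_kerCol h₁ h₂ hpq
  constructor
  · rintro ⟨O', hO', he⟩
    have e : galerkin h₁ O = galerkin h₁ O' := by
      funext i j
      obtain ⟨f', hf', hv⟩ := he (dualElt h₁ 1 i)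
      have : f' = dualElt h₁ p i := Subtype.ext hf'
      rw [galerkin, galerkin, ← hv, this]
    rw [e]
    exact (c.galerkin_ne_top hO').lt_top
  · intro hfin
    obtain ⟨O', hO'⟩ := exists_represents (s := ∞) h₁ h₂
      (hO.kerReproducing_galerkin h₁ h₂).right (c.matBdd _) hfin.ne
    refine ⟨O', hO'.isBdd h₁ (c.matBdd _) hfin.ne, fun f =>
      ⟨⟨f, Co_one_le h₁ p f.2⟩, rfl, Subtype.ext (coeff_injective _ ?_)⟩⟩
    funext j
    exact (hO' ⟨f, Co_one_le h₁ p f.2⟩ j).unique (hO f j)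

end KernelClasses

end CoOrbit

theorem mainTheorem4 {I J H₁ H₂ : Type*} [Countable I] [Countable J]
    [NormedAddCommGroup H₁] [InnerProductSpace ℂ H₁] [CompleteSpace H₁]
    [NormedAddCommGroup H₂] [InnerProductSpace ℂ H₂] [CompleteSpace H₂]
    (A₁ : SpectralMatrixAlgebra I) (A₂ : SpectralMatrixAlgebra J)
    (ψ₁ : I → H₁) (ψ₂ : J → H₂) (hψ₁ : IsLocalised A₁ ψ₁) (hψ₂ : IsLocalised A₂ ψ₂)
    (w₁ : I → ℝ) (w₂ : J → ℝ) (hw₁ : IsAdmissible A₁ w₁) (hw₂ : IsAdmissible A₂ w₂)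
    (p q : ℝ≥0∞) [Fact (1 ≤ p)] [Fact (1 ≤ q)] (hpq : 1 / p + 1 / q = 1) :
    -- (i): operators from `H¹_{w₁}` to `H^p_{1/w₂}`
    (∃ C : ℝ≥0, 1 ≤ C ∧
      (∀ O : Co ψ₁ 1 w₁ →ₗ[ℂ] Co ψ₂ p w₂⁻¹,
        IsBdd O ↔
          ∃! K, K ∈ KerRow ψ₁ ψ₂ p (invTensorWeight w₁ w₂) ∧ IsKernel w₂ O K) ∧
      (∀ K ∈ KerRow ψ₁ ψ₂ p (invTensorWeight w₁ w₂),
        ∃! O : Co ψ₁ 1 w₁ →ₗ[ℂ] Co ψ₂ p w₂⁻¹, IsBdd O ∧ IsKernel w₂ O K) ∧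
      (∀ (O : Co ψ₁ 1 w₁ →ₗ[ℂ] Co ψ₂ p w₂⁻¹),
        ∀ K ∈ KerRow ψ₁ ψ₂ p (invTensorWeight w₁ w₂), IsKernel w₂ O K →
          ∃ k : I → J → ℂ, IsGalerkin w₂ O k ∧
            opNorm O ≤ C * kerRowNorm ψ₁ ψ₂ p (invTensorWeight w₁ w₂) K ∧
            kerRowNorm ψ₁ ψ₂ p (invTensorWeight w₁ w₂) K ≤ C * opNorm O ∧
            kerRowNorm ψ₁ ψ₂ p (invTensorWeight w₁ w₂) K =
              rowNorm p ∞ (invTensorWeight w₁ w₂) k) ∧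
      (∀ O : Co ψ₁ 1 w₁ →ₗ[ℂ] Co ψ₂ ∞ w₂⁻¹, IsBdd O →
        ∃ (K : GenKer ψ₁ ψ₂) (k : I → J → ℂ),
          (K ∈ KerCol ψ₁ ψ₂ ∞ (invTensorWeight w₁ w₂) ∧ IsKernel w₂ O K) ∧
          (∀ K' ∈ KerCol ψ₁ ψ₂ ∞ (invTensorWeight w₁ w₂), IsKernel w₂ O K' → K' = K) ∧
          IsGalerkin w₂ O k ∧
          ((∃ O' : Co ψ₁ 1 w₁ →ₗ[ℂ] Co ψ₂ p w₂⁻¹, IsBdd O' ∧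
              ∀ f, (O' f : GenVec ψ₂) = O f) ↔
            K ∈ KerRow ψ₁ ψ₂ p (invTensorWeight w₁ w₂)) ∧
          ((∃ O' : Co ψ₁ 1 w₁ →ₗ[ℂ] Co ψ₂ p w₂⁻¹, IsBdd O' ∧
              ∀ f, (O' f : GenVec ψ₂) = O f) ↔
            rowNorm p ∞ (invTensorWeight w₁ w₂) k < ∞))) ∧
    -- (ii): operators from `H^p_{w₁}` to `H^∞_{1/w₂}`
    (∃ C : ℝ≥0, 1 ≤ C ∧
      (∀ O : Co ψ₁ p w₁ →ₗ[ℂ] Co ψ₂ ∞ w₂⁻¹,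
        (IsBdd O ∧ (p = ∞ → IsWeakStarCont w₂ O)) ↔
          ∃! K, K ∈ KerCol ψ₁ ψ₂ q (invTensorWeight w₁ w₂) ∧ IsKernel w₂ O K) ∧
      (∀ K ∈ KerCol ψ₁ ψ₂ q (invTensorWeight w₁ w₂),
        ∃! O : Co ψ₁ p w₁ →ₗ[ℂ] Co ψ₂ ∞ w₂⁻¹, IsBdd O ∧ IsKernel w₂ O K) ∧
      (∀ (O : Co ψ₁ p w₁ →ₗ[ℂ] Co ψ₂ ∞ w₂⁻¹),
        ∀ K ∈ KerCol ψ₁ ψ₂ q (invTensorWeight w₁ w₂), IsKernel w₂ O K →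
          ∃ k : I → J → ℂ, IsGalerkin w₂ O k ∧
            opNorm O ≤ C * kerColNorm ψ₁ ψ₂ q (invTensorWeight w₁ w₂) K ∧
            kerColNorm ψ₁ ψ₂ q (invTensorWeight w₁ w₂) K ≤ C * opNorm O ∧
            kerColNorm ψ₁ ψ₂ q (invTensorWeight w₁ w₂) K =
              colNorm q ∞ (invTensorWeight w₁ w₂) k) ∧
      (∀ O : Co ψ₁ 1 w₁ →ₗ[ℂ] Co ψ₂ ∞ w₂⁻¹, IsBdd O →
        ∃ (K : GenKer ψ₁ ψ₂) (k : I → J → ℂ),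
          (K ∈ KerCol ψ₁ ψ₂ ∞ (invTensorWeight w₁ w₂) ∧ IsKernel w₂ O K) ∧
          (∀ K' ∈ KerCol ψ₁ ψ₂ ∞ (invTensorWeight w₁ w₂), IsKernel w₂ O K' → K' = K) ∧
          IsGalerkin w₂ O k ∧
          ((∃ O' : Co ψ₁ p w₁ →ₗ[ℂ] Co ψ₂ ∞ w₂⁻¹, IsBdd O' ∧
              ∀ f : Co ψ₁ 1 w₁, ∃ f' : Co ψ₁ p w₁, (f' : GenVec ψ₁) = f ∧ O' f' = O f) ↔
            K ∈ KerCol ψ₁ ψ₂ q (invTensorWeight w₁ w₂)) ∧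
          ((∃ O' : Co ψ₁ p w₁ →ₗ[ℂ] Co ψ₂ ∞ w₂⁻¹, IsBdd O' ∧
              ∀ f : Co ψ₁ 1 w₁, ∃ f' : Co ψ₁ p w₁, (f' : GenVec ψ₁) = f ∧ O' f' = O f) ↔
            colNorm q ∞ (invTensorWeight w₁ w₂) k < ∞))) := by
  have h₁ := hψ₁.localisedFor hw₁
  have h₂ := hψ₂.localisedFor hw₂
  have hpq' : p.HolderConjugate q := ⟨by simpa using hpq⟩
  have cr := kernelClass_kerRow h₁ h₂ p
  have cc := kernelClass_kerCol h₁ h₂ hpq'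
  have c1 := kernelClass_kerCol h₁ h₂ ENNReal.HolderConjugate.one_top
  obtain ⟨C, hC1, hC⟩ := cr.exists_norm_equiv h₂
  obtain ⟨C', hC1', hC'⟩ := cc.exists_norm_equiv h₂
  refine ⟨⟨C, hC1, fun O => ?_, fun K hK => cr.existsUnique_operator h₂ hK, hC, fun O hO => ?_⟩,
    ⟨C', hC1', cc.isBdd_iff h₂, fun K hK => cc.existsUnique_operator h₂ hK, hC',
      fun O hO => ?_⟩⟩
  · simpa using cr.isBdd_iff h₂ O
  · obtain ⟨K, hK, hOK⟩ := c1.exists_isKernel h₂ hO fun h => absurd h ENNReal.one_ne_top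
    have hrep := c1.represents O hO fun h => absurd h ENNReal.one_ne_top
    have e := c1.kerMatrix_eq_galerkin h₂ hK hOK
    have h := exists_isBdd_codRestrict_iff h₁ h₂ p hrep
    refine ⟨K, galerkin h₁ O, ⟨hK, hOK⟩, fun K' hK' hOK' => c1.isKernel_unique h₂ hK' hOK' hK hOK,
      isGalerkin_coeff_dualElt O h₁ h₂, ?_, h⟩
    rw [h, cr.mem_iff (c1.spec K hK).2, e]
  · obtain ⟨K, hK, hOK⟩ := c1.exists_isKernel h₂ hO fun h => absurd h ENNReal.one_ne_top
    have hrep := c1.represents O hO fun h => absurd h ENNReal.one_ne_top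
    have e := c1.kerMatrix_eq_galerkin h₂ hK hOK
    have h := exists_isBdd_extension_iff h₁ h₂ hpq' hrep
    refine ⟨K, galerkin h₁ O, ⟨hK, hOK⟩, fun K' hK' hOK' => c1.isKernel_unique h₂ hK' hOK' hK hOK,
      isGalerkin_coeff_dualElt O h₁ h₂, ?_, h⟩
    rw [h, cc.mem_iff (c1.spec K hK).2, e]
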